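/- Setting. Let $\mathcal S$ be a finite set, $\mathcal X$ a set, and $\Phi\subseteq(\mathcal X\to\mathcal S)$ a concept class. $\Phi$ is *regular* if $\mathcal X$ and $\mathcal S$ both contain two special elements $0,1$, and every $\phi\in\Phi$ satisfies $\phi(0)=0$, $\phi(1)=1$ and $\phi(x)\notin\{0,1\}$ for $x\notin\{0,1\}$. Its base class $\Phi_0$ consists of the restrictions of the $\phi\in\Phi$ to maps $\mathcal X\setminus\{0,1\}\to\mathcal S\setminus\{0,1\}$. All distributions on $\mathcal X$ are discrete. A $\Phi$-decodable Block MDP with horizon $H$ and finite action set $\mathcal A$ has latent states in $\mathcal S$, an initial latent distribution, latent transitions $s_{h+1}\sim P_{h+1}(\cdot\mid s_h,a_h)$ and observations $x_h\sim O_h(\cdot\mid s_h)$ such that, for some $\phi^\star\in\Phi$, $\phi^\star(x_h)=s_h$ always. $d_h^{M,\pi}(s)$ is the probability that $s_h=s$ under the policy $\pi$. An $(N,K)$-*efficient reward-free episodic RL oracle* for $\Phi$ is a randomized interactive algorithm that, for all $\epsilon,\delta\in(0,1/2)$, $H$, $\mathcal A$ and every such $M$, plays at most $N(\epsilon,\delta,H,|\mathcal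 A|)$ episodes in $M$ and outputs at most $K(\epsilon,\delta,H,|\mathcal A|)$ policies $\Psi$, such that with probability at least $1-\delta$, $\max_{\pi\in\Psi}d_h^{M,\pi}(s)\ge\max_\pi d_h^{M,\pi}(s)-\epsilon$ for all $h\in[H]$, $s\in\mathcal S$. A distribution $D$ on $\mathcal X\times\mathcal X$ is $\phi$-realizable if $D(x_1,x_2)=p(\phi(x_1),\phi(x_2))\,q_1(x_1\mid\phi(x_1))\,q_2(x_2\mid\phi(x_2))$. An algorithm is an $N_{\rm reg}$-*efficient two-context regression algorithm* for $\Phi$ if for all $\epsilon,\delta\in(0,1/2)$, $\phi\in\Phi$, $\phi$-realizable $D$, $f:\mathcal S^2\to[0,1]$ and $n\ge N_{\rm reg}(\epsilon,\delta)$, given $n$ i.i.d. samples $(x_1,x_2)\sim D$, $y\sim\mathrm{Ber}(f(\phi(x_1),\phi(x_2)))$, it outputs a predictor $R:\mathcal X^2\to[0,1]$ such that with probability at least $1-\delta$, $\mathbb E_D(R(x_1,x_2)-f(\phi(x_1),\phi(x_2)))^2\le\epsilon$. The reduction. Write $G(\eta)=\lfloor1/\eta\rfloor+1$, the size of the action grid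 $\{0,\eta,\dots,\eta\lfloor1/\eta\rfloor\}$; a policy is used as a predictor through the (mean) grid value it plays at its first step. * OneRed$(O;\epsilon,\delta)$ on samples $(x,z)$: simulate $O$ with tolerance $\epsilon/4$, failure probability $\delta/2$, horizon 2 and grid $\eta=\sqrt{\epsilon/4}$, with one sample per episode: the first observation is $x$, and after action $a$ the second is $0$ with probability $(a-z)^2$, else $1$. Return the policy of the resulting cover $\Psi$ with the least empirical squared error on the last $\lceil16\epsilon^{-2}\log(4|\Psi|/\delta)\rceil$ samples. * TwoRed$(O;\epsilon,\delta)$, for a base class with $S$ states: on the first half of the samples simulate $O$ with tolerance $\epsilon^2/(4S^2)$, failure probability $\delta/2$, horizon 2 and grid $\eta=\epsilon/(2S)$: the first observation is $x_1$, and after action $a$ the second is $0$ with probability $(a-y)^2$, else $x_2$. For each $\pi$ in the cover $\Psi$ compute $R^\pi$ by OneRed on samples $(x_2,z)$, $z\sim\mathrm{Ber}((\pi(x_1)-y)^2)$, from the second half, with tolerance $\epsilon^4/(16S^4|\Psi|)$ and failure probability $\delta/(2|\Psi|)$. Predict $R(x_1,x_2)=\pi(x_1)$ for the first $\pi\in\Psi$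 minimizing $R^\pi(x_2)$. * TwoAug splits the samples into nine regions according to whether each of $x_1,x_2$ is $0$, $1$ or neither. If both are in $\{0,1\}$ it predicts the empirical mean label; on the other regions it replaces special observations by a fixed $\bar x\notin\{0,1\}$ and calls the base algorithm with $(\epsilon/2,\delta/18)$. The nine predictors are stitched together. RegToRL is TwoAug applied to TwoRed. (If the samples run out before the oracle stops, or if a region or cover is empty, the constant predictor $0$ is used.) **Theorem.** There is an absolute constant $C>0$ such that the following holds for every regular concept class $\Phi\subseteq(\mathcal X\to\mathcal S)$ and every $(N,K)$-efficient reward-free episodic RL oracle $O$ for $\Phi$. 1. Let $S=|\mathcal S|-2$. TwoRed$(O)$ is an $N_2$-efficient two-context regression algorithm for the base class $\Phi_0$, where $$N_2(\epsilon,\delta)=2\Big(N\big(\tfrac{\epsilon^2}{4S^2},\tfrac\delta2,2,G(\tfrac{\epsilon}{2S})\big)+\max_{1\le k\le K'}N_1\big(\tfrac{\epsilon^4}{16S^4k},\tfrac{\delta}{2k}\big)\Big),\qquad K'=K\big(\tfrac{\epsilon^2}{4S^2},\tfrac\delta2,2,G(\tfrac{\epsilon}{2S})\big),$$ $$N_1(\epsilon,\delta)=N\big(\tfrac\epsilon4,\tfrac\delta2,2,G(\sqrt{\epsilon/4})\big)+\Big\lceil\tfrac{16}{\epsilon^2}\log\tfrac{4K(\epsilon/4,\delta/2,2,G(\sqrt{\epsilon/4}))}{\delta}\Big\rceil.$$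 2. Suppose moreover that for all $\epsilon,\delta\in(0,1/2)$ and all $H,|\mathcal A|\ge1$, $$N(\epsilon,\delta,H,|\mathcal A|)\le N_0\Big(\tfrac{H|\mathcal A||\mathcal S|}{\epsilon\delta}\Big)^{c_N},\qquad K(\epsilon,\delta,H,|\mathcal A|)\le K_0\Big(\tfrac{H|\mathcal A||\mathcal S|}{\epsilon\delta}\Big)^{c_K}$$ with $N_0,K_0,c_N\ge1$ and $c_K\ge0$. Then RegToRL$(O)$ is an $N_{\rm reg}$-efficient two-context regression algorithm for $\Phi$, for some $N_{\rm reg}$ with $$N_{\rm reg}(\epsilon,\delta)\le N_0\Big(\tfrac{K_0|\mathcal S|}{\epsilon\delta}\Big)^{C\,c_N(1+c_K)}.$$ 3. Under the assumptions of 2, on $n$ i.i.d. samples as above the oracle time complexity of RegToRL$(O)$ (its number of steps, where an interaction with the oracle, a biased coin flip, an elementary real operation and reading one action probability of an oracle policy each count as one step) is almost surely at most $(n+1)\big(\tfrac{K_0|\mathcal S|}{\epsilon\delta}\big)^{C(1+c_K)^2}$, and its output predictor can be evaluated at any point in at most $\big(\tfrac{K_0|\mathcal S|}{\epsilon\delta}\big)^{C(1+c_K)^2}$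 steps. -/

import Mathlib

open scoped ENNReal

noncomputable section

namespace BlockRL

/-! ## Discrete randomness -/

/-- The Bernoulli distribution with bias `q` (clipped to `[0, 1]`). -/
def ber (q : ℝ) : PMF Bool :=
  PMF.ofFintype
    (fun b => cond b (min (ENNReal.ofReal q) 1) (1 - min (ENNReal.ofReal q) 1))
    (by simp)

/-- `n` independent draws from `p`. -/
def iid {α : Type} (p : PMF α) : ℕ → PMF (List α)
  | 0 => PMF.pure []
  | n + 1 => p.bind fun a => (iid p n).map fun l => a :: l

/-- The value of a label `y ∈ {0, 1}` as a real number. -/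
def bit (b : Bool) : ℝ := cond b 1 0

/-! ## Block MDPs -/

/-- A (stochastic, Markov) policy: `π h x` is the distribution of the action played at step `h`
on observation `x`. Steps are numbered from `0`; a deterministic policy is one whose values are
point masses. -/
abbrev Policy (X : Type) (A : ℕ) : Type := ℕ → X → PMF (Fin A)

/-- A trajectory (or partial trajectory): the observation and the action of each step. -/
abbrev Traj (X : Type) (A : ℕ) : Type := List (X × Fin A)

/-- The latent dynamics and the emissions of a Block MDP with latent states `S`, observations `X`
and `A` actions: initial distribution, transition `trans h` from step `h` to step `h + 1`,
and emission distribution at each step. -/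
structure BlockMDP (S X : Type) (A : ℕ) where
  init : PMF S
  trans : ℕ → S → Fin A → PMF S
  emit : ℕ → S → PMF X

namespace BlockMDP

variable {S X : Type} {A : ℕ}

/-- `φ` decodes the horizon-`H` Block MDP: every state that can be entered at a step `h < H` emits
only observations that `φ` maps back to it. (The emission distribution at a state that no
transition enters is irrelevant; in this form `φ` need not be onto `S`.) -/
def DecodedBy (M : BlockMDP S X A) (H : ℕ) (φ : X → S) : Prop :=
  (∀ s ∈ M.init.support, ∀ x ∈ (M.emit 0 s).support, φ x = s) ∧
  ∀ h, h + 1 < H → ∀ s a, ∀ s' ∈ (M.trans h s a).support,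
    ∀ x ∈ (M.emit (h + 1) s').support, φ x = s'

/-- The distribution of the latent state at step `h` under policy `π`;
`M.visit π h s` is the visitation probability `d_h^{M,π}(s)`. -/
def visit (M : BlockMDP S X A) (π : Policy X A) : ℕ → PMF S
  | 0 => M.init
  | h + 1 => (visit M π h).bind fun s => (M.emit h s).bind fun x =>
      (π h x).bind fun a => M.trans h s a

/-- `k` further steps of interaction, from latent state `s` at step `h`, after the partial
trajectory `past`; the action at each step is drawn by the interacting party, which sees
the partial trajectory and the current observation, but not the latent state. -/
def rollout (M : BlockMDP S X A) (act : Traj X A → X → PMF (Fin A)) :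
    (k h : ℕ) → S → Traj X A → PMF (Traj X A)
  | 0, _, _, past => PMF.pure past
  | k + 1, h, s, past =>
      (M.emit h s).bind fun x => (act past x).bind fun a =>
        (M.trans h s a).bind fun s' => rollout M act k (h + 1) s' (past ++ [(x, a)])

/-- One episode of interaction with the horizon-`H` Block MDP. -/
def episode (M : BlockMDP S X A) (H : ℕ) (act : Traj X A → X → PMF (Fin A)) : PMF (Traj X A) :=
  M.init.bind fun s => M.rollout act H 0 s []

/-- `Ψ` is a `(1, ε)`-policy cover:
`max_{π' ∈ Ψ} d_h^{M,π'}(s) ≥ max_π d_h^{M,π}(s) - ε` for each step `h` and latent state `s`. -/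
def IsCover (M : BlockMDP S X A) (H : ℕ) (ε : ℝ) (Ψ : List (Policy X A)) : Prop :=
  ∀ h < H, ∀ s : S, ∀ π : Policy X A,
    ∃ π' ∈ Ψ, M.visit π h s ≤ M.visit π' h s + ENNReal.ofReal ε

end BlockMDP

/-! ## Reward-free RL with episodic access -/

/-- A randomized interactive algorithm with episodic access, given by its behavior after each
history: from the list of completed episodes it either outputs a set of policies (`some Ψ`) or asks
for another episode (`none`); within an episode, it draws the next action. -/
structure Learner (X : Type) (A : ℕ) where
  next : List (Traj X A) → PMF (Option (List (Policy X A)))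
  act : List (Traj X A) → Traj X A → X → PMF (Fin A)

/-- Run a learner on `M` with at most `k` further episodes; the value is `none` if the learner has
not produced its output by then. -/
def Learner.runOn {S X : Type} {A : ℕ} (L : Learner X A) (M : BlockMDP S X A) (H : ℕ) :
    (k : ℕ) → List (Traj X A) → PMF (Option (List (Policy X A)))
  | 0, hist => L.next hist
  | k + 1, hist => (L.next hist).bind fun o =>
      match o with
      | some Ψ => PMF.pure (some Ψ)
      | none => (M.episode H (L.act hist)).bind fun τ => runOn L M H k (hist ++ [τ])

/-- A reward-free RL oracle takes tolerance `ε`, failure probability `δ`, horizon `H` and a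
nonempty action set of size `A`, and then interacts with an environment. -/
abbrev RLOracle (X : Type) : Type := (ε δ : ℝ) → (H A : ℕ) → [NeZero A] → Learner X A

/-- `O` is an `(N, K)`-efficient reward-free episodic RL oracle for the concept class `Φ`: on every
`Φ`-decodable Block MDP it uses at most `N ε δ H A` episodes, outputs at most `K ε δ H A` policies,
and with probability at least `1 - δ` they form a `(1, ε)`-policy cover. -/
def IsEfficientRL {X S : Type} (Φ : Set (X → S)) (O : RLOracle X)
    (N K : ℝ → ℝ → ℕ → ℕ → ℕ) : Prop :=
  ∀ ε ∈ Set.Ioo (0 : ℝ) (1 / 2), ∀ δ ∈ Set.Ioo (0 : ℝ) (1 / 2), ∀ H : ℕ, 1 ≤ H →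
  ∀ (A : ℕ) [NeZero A], ∀ φ ∈ Φ, ∀ M : BlockMDP S X A, M.DecodedBy H φ →
    (∀ o ∈ ((O ε δ H A).runOn M H (N ε δ H A) []).support,
      ∃ Ψ, o = some Ψ ∧ Ψ.length ≤ K ε δ H A) ∧
    ENNReal.ofReal (1 - δ) ≤
      ((O ε δ H A).runOn M H (N ε δ H A) []).toOuterMeasure
        {o | ∃ Ψ, o = some Ψ ∧ M.IsCover H ε Ψ}

/-! ## Step-counted computation -/

/-- A deterministic computation: its result and the number of steps it took. -/
structure Timed (α : Type) where
  val : α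
  cost : ℕ

instance : Monad Timed where
  pure a := ⟨a, 0⟩
  bind x f := ⟨(f x.val).val, x.cost + (f x.val).cost⟩

/-- One step: an expression of bounded size in arithmetic operations, elementary functions and
comparisons of numbers, or one equality test or table access. -/
def op {α : Type} (a : α) : Timed α := ⟨a, 1⟩

/-- `k` steps, spent on traversing or copying a list of length `k`. -/
def charge (k : ℕ) : Timed Unit := ⟨(), k⟩

/-- A randomized computation: the joint distribution of its result and its number of steps. -/
structure Comp (α : Type) where
  run : PMF (Timed α)

instance : Monad Comp where
  pure a := ⟨PMF.pure ⟨a, 0⟩⟩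
  bind x f := ⟨x.run.bind fun a => (f a.val).run.map fun b => ⟨b.val, a.cost + b.cost⟩⟩

instance : MonadLift Timed Comp where
  monadLift x := ⟨PMF.pure x⟩

/-- One step, spent on a message to and a randomized answer from the oracle, or on a coin flip. -/
def ask {α : Type} (p : PMF α) : Comp α := ⟨p.map op⟩

/-- Run `f` on each element of a list in turn. -/
def forEach {α β : Type} (f : α → Comp β) : List α → Comp (List β)
  | [] => pure []
  | a :: l => do
      let b ← f a
      let bs ← forEach f l
      return b :: bs

/-- The first minimizer of `score` in `l`, if it scores strictly less than `v`, and otherwise the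
element `b`, which has score `v`. -/
def argminAux {α : Type} (score : α → Timed ℝ) : List α → α → ℝ → Timed α
  | [], b, _ => pure b
  | a :: l, b, v => do
      let w ← score a
      let better ← op (decide (w < v))
      if better then argminAux score l a w else argminAux score l b v

/-- The first minimizer of `score` in the nonempty list `a :: l`. -/
def argmin {α : Type} (score : α → Timed ℝ) (a : α) (l : List α) : Timed α := do
  let v ← score a
  argminAux score l a v

/-! ## Regression -/

/-- A predictor that can be evaluated step by step. -/
abbrev Predictor1 (X : Type) : Type := X → Timed ℝ

/-- A predictor that can be evaluated step by step. -/
abbrev Predictor2 (X : Type) : Type := X → X → Timed ℝ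

/-- A two-context regression algorithm takes samples `(x₁, x₂, y)`, a tolerance and a failure
probability. -/
abbrev TwoContextAlg (X : Type) : Type :=
  List (X × X × Bool) → (ε δ : ℝ) → Comp (Predictor2 X)

/-- `D` is `φ`-realizable: `x₁` and `x₂` are linked through their latent states only, that is,
`D(x₁, x₂) = p(φ x₁, φ x₂) q₁(x₁ | φ x₁) q₂(x₂ | φ x₂)`. -/
def Realizable {X S : Type} (φ : X → S) (D : PMF (X × X)) : Prop :=
  ∃ (p : PMF (S × S)) (q₁ q₂ : S → PMF X), ∀ x₁ x₂,
    D (x₁, x₂) = p (φ x₁, φ x₂) * q₁ (φ x₁) x₁ * q₂ (φ x₂) x₂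

/-- The law of a sample: `(x₁, x₂) ∼ D` and `y ∼ Ber(f(φ x₁, φ x₂))`. -/
def sampleLaw {X S : Type} (φ : X → S) (D : PMF (X × X)) (f : S → S → ℝ) :
    PMF (X × X × Bool) :=
  D.bind fun p => (ber (f (φ p.1) (φ p.2))).map fun y => (p.1, p.2, y)

/-- The output, and the number of steps, of an algorithm that is run on `n` i.i.d. samples. -/
def regressionLaw {X S : Type} (alg : TwoContextAlg X) (φ : X → S) (D : PMF (X × X))
    (f : S → S → ℝ) (n : ℕ) (ε δ : ℝ) : PMF (Timed (Predictor2 X)) :=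
  (iid (sampleLaw φ D f) n).bind fun data => (alg data ε δ).run

/-- `alg` is an `N`-efficient two-context regression algorithm for the concept class `Φ`: from
`n ≥ N ε δ` samples it computes a predictor with values in `[0, 1]`, and with probability at
least `1 - δ` the mean squared error of that predictor is at most `ε`. -/
def IsEfficientTwoContext {X S : Type} (Φ : Set (X → S)) (alg : TwoContextAlg X)
    (N : ℝ → ℝ → ℕ) : Prop :=
  ∀ ε ∈ Set.Ioo (0 : ℝ) (1 / 2), ∀ δ ∈ Set.Ioo (0 : ℝ) (1 / 2), ∀ n : ℕ, N ε δ ≤ n →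
  ∀ φ ∈ Φ, ∀ D : PMF (X × X), Realizable φ D →
  ∀ f : S → S → ℝ, (∀ s t, f s t ∈ Set.Icc (0 : ℝ) 1) →
    (∀ o ∈ (regressionLaw alg φ D f n ε δ).support,
      ∀ x₁ x₂, (o.val x₁ x₂).val ∈ Set.Icc (0 : ℝ) 1) ∧
    ENNReal.ofReal (1 - δ) ≤
      (regressionLaw alg φ D f n ε δ).toOuterMeasure
        {o | ∑' p : X × X, D p *
            ENNReal.ofReal (((o.val p.1 p.2).val - f (φ p.1) (φ p.2)) ^ 2) ≤ ENNReal.ofReal ε}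

/-- A two-context regression algorithm with (almost surely) at most `T n ε δ` steps on `n` i.i.d.
samples that are realizable for `Φ`, whose output predictor can be evaluated at every point in at
most `E ε δ` steps. -/
def RunsInTime {X S : Type} (Φ : Set (X → S)) (alg : TwoContextAlg X)
    (T : ℕ → ℝ → ℝ → ℝ) (E : ℝ → ℝ → ℝ) : Prop :=
  ∀ ε ∈ Set.Ioo (0 : ℝ) (1 / 2), ∀ δ ∈ Set.Ioo (0 : ℝ) (1 / 2), ∀ n : ℕ,
  ∀ φ ∈ Φ, ∀ D : PMF (X × X), Realizable φ D →
  ∀ f : S → S → ℝ, (∀ s t, f s t ∈ Set.Icc (0 : ℝ) 1) →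
    ∀ o ∈ (regressionLaw alg φ D f n ε δ).support,
      (o.cost : ℝ) ≤ T n ε δ ∧ ∀ x₁ x₂, ((o.val x₁ x₂).cost : ℝ) ≤ E ε δ

/-! ## Regular concept classes -/

/-- A concept class `Φ ⊆ (X → S)` is regular: `X` and `S` both contain two special elements `0, 1`
(`ιX false, ιX true` and `ιS false, ιS true`), each concept maps the special observations
identically to the special states, and it maps no other observation to a special state. -/
def IsRegular {X S : Type} (ιX : Bool → X) (ιS : Bool → S) (Φ : Set (X → S)) : Prop :=
  Function.Injective ιX ∧ Function.Injective ιS ∧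
  ∀ φ ∈ Φ, (∀ b, φ (ιX b) = ιS b) ∧ ∀ x, x ∉ Set.range ιX → φ x ∉ Set.range ιS

/-- The base class of a regular class: the concepts restricted to the observations other than
`0, 1`, as maps into the states other than `0, 1`. -/
def baseClass {X S : Type} (ιX : Bool → X) (ιS : Bool → S) (Φ : Set (X → S)) :
    Set ({x // x ∉ Set.range ιX} → {s // s ∉ Set.range ιS}) :=
  {ψ | ∃ φ ∈ Φ, ∀ x, φ x.1 = (ψ x).1}

/-! ## The reduction -/

section Reduction

variable {X : Type}

/-- Simulate a horizon-2 episode per sample for the learner `L`: the first observation is `fst d`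
and the second one is drawn by `snd d a`, where `d` is the sample and `a` the action. The
simulation stops when `L` returns its policies, or when the samples are used up. -/
def simulate {A : ℕ} {δ : Type} (L : Learner X A) (fst : δ → X) (snd : δ → Fin A → Comp X) :
    List δ → List (Traj X A) → Comp (Option (List (Policy X A)))
  | [], hist => ask (L.next hist)
  | d :: ds, hist => do
      let o ← ask (L.next hist)
      match o with
      | some Ψ => return some Ψ
      | none => do
          let x₁ ← op (fst d)
          let a₁ ← ask (L.act hist [] x₁)
          let x₂ ← snd d a₁
          let a₂ ← ask (L.act hist [(x₁, a₁)] x₂)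
          simulate L fst snd ds (hist ++ [[(x₁, a₁), (x₂, a₂)]])

/-- Number of points of the grid `{0, η, 2η, …, η ⌊1/η⌋} ⊆ [0, 1]`; action `a` stands for `a η`. -/
def gridSize (η : ℝ) : ℕ := ⌊1 / η⌋₊ + 1

instance (η : ℝ) : NeZero (gridSize η) := ⟨Nat.succ_ne_zero _⟩

/-- The number in `[0, 1]` that a policy plays at its first step on `x`: the grid point it plays
(its mean, if the policy is randomized). One step per action. -/
def playedValue {A : ℕ} (η : ℝ) (π : Policy X A) (x : X) : Timed ℝ := do
  charge A
  return ∑ a : Fin A, ((π 0 x) a).toReal * ((a : ℕ) * η)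

/-- `(v - y)²`, the squared error of the prediction `v` for the label `y`. -/
def sqErr (v : ℝ) (y : Bool) : Timed ℝ := op ((v - bit y) ^ 2)

/-- The sum of the squared errors of a predictor over a list of samples. -/
def sumSqErr (R : Predictor1 X) : List (X × Bool) → Timed ℝ
  | [] => op 0
  | (x, y) :: l => do
      let v ← R x
      let e ← sqErr v y
      let r ← sumSqErr R l
      op (e + r)

/-- One-context regression by reward-free RL over the class augmented with `0, 1`
(`zero` and `one` are the two special observations). -/
def oneRed (O : RLOracle X) (zero one : X) (data : List (X × Bool)) (ε δ : ℝ) :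
    Comp (Predictor1 X) := do
  let η ← op (Real.sqrt (ε / 4))
  let o ← simulate (O (ε / 4) (δ / 2) 2 (gridSize η)) Prod.fst
    (fun d a => do
      let q ← sqErr ((a : ℕ) * η) d.2
      let fail ← ask (ber q)
      op (if fail then zero else one)) data []
  match o with
  | none => return fun _ => op 0
  | some [] => return fun _ => op 0
  | some (π₀ :: Ψ) => do
      charge (Ψ.length + 1)
      let m ← op ⌈16 / ε ^ 2 * Real.log (4 * ((Ψ.length + 1 : ℕ) : ℝ) / δ)⌉₊
      charge data.length
      let test := data.drop (data.length - m)
      let best ← argmin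
        (fun π => do
          let r ← sumSqErr (playedValue η π) test
          op (r / m)) π₀ Ψ
      return playedValue η best

/-- Relabel a sample `(x₁, x₂, y)` by `(x₂, z)` with `z ∼ Ber((π(x₁) - y)²)`. -/
def relabel (R : Predictor1 X) (d : X × X × Bool) : Comp (X × Bool) := do
  let v ← R d.1
  let q ← sqErr v d.2.2
  let z ← ask (ber q)
  return (d.2.1, z)

/-- Two-context regression over a base class with `S` latent states, by reward-free RL over the
class augmented with `0, 1`. A horizon-2 Block MDP is simulated on the first half of the samples;
for each policy of the resulting cover, its error given `x₂` is estimated on the second half; the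
final predictor answers `(x₁, x₂)` with the value played on `x₁` by the policy whose
estimated error at `x₂` is least. -/
def twoRed (O : RLOracle X) (zero one : X) (S : ℕ) : TwoContextAlg X := fun data ε δ => do
  let η ← op (ε / (2 * (S : ℝ)))
  charge data.length
  let fstHalf := data.take (data.length / 2)
  let sndHalf := data.drop (data.length / 2)
  let o ← simulate (O (ε ^ 2 / (4 * (S : ℝ) ^ 2)) (δ / 2) 2 (gridSize η)) (fun d => d.1)
    (fun d a => do
      let q ← sqErr ((a : ℕ) * η) d.2.2
      let fail ← ask (ber q)
      op (if fail then zero else d.2.1)) fstHalf []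
  match o with
  | none => return fun _ _ => op 0
  | some Ψ => do
      charge Ψ.length
      let ε₁ ← op (ε ^ 4 / (16 * (S : ℝ) ^ 4 * (Ψ.length : ℝ)))
      let δ₁ ← op (δ / (2 * (Ψ.length : ℝ)))
      let scored ← forEach
        (fun π => do
          let c ← forEach (relabel (playedValue η π)) sndHalf
          let R ← oneRed O zero one c ε₁ δ₁
          return (π, R)) Ψ
      match scored with
      | [] => return fun _ _ => op 0
      | p :: ps => return fun x₁ x₂ => do
          let best ← argmin (fun q => q.2 x₂) p ps
          playedValue η best.1 x₁

open Classical in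
/-- Which of `0` (`some false`), `1` (`some true`) or neither (`none`) the observation `x` is. -/
def kind (ιX : Bool → X) (x : X) : Timed (Option Bool) := do
  let isZero ← op (decide (x = ιX false))
  if isZero then return some false
  else do
    let isOne ← op (decide (x = ιX true))
    if isOne then return some true else return none

/-- Replace an observation of kind `0` or `1` by the fixed observation `xbar`. -/
def toBase (xbar : X) (k : Option Bool) (x : X) : X := if k.isSome then xbar else x

/-- The samples whose two observations are of the kinds `r`, with observations of kinds `0, 1`
replaced by `xbar`. -/
def select (ιX : Bool → X) (xbar : X) (r : Option Bool × Option Bool) :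
    List (X × X × Bool) → Timed (List (X × X × Bool))
  | [] => pure []
  | d :: l => do
      let k₁ ← kind ιX d.1
      let k₂ ← kind ιX d.2.1
      let rest ← select ιX xbar r l
      let keep ← op (decide ((k₁, k₂) = r))
      if keep then return (toBase xbar k₁ d.1, toBase xbar k₂ d.2.1, d.2.2) :: rest
      else return rest

/-- The sum of the labels. -/
def sumLabels : List (X × X × Bool) → Timed ℝ
  | [] => op 0
  | d :: l => do
      let r ← sumLabels l
      op (bit d.2.2 + r)

/-- The nine regions of the covariate space. -/
def regions : List (Option Bool × Option Bool) :=
  [(none, none), (none, some false), (none, some true),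
   (some false, none), (some false, some false), (some false, some true),
   (some true, none), (some true, some false), (some true, some true)]

/-- Fit one region. The samples of the region become samples for the base class; if both
observations are in `{0, 1}` there is only a constant to estimate. -/
def fitRegion (alg : TwoContextAlg X) (ιX : Bool → X) (xbar : X) (data : List (X × X × Bool))
    (ε δ : ℝ) (r : Option Bool × Option Bool) : Comp (Predictor2 X) := do
  let sub ← select ιX xbar r data
  match sub with
  | [] => return fun _ _ => op 0
  | d :: l => do
      if r.1.isSome && r.2.isSome then
        let t ← sumLabels (d :: l)
        charge (l.length + 1)
        let v ← op (t / ((l.length + 1 : ℕ) : ℝ))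
        return fun _ _ => op v
      else alg (d :: l) (ε / 2) (δ / 18)

/-- Two-context regression over a regular class from two-context regression over its base class:
treat the nine regions separately and stitch the predictors together. -/
def twoAug (alg : TwoContextAlg X) (ιX : Bool → X) (xbar : X) : TwoContextAlg X :=
  fun data ε δ => do
    let table ← forEach
      (fun r => do
        let R ← fitRegion alg ιX xbar data ε δ r
        return (r, R)) regions
    return fun x₁ x₂ => do
      let k₁ ← kind ιX x₁
      let k₂ ← kind ιX x₂
      charge 9
      match table.find? (fun p => decide (p.1 = (k₁, k₂))) with
      | none => op 0
      | some p => p.2 (toBase xbar k₁ x₁) (toBase xbar k₂ x₂)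

/-- The reduction from two-context regression over a regular class with `S` latent states to
reward-free episodic RL over the same class. -/
def regToRL (O : RLOracle X) (ιX : Bool → X) (xbar : X) (S : ℕ) : TwoContextAlg X :=
  twoAug (twoRed O (ιX false) (ιX true) (S - 2)) ιX xbar

/-- `twoRed`, as an algorithm on the observations of the base class. -/
def twoRedBase (O : RLOracle X) (ιX : Bool → X) (S : ℕ) :
    TwoContextAlg {x // x ∉ Set.range ιX} := fun data ε δ => do
  let R ← twoRed O (ιX false) (ιX true) S (data.map fun d => (d.1.1, d.2.1.1, d.2.2)) ε δ
  return fun x₁ x₂ => R x₁.1 x₂.1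

end Reduction

/-! ## Sample sizes -/

/-- Sample size of `oneRed` with an `(N, K)`-efficient oracle. -/
def oneRedSamples (N K : ℝ → ℝ → ℕ → ℕ → ℕ) (ε δ : ℝ) : ℕ :=
  N (ε / 4) (δ / 2) 2 (gridSize (Real.sqrt (ε / 4))) +
    ⌈16 / ε ^ 2 *
      Real.log (4 * (K (ε / 4) (δ / 2) 2 (gridSize (Real.sqrt (ε / 4))) : ℝ) / δ)⌉₊

/-- Size bound for the policy cover in `twoRed` with `S` latent states. -/
def coverSize (K : ℝ → ℝ → ℕ → ℕ → ℕ) (S : ℕ) (ε δ : ℝ) : ℕ :=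
  K (ε ^ 2 / (4 * (S : ℝ) ^ 2)) (δ / 2) 2 (gridSize (ε / (2 * (S : ℝ))))

/-- Sample size of `twoRed` with an `(N, K)`-efficient oracle and `S` latent states. -/
def twoRedSamples (N K : ℝ → ℝ → ℕ → ℕ → ℕ) (S : ℕ) (ε δ : ℝ) : ℕ :=
  2 * (N (ε ^ 2 / (4 * (S : ℝ) ^ 2)) (δ / 2) 2 (gridSize (ε / (2 * (S : ℝ)))) +
    (Finset.Icc 1 (coverSize K S ε δ)).sup fun k =>
      oneRedSamples N K (ε ^ 4 / (16 * (S : ℝ) ^ 4 * (k : ℝ))) (δ / (2 * (k : ℝ))))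

end BlockRL

end

noncomputable section

namespace BlockRL

/-! ## Expectations and probabilities -/

section Expect

variable {α β γ : Type}

/-! The whole reduction rests on one identity. If `y ∼ Ber(c)` and an episode fails with probability
`(v - y)²`, then averaging over `y` it fails with probability `labelLoss v c = (v - c)² + c(1 - c)`
(`expect_ber_ber`). The label disappears, and what remains depends on the latent state only. An
episode simulated from one fresh labeled sample is therefore distributed exactly like an episode of
a genuine Block MDP (`simulates_oneMDP`, `simulates_twoMDP`, `Simulates.law_simulate`), and the
oracle's guarantee applies. Since the variance `c(1 - c)` does not depend on the policy, comparing
success probabilities is the same as comparing squared errors (`expect_sq_le_of_success`).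

With one context, reaching state `1` means not failing. The cover thus contains a policy nearly as
good as rounding the regression function to the grid, and empirical risk on fresh samples finds one
of comparable quality (`prob_argmin_le`, `prob_oneRed_le`).

With two contexts, a successful episode moves to the second latent state `t`. To reach `t` often, a
policy must predict `f(·, t)` well on the event `s₂ = t`, and for fixed `t` this is a function of
the first context alone. So each `t` has its own good policy in the cover (`exists_good_policy`).
The state `t` is not observed, but given `x₂` the loss of a fixed policy depends on `φ x₂` only, so
it can be estimated by one-context regression on relabeled samples (`bind_relabel`,
`prob_twoFit_le`). Choosing the policy with the least estimate costs the estimation errors of two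
policies, which AM-GM converts into mean squared errors (`condExpect_argmin_le`,
`expect_sq_select_le`). The result is `prob_twoRed_le`.

For the regular class, concepts preserve the kind (`0`, `1` or neither) of an observation, so
conditioning on one of the nine regions leaves a realizable law (`expect_region`), and the samples
in a region are i.i.d. from it given their number (`expect_iid_filterMap`). Unlikely regions
contribute little error, and likely ones receive enough samples by Hoeffding's inequality
(`isEfficientTwoContext_regToRL`).

Running times are bounded by a small calculus of almost sure step bounds (`CostLe`). The needed
bounds on cover sizes hold for every possible data set (`Simulates.length_le`), because any
simulated run is a possible run in a decodable Block MDP. The exponents then come from absorbing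
every parameter into powers of one base (`ParamBound`). -/

/-- The expectation of a nonnegative function under a discrete distribution. -/
def expect (p : PMF α) (F : α → ℝ≥0∞) : ℝ≥0∞ := ∑' a, p a * F a

theorem expect_pure (a : α) (F : α → ℝ≥0∞) : expect (PMF.pure a) F = F a := by
  unfold expect
  rw [tsum_eq_single a]
  · simp
  · intro b hb
    simp [PMF.pure_apply, hb]

theorem expect_bind (p : PMF α) (f : α → PMF β) (F : β → ℝ≥0∞) :
    expect (p.bind f) F = expect p fun a => expect (f a) F := by
  unfold expect
  simp_rw [PMF.bind_apply, ← ENNReal.tsum_mul_right, ← ENNReal.tsum_mul_left]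
  rw [ENNReal.tsum_comm]
  simp_rw [mul_assoc]

theorem expect_map (p : PMF α) (f : α → β) (F : β → ℝ≥0∞) :
    expect (p.map f) F = expect p fun a => F (f a) := by
  rw [← PMF.bind_pure_comp, expect_bind]
  simp [expect_pure]

theorem expect_mono {p : PMF α} {F G : α → ℝ≥0∞} (h : ∀ a ∈ p.support, F a ≤ G a) :
    expect p F ≤ expect p G := by
  refine ENNReal.tsum_le_tsum fun a => ?_
  by_cases ha : p a = 0
  · simp [ha]
  · gcongr
    exact h a ((PMF.mem_support_iff _ _).2 ha)

theorem expect_congr {p : PMF α} {F G : α → ℝ≥0∞} (h : ∀ a ∈ p.support, F a = G a) :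
    expect p F = expect p G :=
  le_antisymm (expect_mono fun a ha => (h a ha).le) (expect_mono fun a ha => (h a ha).ge)

theorem expect_const (p : PMF α) (c : ℝ≥0∞) : expect p (fun _ => c) = c := by
  unfold expect
  rw [ENNReal.tsum_mul_right, p.tsum_coe, one_mul]

theorem expect_le_of_le {p : PMF α} {F : α → ℝ≥0∞} {c : ℝ≥0∞} (h : ∀ a ∈ p.support, F a ≤ c) :
    expect p F ≤ c :=
  (expect_mono h).trans (expect_const p c).le

theorem expect_add (p : PMF α) (F G : α → ℝ≥0∞) :
    expect p (fun a => F a + G a) = expect p F + expect p G := by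
  simp only [expect, mul_add, ENNReal.tsum_add]

theorem expect_const_mul (p : PMF α) (c : ℝ≥0∞) (F : α → ℝ≥0∞) :
    expect p (fun a => c * F a) = c * expect p F := by
  simp only [expect, ← ENNReal.tsum_mul_left, mul_left_comm]

theorem expect_mul_const (p : PMF α) (c : ℝ≥0∞) (F : α → ℝ≥0∞) :
    expect p (fun a => F a * c) = expect p F * c := by
  simp only [expect, ← ENNReal.tsum_mul_right, mul_assoc]

theorem expect_finset_sum {ι : Type} (p : PMF α) (s : Finset ι) (F : ι → α → ℝ≥0∞) :
    expect p (fun a => ∑ i ∈ s, F i a) = ∑ i ∈ s, expect p (F i) := by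
  classical
  induction s using Finset.induction_on with
  | empty => simp [expect_const]
  | insert i s hi ih => simp [Finset.sum_insert hi, expect_add, ih]

theorem expect_list_sum {ι : Type} (p : PMF α) (l : List ι) (F : ι → α → ℝ≥0∞) :
    expect p (fun a => (l.map fun i => F i a).sum) = (l.map fun i => expect p (F i)).sum := by
  induction l with
  | nil => simp [expect_const]
  | cons i l ih => simp [expect_add, ih]

theorem expect_comm (p : PMF α) (q : PMF β) (F : α → β → ℝ≥0∞) :
    expect p (fun a => expect q fun b => F a b) = expect q fun b => expect p fun a => F a b := by
  simp only [expect, ← ENNReal.tsum_mul_left]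
  rw [ENNReal.tsum_comm]
  simp only [mul_left_comm]

theorem expect_fintype [Fintype α] (p : PMF α) (F : α → ℝ≥0∞) :
    expect p F = ∑ a, p a * F a := tsum_fintype _

-- Reduces equality of laws to a computation with `expect`, where sums can be exchanged freely.
-- Indicators of points suffice as test functions.
open Classical in
theorem ext_of_expect {p q : PMF α} (h : ∀ F, expect p F = expect q F) : p = q := by
  refine PMF.ext fun a => ?_
  have := h fun b => if b = a then 1 else 0
  simpa [expect] using this

theorem expect_eq_zero {p : PMF α} {F : α → ℝ≥0∞} (h : expect p F = 0) :
    ∀ a ∈ p.support, F a = 0 := by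
  intro a ha
  have := ENNReal.tsum_eq_zero.1 h a
  exact (mul_eq_zero.1 this).resolve_left ((PMF.mem_support_iff _ _).1 ha)

open Classical in
/-- The probability of an event. -/
def prob (p : PMF α) (P : α → Prop) : ℝ≥0∞ := expect p fun a => if P a then 1 else 0

theorem prob_bind (p : PMF α) (f : α → PMF β) (P : β → Prop) :
    prob (p.bind f) P = expect p fun a => prob (f a) P := expect_bind _ _ _

theorem prob_pure_of_not {a : α} {P : α → Prop} (h : ¬ P a) : prob (PMF.pure a) P = 0 := by
  simp [prob, expect_pure, h]

theorem prob_map (p : PMF α) (f : α → β) (P : β → Prop) :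
    prob (p.map f) P = prob p fun a => P (f a) := expect_map _ _ _

theorem expect_prob_pure (p : PMF α) (f : α → β) (P : β → Prop) :
    expect p (fun a => prob (PMF.pure (f a)) P) = prob p fun a => P (f a) := by
  simp only [prob, expect_pure]

theorem prob_le_one (p : PMF α) (P : α → Prop) : prob p P ≤ 1 :=
  expect_le_of_le fun a _ => by split_ifs <;> simp

theorem prob_mono {p : PMF α} {P Q : α → Prop} (h : ∀ a ∈ p.support, P a → Q a) :
    prob p P ≤ prob p Q := by
  refine expect_mono fun a ha => ?_
  have := h a ha
  split_ifs <;> simp_all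

theorem prob_eq_zero {p : PMF α} {P : α → Prop} (h : ∀ a ∈ p.support, ¬ P a) : prob p P = 0 := by
  refine le_antisymm (expect_le_of_le fun a ha => ?_) zero_le
  simp [h a ha]

theorem prob_or_le (p : PMF α) (P Q : α → Prop) :
    prob p (fun a => P a ∨ Q a) ≤ prob p P + prob p Q := by
  unfold prob
  rw [← expect_add]
  refine expect_mono fun a _ => ?_
  by_cases hP : P a <;> by_cases hQ : Q a <;> simp [hP, hQ]

theorem prob_exists_mem_le {ι : Type} (p : PMF α) (l : List ι) (P : ι → α → Prop) :
    prob p (fun a => ∃ i ∈ l, P i a) ≤ (l.map fun i => prob p (P i)).sum := by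
  induction l with
  | nil => simp [prob, expect_const]
  | cons i l ih =>
    simp only [List.mem_cons, exists_eq_or_imp, List.map_cons, List.sum_cons]
    exact (prob_or_le p _ _).trans (by gcongr)

/-- Markov's inequality. -/
theorem prob_le_expect {p : PMF α} {P : α → Prop} {F : α → ℝ≥0∞}
    (h : ∀ a ∈ p.support, P a → 1 ≤ F a) : prob p P ≤ expect p F := by
  refine expect_mono fun a ha => ?_
  split_ifs with hP
  · exact h a ha hP
  · exact zero_le

/-- The union bound for two successive stages: the second-stage probability is at most the indicator
of a first-stage failure plus `b`. -/
theorem prob_bind_le {p : PMF α} {f : α → PMF β} {P : α → Prop} {Q : β → Prop} {a b : ℝ≥0∞}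
    (h₁ : prob p P ≤ a) (h₂ : ∀ x ∈ p.support, ¬ P x → prob (f x) Q ≤ b) :
    prob (p.bind f) Q ≤ a + b := by
  rw [prob_bind]
  calc expect p (fun x => prob (f x) Q)
      ≤ expect p (fun x => (@ite _ (P x) (Classical.dec _) 1 0) + b) := by
        refine expect_mono fun x hx => ?_
        by_cases hP : P x
        · simpa [hP] using (prob_le_one _ _).trans le_self_add
        · simpa [hP] using h₂ x hx hP
    _ ≤ a + b := by
        rw [expect_add, expect_const]
        gcongr
        refine le_trans (le_of_eq ?_) h₁
        unfold prob
        congr 1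

theorem prob_add_prob_not (p : PMF α) (P : α → Prop) : prob p P + prob p (fun a => ¬ P a) = 1 := by
  unfold prob
  rw [← expect_add]
  refine (expect_congr fun a _ => ?_).trans (expect_const p 1)
  by_cases h : P a <;> simp [h]

theorem toOuterMeasure_eq_prob (p : PMF α) (P : α → Prop) :
    p.toOuterMeasure {a | P a} = prob p P := by
  rw [PMF.toOuterMeasure_apply]
  refine tsum_congr fun a => ?_
  by_cases h : P a <;> simp [h, Set.indicator]

/-- The definitions speak of success probabilities, but failure probabilities are what add up. This
passes between the two. -/
theorem le_toOuterMeasure_iff {p : PMF α} {P : α → Prop} {δ : ℝ} (h₀ : 0 ≤ δ) (h₁ : δ ≤ 1) :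
    ENNReal.ofReal (1 - δ) ≤ p.toOuterMeasure {a | P a} ↔
      prob p (fun a => ¬ P a) ≤ ENNReal.ofReal δ := by
  rw [toOuterMeasure_eq_prob]
  have key := prob_add_prob_not p P
  have hδ : ENNReal.ofReal (1 - δ) + ENNReal.ofReal δ = 1 := by
    rw [← ENNReal.ofReal_add (by linarith) h₀]; simp
  constructor
  · intro h
    by_contra! hlt
    have : ENNReal.ofReal (1 - δ) + ENNReal.ofReal δ < prob p P + prob p (fun a => ¬ P a) :=
      ENNReal.add_lt_add_of_le_of_lt ENNReal.ofReal_ne_top h hlt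
    rw [hδ, key] at this
    exact lt_irrefl _ this
  · intro h
    by_contra! hlt
    have : prob p P + prob p (fun a => ¬ P a) < ENNReal.ofReal (1 - δ) + ENNReal.ofReal δ :=
      ENNReal.add_lt_add_of_lt_of_le
        (ne_top_of_le_ne_top ENNReal.ofReal_ne_top h) hlt h
    rw [hδ, key] at this
    exact lt_irrefl _ this

/-- Both sides have total mass `1`, so a strict inequality at one point would make the total masses
differ. -/
theorem eq_of_forall_le {p q : PMF α} (h : ∀ a, p a ≤ q a) : p = q := by
  refine PMF.ext fun a => le_antisymm (h a) ?_
  by_contra! hlt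
  have : ∑' a, p a < ∑' a, q a :=
    ENNReal.tsum_lt_tsum (by rw [p.tsum_coe]; simp) h hlt
  rw [p.tsum_coe, q.tsum_coe] at this
  exact lt_irrefl _ this

end Expect

/-! ## Bernoulli variables and i.i.d. sequences -/

theorem expect_ber {q : ℝ} (hq : q ∈ Set.Icc (0 : ℝ) 1) (F : Bool → ℝ≥0∞) :
    expect (ber q) F = ENNReal.ofReal q * F true + ENNReal.ofReal (1 - q) * F false := by
  rw [expect_fintype, Fintype.sum_bool]
  have h : ENNReal.ofReal q ≤ 1 := by simpa using hq.2
  simp only [ber, PMF.ofFintype_apply, cond_true, cond_false, min_eq_left h]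
  rw [ENNReal.ofReal_sub _ hq.1, ENNReal.ofReal_one]

section Iid

variable {α β : Type}

theorem expect_iid_zero (p : PMF α) (F : List α → ℝ≥0∞) : expect (iid p 0) F = F [] :=
  expect_pure _ _

theorem expect_iid_succ (p : PMF α) (n : ℕ) (F : List α → ℝ≥0∞) :
    expect (iid p (n + 1)) F = expect p fun a => expect (iid p n) fun l => F (a :: l) := by
  simp only [iid, expect_bind, expect_map]

theorem mem_support_iid {p : PMF α} {n : ℕ} {l : List α} :
    l ∈ (iid p n).support ↔ l.length = n ∧ ∀ a ∈ l, a ∈ p.support := by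
  induction n generalizing l with
  | zero => simp +contextual [iid]
  | succ n ih =>
    simp only [iid, PMF.mem_support_bind_iff, PMF.mem_support_map_iff, ih]
    constructor
    · rintro ⟨a, ha, l', ⟨hl, hs⟩, rfl⟩
      refine ⟨by simp [hl], ?_⟩
      simp only [List.mem_cons, forall_eq_or_imp]
      exact ⟨ha, hs⟩
    · rintro ⟨hl, hs⟩
      cases l with
      | nil => simp at hl
      | cons a l =>
        simp only [List.mem_cons, forall_eq_or_imp] at hs
        exact ⟨a, hs.1, l, ⟨by simpa using hl, hs.2⟩, rfl⟩

theorem expect_iid_add (p : PMF α) (m n : ℕ) (F : List α → ℝ≥0∞) :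
    expect (iid p (m + n)) F =
      expect (iid p m) fun l => expect (iid p n) fun l' => F (l ++ l') := by
  induction m generalizing F with
  | zero => simp [expect_iid_zero]
  | succ m ih =>
    rw [Nat.succ_add_eq_add_succ, Nat.add_succ, expect_iid_succ, expect_iid_succ]
    simp [ih]

theorem expect_iid_drop (p : PMF α) (m n : ℕ) (F : List α → ℝ≥0∞) :
    expect (iid p (m + n)) (fun l => F (l.drop m)) = expect (iid p n) F := by
  rw [expect_iid_add]
  refine (expect_congr fun l hl => ?_).trans (expect_const (iid p m) _)
  rw [mem_support_iid] at hl
  simp [← hl.1]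

theorem expect_iid_map (p : PMF α) (f : α → β) (n : ℕ) (F : List β → ℝ≥0∞) :
    expect (iid (p.map f) n) F = expect (iid p n) fun l => F (l.map f) := by
  induction n generalizing F with
  | zero => simp [expect_iid_zero]
  | succ n ih => simp [expect_iid_succ, ih, expect_map]

end Iid

/-! ## Values of computations -/

section Law

variable {α β : Type}

@[simp] theorem Timed.val_bind (x : Timed α) (f : α → Timed β) :
    (x >>= f).val = (f x.val).val := rfl

@[simp] theorem Timed.val_pure (a : α) : (pure a : Timed α).val = a := rfl

@[simp] theorem Timed.cost_bind (x : Timed α) (f : α → Timed β) :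
    (x >>= f).cost = x.cost + (f x.val).cost := rfl

@[simp] theorem Timed.cost_pure (a : α) : (pure a : Timed α).cost = 0 := rfl

@[simp] theorem val_op (a : α) : (op a).val = a := rfl

@[simp] theorem cost_op (a : α) : (op a).cost = 1 := rfl

@[simp] theorem cost_charge (k : ℕ) : (charge k).cost = k := rfl

/-- The distribution of the result of a randomized computation. -/
def Comp.law (c : Comp α) : PMF α := c.run.map Timed.val

@[simp] theorem Comp.law_pure (a : α) : (pure a : Comp α).law = PMF.pure a := by
  change (PMF.pure _).map _ = _
  rw [PMF.pure_map]

@[simp] theorem Comp.law_bind (x : Comp α) (f : α → Comp β) :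
    (x >>= f).law = x.law.bind fun a => (f a).law := by
  change (x.run.bind fun a => (f a.val).run.map _).map _ = _
  rw [PMF.map_bind, Comp.law, PMF.bind_map]
  congr 1
  funext a
  rw [PMF.map_comp]
  rfl

@[simp] theorem Comp.law_lift (t : Timed α) : (liftM t : Comp α).law = PMF.pure t.val := by
  change (PMF.pure t).map _ = _
  rw [PMF.pure_map]

@[simp] theorem Comp.law_ask (p : PMF α) : (ask p).law = p := by
  simp only [Comp.law, ask, PMF.map_comp]
  exact PMF.map_id p

theorem forall₂_of_mem_support_forEach {f : α → Comp β} {l : List α} {bs : List β}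
    (h : bs ∈ (forEach f l).law.support) :
    List.Forall₂ (fun a b => b ∈ (f a).law.support) l bs := by
  induction l generalizing bs with
  | nil =>
    simp only [forEach, Comp.law_pure, PMF.support_pure, Set.mem_singleton_iff] at h
    simp [h]
  | cons a l ih =>
    simp only [forEach, Comp.law_bind, Comp.law_pure, PMF.mem_support_bind_iff,
      PMF.support_pure, Set.mem_singleton_iff] at h
    obtain ⟨b, hb, bs', hbs', rfl⟩ := h
    exact List.Forall₂.cons hb (ih hbs')

/-- Union bound over the successive runs: as long as no earlier output is bad, the event is decided
by the remaining ones. -/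
theorem prob_forEach_le (f : α → Comp β) (l : List α) (P : β → Prop) :
    prob (forEach f l).law (fun bs => ∃ b ∈ bs, P b) ≤
      (l.map fun a => prob (f a).law P).sum := by
  induction l with
  | nil => simp [forEach, prob, expect_pure]
  | cons a l ih =>
    simp only [forEach, Comp.law_bind, Comp.law_pure, List.map_cons, List.sum_cons]
    refine prob_bind_le le_rfl fun b _ hb => ?_
    rw [prob_bind]
    refine le_trans (le_of_eq ?_) ih
    refine expect_congr fun bs _ => ?_
    simp only [prob, expect_pure]
    congr 1
    simp [hb]

/-- Processing i.i.d. samples one by one with fresh randomness yields i.i.d. results. The only point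
is to exchange the randomness of the first item with the draw of the remaining samples. -/
theorem iid_bind_forEach (p : PMF α) (f : α → Comp β) (n : ℕ) :
    (iid p n).bind (fun l => (forEach f l).law) = iid (p.bind fun a => (f a).law) n := by
  refine ext_of_expect fun F => ?_
  induction n generalizing F with
  | zero => simp [iid, forEach]
  | succ n ih =>
    rw [expect_bind, expect_iid_succ, expect_iid_succ, expect_bind]
    refine expect_congr fun a _ => ?_
    simp only [forEach, Comp.law_bind, Comp.law_pure, expect_bind, expect_pure]
    rw [expect_comm]
    refine expect_congr fun b _ => ?_
    rw [← ih fun l => F (b :: l), expect_bind]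

/-- The loop invariant is that the running value is the score of the current candidate. Hence the
last argument is fixed to `(score b).val` and the induction generalizes over `b`. -/
theorem argminAux_spec (score : α → Timed ℝ) (l : List α) (b : α) :
    (argminAux score l b (score b).val).val ∈ b :: l ∧
    ∀ c ∈ b :: l, (score (argminAux score l b (score b).val).val).val ≤ (score c).val := by
  induction l generalizing b with
  | nil => simp [argminAux]
  | cons a l ih =>
    by_cases h : (score a).val < (score b).val
    · have := ih a
      simp only [argminAux, Timed.val_bind, val_op, h, decide_true, if_true]
      refine ⟨List.mem_cons_of_mem _ this.1, ?_⟩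
      intro c hc
      rcases List.mem_cons.1 hc with rfl | hc
      · exact (this.2 a (by simp)).trans h.le
      · exact this.2 c hc
    · have := ih b
      simp only [argminAux, Timed.val_bind, val_op, h, decide_false]
      refine ⟨?_, ?_⟩
      · rcases List.mem_cons.1 this.1 with h' | h'
        · simp [h']
        · simp [h']
      · intro c hc
        simp only [List.mem_cons] at hc
        rcases hc with rfl | rfl | hc
        · exact this.2 _ (by simp)
        · exact (this.2 b (by simp)).trans (not_lt.1 h)
        · exact this.2 c (by simp [hc])

theorem argmin_mem (score : α → Timed ℝ) (a : α) (l : List α) :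
    (argmin score a l).val ∈ a :: l := (argminAux_spec score l a).1

theorem argmin_le (score : α → Timed ℝ) (a : α) (l : List α) {c : α} (hc : c ∈ a :: l) :
    (score (argmin score a l).val).val ≤ (score c).val := (argminAux_spec score l a).2 c hc

end Law

/-! ## Simulating a Block MDP from samples -/

section Simulation

variable {S X δ : Type} {A : ℕ}

/-- For every action, the two observations of an episode simulated from a sample `d ∼ P` have the
same joint distribution as those of a horizon-2 episode in `M`. -/
def Simulates (P : PMF δ) (fst : δ → X) (snd : δ → Fin A → Comp X) (M : BlockMDP S X A) : Prop :=
  ∀ (a : Fin A) (F : X → X → ℝ≥0∞),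
    expect P (fun d => expect (snd d a).law (F (fst d))) =
      expect M.init fun s => expect (M.emit 0 s) fun x =>
        expect (M.trans 0 s a) fun s' => expect (M.emit 1 s') (F x)

theorem expect_episode_two (M : BlockMDP S X A) (act : Traj X A → X → PMF (Fin A))
    (F : Traj X A → ℝ≥0∞) :
    expect (M.episode 2 act) F =
      expect M.init fun s => expect (M.emit 0 s) fun x => expect (act [] x) fun a =>
        expect (M.trans 0 s a) fun s' => expect (M.emit 1 s') fun x' =>
          expect (act [(x, a)] x') fun a' => F [(x, a), (x', a')] := by
  simp [BlockMDP.episode, BlockMDP.rollout, expect_bind, expect_pure]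

/-- `Simulates` fixes the action. A randomized action that depends on the first observation is
reduced to this by summing over the finitely many actions and moving each probability into the test
function. -/
theorem Simulates.expect_act {P : PMF δ} {fst : δ → X} {snd : δ → Fin A → Comp X}
    {M : BlockMDP S X A} (h : Simulates P fst snd M) (act : X → PMF (Fin A))
    (G : X → Fin A → X → ℝ≥0∞) :
    expect P (fun d => expect (act (fst d)) fun a => expect (snd d a).law (G (fst d) a)) =
      expect M.init fun s => expect (M.emit 0 s) fun x => expect (act x) fun a =>
        expect (M.trans 0 s a) fun s' => expect (M.emit 1 s') (G x a) := by
  simp only [expect_fintype (act _), expect_finset_sum]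
  refine Finset.sum_congr rfl fun a _ => ?_
  simp only [← expect_const_mul]
  exact h a fun x x' => act x a * G x a x'

theorem expect_simulate_cons (L : Learner X A) (fst : δ → X) (snd : δ → Fin A → Comp X)
    (d : δ) (ds : List δ) (hist : List (Traj X A)) (F : Option (List (Policy X A)) → ℝ≥0∞) :
    expect (simulate L fst snd (d :: ds) hist).law F =
      expect (L.next hist) fun o => o.elim
        (expect (L.act hist [] (fst d)) fun a => expect (snd d a).law fun x =>
          expect (L.act hist [(fst d, a)] x) fun a' =>
            expect (simulate L fst snd ds (hist ++ [[(fst d, a), (x, a')]])).law F)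
        (fun Ψ => F (some Ψ)) := by
  simp only [simulate, Comp.law_bind, Comp.law_ask, expect_bind]
  refine expect_congr fun o _ => ?_
  cases o <;> simp [expect_bind, expect_pure]

theorem expect_runOn_succ (L : Learner X A) (M : BlockMDP S X A) (H k : ℕ)
    (hist : List (Traj X A)) (F : Option (List (Policy X A)) → ℝ≥0∞) :
    expect (L.runOn M H (k + 1) hist) F =
      expect (L.next hist) fun o => o.elim
        (expect (M.episode H (L.act hist)) fun τ => expect (L.runOn M H k (hist ++ [τ])) F)
        (fun Ψ => F (some Ψ)) := by
  simp only [Learner.runOn, expect_bind]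
  refine expect_congr fun o _ => ?_
  cases o <;> simp [expect_bind, expect_pure]

/-- Each episode uses its own sample, so given the history the next simulated episode is independent
of the past and has the law of a real one. Induct on the number of samples. -/
theorem Simulates.expect_simulate {P : PMF δ} {fst : δ → X} {snd : δ → Fin A → Comp X}
    {M : BlockMDP S X A} (h : Simulates P fst snd M) (L : Learner X A) (n : ℕ)
    (hist : List (Traj X A)) (F : Option (List (Policy X A)) → ℝ≥0∞) :
    expect (iid P n) (fun data => expect (simulate L fst snd data hist).law F) =
      expect (L.runOn M 2 n hist) F := by
  induction n generalizing hist with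
  | zero => simp [expect_iid_zero, simulate, Learner.runOn]
  | succ n ih =>
    simp only [expect_iid_succ, expect_simulate_cons, expect_runOn_succ]
    -- The current episode does not involve the remaining samples `ds`, so their draw can be moved
    -- inside past it, where the induction hypothesis applies.
    have hswap : ∀ d, expect (iid P n) (fun ds => expect (L.next hist) fun o => o.elim
        (expect (L.act hist [] (fst d)) fun a => expect (snd d a).law fun x =>
          expect (L.act hist [(fst d, a)] x) fun a' =>
            expect (simulate L fst snd ds (hist ++ [[(fst d, a), (x, a')]])).law F)
        (fun Ψ => F (some Ψ))) = expect (L.next hist) fun o => o.elim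
        (expect (L.act hist [] (fst d)) fun a => expect (snd d a).law fun x =>
          expect (L.act hist [(fst d, a)] x) fun a' =>
            expect (L.runOn M 2 n (hist ++ [[(fst d, a), (x, a')]])) F)
        (fun Ψ => F (some Ψ)) := by
      intro d
      rw [expect_comm]
      refine expect_congr fun o _ => ?_
      cases o with
      | some Ψ => simp [expect_const]
      | none =>
        simp only [Option.elim_none]
        rw [expect_comm]
        refine expect_congr fun a _ => ?_
        rw [expect_comm]
        refine expect_congr fun x _ => ?_
        rw [expect_comm]
        exact expect_congr fun a' _ => ih _
    simp only [hswap]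
    rw [expect_comm]
    refine expect_congr fun o _ => ?_
    cases o with
    | some Ψ => simp [expect_const]
    | none =>
      simp only [Option.elim_none]
      rw [h.expect_act (L.act hist []) fun x a x' => expect (L.act hist [(x, a)] x') fun a' =>
            expect (L.runOn M 2 n (hist ++ [[(x, a), (x', a')]])) F, expect_episode_two]

theorem Simulates.law_simulate {P : PMF δ} {fst : δ → X} {snd : δ → Fin A → Comp X}
    {M : BlockMDP S X A} (h : Simulates P fst snd M) (L : Learner X A) (n : ℕ)
    (hist : List (Traj X A)) :
    (iid P n).bind (fun data => (simulate L fst snd data hist).law) = L.runOn M 2 n hist :=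
  ext_of_expect fun F => by rw [expect_bind, h.expect_simulate]

theorem mem_support_runOn_succ {L : Learner X A} {M : BlockMDP S X A} {H k : ℕ}
    {hist : List (Traj X A)} {o : Option (List (Policy X A))} :
    o ∈ (L.runOn M H (k + 1) hist).support ↔
      (o ∈ (L.next hist).support ∧ o.isSome) ∨
      (none ∈ (L.next hist).support ∧ ∃ τ ∈ (M.episode H (L.act hist)).support,
        o ∈ (L.runOn M H k (hist ++ [τ])).support) := by
  simp only [Learner.runOn, PMF.mem_support_bind_iff]
  constructor
  · rintro ⟨o', ho', ho⟩
    cases o' with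
    | some Ψ =>
      simp only [PMF.support_pure, Set.mem_singleton_iff] at ho
      subst ho
      exact Or.inl ⟨ho', rfl⟩
    | none =>
      rw [PMF.mem_support_bind_iff] at ho
      exact Or.inr ⟨ho', ho⟩
  · rintro (⟨ho, hs⟩ | ⟨hn, ho⟩)
    · obtain ⟨Ψ, rfl⟩ := Option.isSome_iff_exists.1 hs
      exact ⟨_, ho, by simp⟩
    · exact ⟨none, hn, (PMF.mem_support_bind_iff _ _ _).2 ho⟩

/-- A run that stops within `k` episodes is also a run with any larger budget. -/
theorem mem_support_runOn_mono {L : Learner X A} {M : BlockMDP S X A} {H k k' : ℕ}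
    (hk : k ≤ k') {hist : List (Traj X A)} {Ψ : List (Policy X A)}
    (h : some Ψ ∈ (L.runOn M H k hist).support) :
    some Ψ ∈ (L.runOn M H k' hist).support := by
  induction k generalizing k' hist with
  | zero =>
    cases k' with
    | zero => exact h
    | succ k' => exact mem_support_runOn_succ.2 (Or.inl ⟨h, rfl⟩)
  | succ k ih =>
    obtain ⟨k', rfl⟩ : ∃ j, k' = j + 1 := ⟨k' - 1, by omega⟩
    rw [mem_support_runOn_succ] at h ⊢
    rcases h with h | ⟨hn, τ, hτ, h⟩
    · exact Or.inl h
    · exact Or.inr ⟨hn, τ, hτ, ih (by omega) h⟩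

/-- If the learner has surely stopped after `k` episodes, the additional budget is never touched. -/
theorem runOn_eq_of_le {L : Learner X A} {M : BlockMDP S X A} {H k k' : ℕ} (hk : k ≤ k')
    {hist : List (Traj X A)} (h : none ∉ (L.runOn M H k hist).support) :
    L.runOn M H k' hist = L.runOn M H k hist := by
  refine ext_of_expect fun F => ?_
  induction k generalizing k' hist with
  | zero =>
    cases k' with
    | zero => rfl
    | succ k' =>
      rw [expect_runOn_succ]
      refine expect_congr fun o ho => ?_
      cases o with
      | none => exact absurd ho h
      | some Ψ => rfl
  | succ k ih =>
    obtain ⟨k', rfl⟩ : ∃ j, k' = j + 1 := ⟨k' - 1, by omega⟩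
    rw [expect_runOn_succ, expect_runOn_succ]
    refine expect_congr fun o ho => ?_
    cases o with
    | some Ψ => rfl
    | none =>
      refine expect_congr fun τ hτ => ih (by omega) fun hn => h ?_
      exact mem_support_runOn_succ.2 (Or.inr ⟨ho, τ, hτ, hn⟩)

theorem mem_support_simulate_cons {L : Learner X A} {fst : δ → X} {snd : δ → Fin A → Comp X}
    {d : δ} {ds : List δ} {hist : List (Traj X A)} (hn : none ∈ (L.next hist).support)
    {a : Fin A} (ha : a ∈ (L.act hist [] (fst d)).support) {x : X}
    (hx : x ∈ (snd d a).law.support) {a' : Fin A}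
    (ha' : a' ∈ (L.act hist [(fst d, a)] x).support) {o : Option (List (Policy X A))}
    (ho : o ∈ (simulate L fst snd ds (hist ++ [[(fst d, a), (x, a')]])).law.support) :
    o ∈ (simulate L fst snd (d :: ds) hist).law.support := by
  simp only [simulate, Comp.law_bind, Comp.law_ask, PMF.mem_support_bind_iff]
  refine ⟨none, hn, ?_⟩
  simp only [Comp.law_bind, Comp.law_ask, Comp.law_lift, PMF.mem_support_bind_iff,
    PMF.support_pure, Set.mem_singleton_iff, exists_eq_left, val_op]
  exact ⟨a, ha, x, hx, a', ha', ho⟩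

/-- Samples that are left over after the learner has stopped do not matter. -/
theorem simulate_append {L : Learner X A} {fst : δ → X} {snd : δ → Fin A → Comp X}
    {l l' : List δ} {hist : List (Traj X A)}
    (h : none ∉ (simulate L fst snd l hist).law.support) :
    (simulate L fst snd (l ++ l') hist).law = (simulate L fst snd l hist).law := by
  refine ext_of_expect fun F => ?_
  induction l generalizing hist with
  | nil =>
    cases l' with
    | nil => rfl
    | cons d ds =>
      simp only [simulate, Comp.law_ask] at h
      rw [List.nil_append, expect_simulate_cons, simulate, Comp.law_ask]
      refine expect_congr fun o ho => ?_
      cases o with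
      | none => exact absurd ho h
      | some Ψ => rfl
  | cons d ds ih =>
    rw [List.cons_append, expect_simulate_cons, expect_simulate_cons]
    refine expect_congr fun o ho => ?_
    cases o with
    | some Ψ => rfl
    | none =>
      refine expect_congr fun a ha => expect_congr fun x hx => expect_congr fun a' ha' => ih ?_
      exact fun hn => h (mem_support_simulate_cons ho ha hx ha' hn)

/-! ### The oracle's guarantee on simulated episodes. -/

section Oracle

variable {Φ : Set (X → S)} {O : RLOracle X} {N K : ℝ → ℝ → ℕ → ℕ → ℕ} {ε γ : ℝ} {φ : X → S}
  [NeZero A] {M : BlockMDP S X A} {P : PMF δ} {fst : δ → X} {snd : δ → Fin A → Comp X}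

/-- This holds for data of any length, as the almost sure step bounds require: a simulated output is
a possible output of a real run with budget `data.length`. A budget below the oracle's is covered by
monotonicity, and a budget above it changes nothing. -/
theorem Simulates.length_le (h : Simulates P fst snd M) (hO : IsEfficientRL Φ O N K)
    (hε : ε ∈ Set.Ioo (0 : ℝ) (1 / 2)) (hγ : γ ∈ Set.Ioo (0 : ℝ) (1 / 2)) (hφ : φ ∈ Φ)
    (hM : M.DecodedBy 2 φ) {data : List δ} (hdata : ∀ d ∈ data, d ∈ P.support)
    {Ψ : List (Policy X A)}
    (hΨ : some Ψ ∈ (simulate (O ε γ 2 A) fst snd data []).law.support) :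
    Ψ.length ≤ K ε γ 2 A := by
  have hall := (hO ε hε γ hγ 2 (by norm_num) A φ hφ M hM).1
  have h1 : some Ψ ∈ ((O ε γ 2 A).runOn M 2 data.length []).support := by
    rw [← h.law_simulate, PMF.mem_support_bind_iff]
    exact ⟨data, mem_support_iid.2 ⟨rfl, hdata⟩, hΨ⟩
  have h2 : some Ψ ∈ ((O ε γ 2 A).runOn M 2 (N ε γ 2 A) []).support := by
    rcases le_total data.length (N ε γ 2 A) with hle | hle
    · exact mem_support_runOn_mono hle h1
    · rwa [runOn_eq_of_le hle] at h1
      intro hn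
      obtain ⟨Ψ, hΨ, -⟩ := hall _ hn
      simp at hΨ
  obtain ⟨Ψ', hΨ', hlen⟩ := hall _ h2
  cases hΨ'
  exact hlen

theorem Simulates.none_notMem (h : Simulates P fst snd M) (hO : IsEfficientRL Φ O N K)
    (hε : ε ∈ Set.Ioo (0 : ℝ) (1 / 2)) (hγ : γ ∈ Set.Ioo (0 : ℝ) (1 / 2)) (hφ : φ ∈ Φ)
    (hM : M.DecodedBy 2 φ) {data : List δ} (hdata : data ∈ (iid P (N ε γ 2 A)).support) :
    none ∉ (simulate (O ε γ 2 A) fst snd data []).law.support := by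
  intro hn
  have h1 : none ∈ ((O ε γ 2 A).runOn M 2 (N ε γ 2 A) []).support := by
    rw [← h.law_simulate, PMF.mem_support_bind_iff]
    exact ⟨data, hdata, hn⟩
  obtain ⟨Ψ, hΨ, -⟩ := (hO ε hε γ hγ 2 (by norm_num) A φ hφ M hM).1 _ h1
  simp at hΨ

theorem Simulates.prob_not_cover_le (h : Simulates P fst snd M) (hO : IsEfficientRL Φ O N K)
    (hε : ε ∈ Set.Ioo (0 : ℝ) (1 / 2)) (hγ : γ ∈ Set.Ioo (0 : ℝ) (1 / 2)) (hφ : φ ∈ Φ)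
    (hM : M.DecodedBy 2 φ) :
    prob ((iid P (N ε γ 2 A)).bind fun data => (simulate (O ε γ 2 A) fst snd data []).law)
      (fun o => ¬ ∃ Ψ, o = some Ψ ∧ M.IsCover 2 ε Ψ) ≤ ENNReal.ofReal γ := by
  rw [h.law_simulate]
  exact (le_toOuterMeasure_iff hγ.1.le (by linarith [hγ.2])).1
    (hO ε hε γ hγ 2 (by norm_num) A φ hφ M hM).2

/-- Run the oracle on the first samples and continue with the remaining ones: the failure
probabilities of the two parts add up. -/
theorem Simulates.prob_le {β : Type} (h : Simulates P fst snd M) (hO : IsEfficientRL Φ O N K)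
    (hε : ε ∈ Set.Ioo (0 : ℝ) (1 / 2)) (hγ : γ ∈ Set.Ioo (0 : ℝ) (1 / 2)) (hφ : φ ∈ Φ)
    (hM : M.DecodedBy 2 φ) (r : ℕ)
    (rest : List δ → Option (List (Policy X A)) → PMF β) (bad : β → Prop) (b : ℝ≥0∞)
    (hrest : ∀ Ψ : List (Policy X A), M.IsCover 2 ε Ψ → Ψ.length ≤ K ε γ 2 A →
      ∀ l : List δ, l.length = N ε γ 2 A →
        expect (iid P r) (fun l' => prob (rest (l ++ l') (some Ψ)) bad) ≤ b) :
    expect (iid P (N ε γ 2 A + r)) (fun data =>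
      prob ((simulate (O ε γ 2 A) fst snd data []).law.bind (rest data)) bad) ≤
        ENNReal.ofReal γ + b := by
  rw [expect_iid_add]
  -- The oracle has stopped by the end of `l`, so `l'` does not influence its output and may be
  -- drawn after it. This is what makes the later samples fresh.
  have hswap : ∀ l ∈ (iid P (N ε γ 2 A)).support,
      expect (iid P r) (fun l' =>
        prob ((simulate (O ε γ 2 A) fst snd (l ++ l') []).law.bind (rest (l ++ l'))) bad) =
      prob ((simulate (O ε γ 2 A) fst snd l []).law.bind fun o =>
        (iid P r).bind fun l' => rest (l ++ l') o) bad := by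
    intro l hl
    simp only [simulate_append (h.none_notMem hO hε hγ hφ hM hl), prob_bind]
    rw [expect_comm]
  rw [expect_congr hswap, ← prob_bind]
  -- The samples are kept together with the output, so that the second stage still knows the length
  -- and the support of `l`.
  rw [show ((iid P (N ε γ 2 A)).bind fun l =>
      (simulate (O ε γ 2 A) fst snd l []).law.bind fun o =>
        (iid P r).bind fun l' => rest (l ++ l') o) =
      ((iid P (N ε γ 2 A)).bind fun l =>
        (simulate (O ε γ 2 A) fst snd l []).law.map fun o => (l, o)).bind fun p =>
        (iid P r).bind fun l' => rest (p.1 ++ l') p.2 by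
      simp [PMF.bind_bind, PMF.bind_map, Function.comp_def]]
  refine prob_bind_le (P := fun p => ¬ ∃ Ψ, p.2 = some Ψ ∧ M.IsCover 2 ε Ψ) ?_ ?_
  · refine le_trans (le_of_eq ?_) (h.prob_not_cover_le hO hε hγ hφ hM)
    simp only [prob_bind, prob_map]
  · rintro ⟨l, o⟩ hp hcov
    simp only [PMF.mem_support_bind_iff, PMF.mem_support_map_iff, Prod.mk.injEq] at hp
    obtain ⟨l₀, hl₀, o₀, ho₀, rfl, rfl⟩ := hp
    simp only [not_not] at hcov
    obtain ⟨Ψ, rfl, hΨ⟩ := hcov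
    rw [prob_bind]
    rw [mem_support_iid] at hl₀
    exact hrest Ψ hΨ (h.length_le hO hε hγ hφ hM hl₀.2 ho₀) _ hl₀.1

end Oracle

end Simulation

/-! ## Concentration of empirical means -/

section Concentration

variable {α : Type} {W : PMF α} {Y : α → ℝ}

theorem expect_ofReal_one_sub (hY : ∀ a, Y a ∈ Set.Icc (0 : ℝ) 1) :
    expect W (fun a => ENNReal.ofReal (1 - Y a)) =
      ENNReal.ofReal (1 - (expect W fun a => ENNReal.ofReal (Y a)).toReal) := by
  have h1 : expect W (fun a => ENNReal.ofReal (Y a)) ≤ 1 :=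
    expect_le_of_le fun a _ => by simpa using (hY a).2
  have hsum : expect W (fun a => ENNReal.ofReal (1 - Y a)) +
      expect W (fun a => ENNReal.ofReal (Y a)) = 1 := by
    rw [← expect_add]
    refine (expect_congr fun a _ => ?_).trans (expect_const W 1)
    rw [← ENNReal.ofReal_add (by linarith [(hY a).2]) (hY a).1]
    simp
  rw [ENNReal.ofReal_sub _ ENNReal.toReal_nonneg, ENNReal.ofReal_one,
    ENNReal.ofReal_toReal (ne_top_of_le_ne_top ENNReal.one_ne_top h1)]
  exact ENNReal.eq_sub_of_add_eq (ne_top_of_le_ne_top ENNReal.one_ne_top h1) hsum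

/-- Bound `exp u` by `1 + u + u²` for `|u| ≤ 1`: the linear terms cancel and `p(1 - p) ≤ 1/4`
remains. The sharp exponent would be `s²/8`. -/
theorem two_point_exp_le {p s : ℝ} (hp : p ∈ Set.Icc (0 : ℝ) 1) (hs : s ∈ Set.Icc (0 : ℝ) 1) :
    (1 - p) * Real.exp (-(s * p)) + p * Real.exp (s * (1 - p)) ≤ Real.exp (s ^ 2 / 4) := by
  obtain ⟨hp0, hp1⟩ := hp
  obtain ⟨hs0, hs1⟩ := hs
  have key : ∀ u : ℝ, |u| ≤ 1 → Real.exp u ≤ 1 + u + u ^ 2 := fun u hu => by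
    linarith [(abs_le.1 (Real.abs_exp_sub_one_sub_id_le hu)).2]
  have h1 := key (-(s * p)) (by
    rw [abs_neg, abs_of_nonneg (by positivity)]; nlinarith)
  have h2 := key (s * (1 - p)) (by
    rw [abs_of_nonneg (mul_nonneg hs0 (by linarith))]; nlinarith)
  have h3 := Real.add_one_le_exp (s ^ 2 / 4)
  calc (1 - p) * Real.exp (-(s * p)) + p * Real.exp (s * (1 - p))
      ≤ (1 - p) * (1 + -(s * p) + (-(s * p)) ^ 2) +
          p * (1 + s * (1 - p) + (s * (1 - p)) ^ 2) := by
        gcongr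
    _ = 1 + s ^ 2 * (p * (1 - p)) := by ring
    _ ≤ s ^ 2 / 4 + 1 := by
        nlinarith [mul_nonneg (sq_nonneg s) (sq_nonneg (p - 1 / 2))]
    _ ≤ _ := h3

/-- By convexity the exponential lies below its chord on `[0, 1]`, which replaces `Y` by a Bernoulli
variable of the same mean and leaves `two_point_exp_le`. -/
theorem expect_exp_le (hY : ∀ a, Y a ∈ Set.Icc (0 : ℝ) 1) {s : ℝ}
    (hs : s ∈ Set.Icc (0 : ℝ) 1) {m : ℝ}
    (hm : m = (expect W fun a => ENNReal.ofReal (Y a)).toReal) :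
    expect W (fun a => ENNReal.ofReal (Real.exp (s * (Y a - m)))) ≤
      ENNReal.ofReal (Real.exp (s ^ 2 / 4)) := by
  have h1 : expect W (fun a => ENNReal.ofReal (Y a)) ≤ 1 :=
    expect_le_of_le fun a _ => by simpa using (hY a).2
  have hm0 : 0 ≤ m := hm ▸ ENNReal.toReal_nonneg
  have hm1 : m ≤ 1 := by
    rw [hm]
    exact ENNReal.toReal_mono ENNReal.one_ne_top h1
  have hmean : expect W (fun a => ENNReal.ofReal (Y a)) = ENNReal.ofReal m := by
    rw [hm, ENNReal.ofReal_toReal (ne_top_of_le_ne_top ENNReal.one_ne_top h1)]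
  have hconv : ∀ a, Real.exp (s * (Y a - m)) ≤
      Real.exp (-(s * m)) * (1 - Y a) + Real.exp (s * (1 - m)) * Y a := by
    intro a
    have := (convexOn_exp.2 (Set.mem_univ (-(s * m))) (Set.mem_univ (s * (1 - m)))
      (sub_nonneg.2 (hY a).2) (hY a).1 (by ring))
    simp only [smul_eq_mul] at this
    calc Real.exp (s * (Y a - m))
        = Real.exp ((1 - Y a) * -(s * m) + Y a * (s * (1 - m))) := by congr 1; ring
      _ ≤ _ := by linarith
  calc expect W (fun a => ENNReal.ofReal (Real.exp (s * (Y a - m))))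
      ≤ expect W (fun a => ENNReal.ofReal (Real.exp (-(s * m))) * ENNReal.ofReal (1 - Y a) +
          ENNReal.ofReal (Real.exp (s * (1 - m))) * ENNReal.ofReal (Y a)) := by
        refine expect_mono fun a _ => ?_
        rw [← ENNReal.ofReal_mul (Real.exp_nonneg _), ← ENNReal.ofReal_mul (Real.exp_nonneg _),
          ← ENNReal.ofReal_add]
        · exact ENNReal.ofReal_le_ofReal (hconv a)
        · exact mul_nonneg (Real.exp_nonneg _) (sub_nonneg.2 (hY a).2)
        · exact mul_nonneg (Real.exp_nonneg _) (hY a).1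
    _ = ENNReal.ofReal (Real.exp (-(s * m)) * (1 - m) + Real.exp (s * (1 - m)) * m) := by
        rw [expect_add, expect_const_mul, expect_const_mul, expect_ofReal_one_sub hY, ← hm, hmean,
          ← ENNReal.ofReal_mul (Real.exp_nonneg _), ← ENNReal.ofReal_mul (Real.exp_nonneg _),
          ← ENNReal.ofReal_add]
        · exact mul_nonneg (Real.exp_nonneg _) (by linarith)
        · exact mul_nonneg (Real.exp_nonneg _) hm0
    _ ≤ _ := by
        refine ENNReal.ofReal_le_ofReal ?_
        linarith [two_point_exp_le ⟨hm0, hm1⟩ hs]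

theorem expect_iid_exp_le (hY : ∀ a, Y a ∈ Set.Icc (0 : ℝ) 1) {s : ℝ}
    (hs : s ∈ Set.Icc (0 : ℝ) 1) {m : ℝ}
    (hm : m = (expect W fun a => ENNReal.ofReal (Y a)).toReal) (n : ℕ) :
    expect (iid W n) (fun l => ENNReal.ofReal (Real.exp (s * ((l.map Y).sum - n * m)))) ≤
      ENNReal.ofReal (Real.exp (n * (s ^ 2 / 4))) := by
  induction n with
  | zero => simp [expect_iid_zero]
  | succ n ih =>
    rw [expect_iid_succ]
    have h : ∀ (a : α) (l : List α),
        ENNReal.ofReal (Real.exp (s * (((a :: l).map Y).sum - (n + 1 : ℕ) * m))) =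
        ENNReal.ofReal (Real.exp (s * (Y a - m))) *
          ENNReal.ofReal (Real.exp (s * ((l.map Y).sum - n * m))) := by
      intro a l
      rw [← ENNReal.ofReal_mul (Real.exp_nonneg _), ← Real.exp_add]
      congr 2
      simp only [List.map_cons, List.sum_cons]
      push_cast
      ring
    simp only [h, expect_const_mul, expect_mul_const]
    calc _ ≤ ENNReal.ofReal (Real.exp (s ^ 2 / 4)) *
          ENNReal.ofReal (Real.exp (n * (s ^ 2 / 4))) := by
          gcongr
          exact expect_exp_le hY hs hm
      _ = _ := by
          rw [← ENNReal.ofReal_mul (Real.exp_nonneg _), ← Real.exp_add]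
          congr 2
          push_cast
          ring

/-- Hoeffding's inequality (with a suboptimal constant), upper tail. -/
theorem prob_sum_ge_le (hY : ∀ a, Y a ∈ Set.Icc (0 : ℝ) 1) {t : ℝ} (ht0 : 0 ≤ t)
    (ht : t ≤ 1 / 2) (n : ℕ) :
    prob (iid W n) (fun l =>
      n * ((expect W fun a => ENNReal.ofReal (Y a)).toReal + t) ≤ (l.map Y).sum) ≤
        ENNReal.ofReal (Real.exp (-(n * t ^ 2))) := by
  set m := (expect W fun a => ENNReal.ofReal (Y a)).toReal with hm
  -- Chernoff's method with `s = 2t`, which is at most `1` because `t ≤ 1/2`. The exponents `-2nt²`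
  -- and `n(2t)²/4` add up to `-nt²`.
  calc _ ≤ expect (iid W n) (fun l => ENNReal.ofReal (Real.exp (-(n * (2 * t ^ 2)))) *
        ENNReal.ofReal (Real.exp (2 * t * ((l.map Y).sum - n * m)))) := by
        refine prob_le_expect fun l _ hl => ?_
        rw [← ENNReal.ofReal_mul (Real.exp_nonneg _), ← Real.exp_add, ENNReal.one_le_ofReal]
        refine Real.one_le_exp ?_
        nlinarith
    _ ≤ ENNReal.ofReal (Real.exp (-(n * (2 * t ^ 2)))) *
        ENNReal.ofReal (Real.exp (n * ((2 * t) ^ 2 / 4))) := by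
        rw [expect_const_mul]
        gcongr
        exact expect_iid_exp_le hY ⟨by linarith, by linarith⟩ hm n
    _ = _ := by
        rw [← ENNReal.ofReal_mul (Real.exp_nonneg _), ← Real.exp_add]
        congr 2
        ring

/-- Hoeffding's inequality (with a suboptimal constant), lower tail. -/
theorem prob_sum_le_le (hY : ∀ a, Y a ∈ Set.Icc (0 : ℝ) 1) {t : ℝ} (ht0 : 0 ≤ t)
    (ht : t ≤ 1 / 2) (n : ℕ) :
    prob (iid W n) (fun l =>
      (l.map Y).sum ≤ n * ((expect W fun a => ENNReal.ofReal (Y a)).toReal - t)) ≤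
        ENNReal.ofReal (Real.exp (-(n * t ^ 2))) := by
  have hY' : ∀ a, 1 - Y a ∈ Set.Icc (0 : ℝ) 1 := fun a =>
    ⟨by linarith [(hY a).2], by linarith [(hY a).1]⟩
  refine le_trans (prob_mono fun l hl h => ?_) (prob_sum_ge_le (W := W) hY' ht0 ht n)
  have hm1 : (expect W fun a => ENNReal.ofReal (Y a)).toReal ≤ 1 :=
    ENNReal.toReal_mono ENNReal.one_ne_top
      (expect_le_of_le fun a _ => by simpa using (hY a).2)
  rw [expect_ofReal_one_sub hY, ENNReal.toReal_ofReal (by linarith)]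
  have hsum : ∀ l : List α, (l.map fun a => 1 - Y a).sum = l.length - (l.map Y).sum := by
    intro l
    induction l with
    | nil => simp
    | cons a l ih => simp only [List.map_cons, List.sum_cons, ih, List.length_cons]; push_cast; ring
  rw [hsum, (mem_support_iid.1 hl).1]
  nlinarith

end Concentration

/-! ## Grid policies -/

section Grid

variable {X : Type}

theorem natCast_mul_le_one {η : ℝ} (hη : 0 ≤ η) (a : Fin (gridSize η)) : ((a : ℕ) : ℝ) * η ≤ 1 := by
  rcases hη.eq_or_lt with rfl | hη
  · simp
  have h1 : (a : ℕ) ≤ ⌊1 / η⌋₊ := Nat.lt_succ_iff.1 a.2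
  have h2 : ((a : ℕ) : ℝ) ≤ 1 / η :=
    (Nat.cast_le.2 h1).trans (Nat.floor_le (by positivity))
  calc ((a : ℕ) : ℝ) * η ≤ 1 / η * η := by gcongr
    _ = 1 := by field_simp

theorem sum_toReal_eq_one {A : ℕ} (p : PMF (Fin A)) : ∑ a, (p a).toReal = 1 := by
  rw [← ENNReal.toReal_sum fun a _ => p.apply_ne_top a, ← tsum_fintype (L := .unconditional _),
    p.tsum_coe, ENNReal.toReal_one]

theorem playedValue_val {A : ℕ} (η : ℝ) (π : Policy X A) (x : X) :
    (playedValue η π x).val = ∑ a : Fin A, ((π 0 x) a).toReal * ((a : ℕ) * η) := rfl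

theorem playedValue_mem {η : ℝ} (hη : 0 ≤ η) (π : Policy X (gridSize η)) (x : X) :
    (playedValue η π x).val ∈ Set.Icc (0 : ℝ) 1 := by
  rw [playedValue_val]
  constructor
  · positivity
  · calc ∑ a : Fin (gridSize η), ((π 0 x) a).toReal * ((a : ℕ) * η)
        ≤ ∑ a : Fin (gridSize η), ((π 0 x) a).toReal * 1 := by
          gcongr with a
          exact natCast_mul_le_one hη a
      _ = 1 := by simp [sum_toReal_eq_one]

theorem expect_ofReal {A : ℕ} (p : PMF (Fin A)) {g : Fin A → ℝ} (hg : ∀ a, 0 ≤ g a) :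
    expect p (fun a => ENNReal.ofReal (g a)) = ENNReal.ofReal (∑ a, (p a).toReal * g a) := by
  rw [expect_fintype, ENNReal.ofReal_sum_of_nonneg fun a _ => mul_nonneg ENNReal.toReal_nonneg (hg a)]
  refine Finset.sum_congr rfl fun a _ => ?_
  rw [ENNReal.ofReal_mul ENNReal.toReal_nonneg, ENNReal.ofReal_toReal (p.apply_ne_top a)]

/-- Jensen's inequality for the square: expanding around the mean `v`, the cross term vanishes and
the variance of the action is nonnegative. So randomized policies need no separate treatment. -/
theorem playedValue_sq_le {A : ℕ} (η : ℝ) (π : Policy X A) (x : X) (c : ℝ) :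
    ENNReal.ofReal (((playedValue η π x).val - c) ^ 2) ≤
      expect (π 0 x) fun a => ENNReal.ofReal (((a : ℕ) * η - c) ^ 2) := by
  rw [expect_ofReal _ fun a => sq_nonneg _]
  refine ENNReal.ofReal_le_ofReal ?_
  set v := (playedValue η π x).val with hv
  have hv' : ∑ a : Fin A, ((π 0 x) a).toReal * ((a : ℕ) * η) = v := (playedValue_val η π x).symm
  have h1 := sum_toReal_eq_one (π 0 x)
  have h2 : 0 ≤ ∑ a : Fin A, ((π 0 x) a).toReal * ((a : ℕ) * η - v) ^ 2 :=
    Finset.sum_nonneg fun a _ => mul_nonneg ENNReal.toReal_nonneg (sq_nonneg _)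
  have h3 : ∑ a : Fin A, ((π 0 x) a).toReal * ((a : ℕ) * η - c) ^ 2 =
      ∑ a : Fin A, ((π 0 x) a).toReal * ((a : ℕ) * η - v) ^ 2 +
        2 * (v - c) * (∑ a : Fin A, ((π 0 x) a).toReal * ((a : ℕ) * η) -
          v * ∑ a : Fin A, ((π 0 x) a).toReal) +
        (v - c) ^ 2 * ∑ a : Fin A, ((π 0 x) a).toReal := by
    rw [mul_sub, Finset.mul_sum, Finset.mul_sum, Finset.mul_sum, Finset.mul_sum,
      ← Finset.sum_sub_distrib, ← Finset.sum_add_distrib, ← Finset.sum_add_distrib]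
    refine Finset.sum_congr rfl fun a _ => ?_
    ring
  rw [h3, hv', h1]
  linarith

theorem exists_grid_near {η c : ℝ} (hη : 0 < η) (hc : c ∈ Set.Icc (0 : ℝ) 1) :
    ∃ a : Fin (gridSize η), (((a : ℕ) : ℝ) * η - c) ^ 2 ≤ η ^ 2 := by
  have hle : ⌊c / η⌋₊ ≤ ⌊1 / η⌋₊ := Nat.floor_le_floor (by gcongr; exact hc.2)
  refine ⟨⟨⌊c / η⌋₊, Nat.lt_succ_iff.2 hle⟩, ?_⟩
  have h1 : (⌊c / η⌋₊ : ℝ) * η ≤ c :=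
    (le_div_iff₀ hη).1 (Nat.floor_le (div_nonneg hc.1 hη.le))
  have h2 : c < (⌊c / η⌋₊ + 1 : ℝ) * η := (div_lt_iff₀ hη).1 (Nat.lt_floor_add_one _)
  simp only
  nlinarith

/-- The policy that plays the grid point nearest to `κ x`. -/
theorem exists_grid_policy {η : ℝ} (hη : 0 < η) {κ : X → ℝ}
    (hκ : ∀ x, κ x ∈ Set.Icc (0 : ℝ) 1) :
    ∃ π : Policy X (gridSize η), ∀ x,
      expect (π 0 x) (fun a => ENNReal.ofReal (((a : ℕ) * η - κ x) ^ 2)) ≤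
        ENNReal.ofReal (η ^ 2) := by
  choose a ha using fun x => exists_grid_near hη (hκ x)
  exact ⟨fun _ x => PMF.pure (a x), fun x => by
    rw [expect_pure]; exact ENNReal.ofReal_le_ofReal (ha x)⟩

/-- The expected squared error of the prediction `v` for a `Ber(c)` label. -/
def labelLoss (v c : ℝ) : ℝ := (v - c) ^ 2 + c * (1 - c)

theorem labelLoss_mem {v c : ℝ} (hv : v ∈ Set.Icc (0 : ℝ) 1) (hc : c ∈ Set.Icc (0 : ℝ) 1) :
    labelLoss v c ∈ Set.Icc (0 : ℝ) 1 := by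
  obtain ⟨hv0, hv1⟩ := hv
  obtain ⟨hc0, hc1⟩ := hc
  unfold labelLoss
  constructor
  · nlinarith [sq_nonneg (v - c), mul_nonneg hc0 (sub_nonneg.2 hc1)]
  · nlinarith [mul_nonneg hc0 hv0, mul_nonneg hv0 (sub_nonneg.2 hv1),
      mul_nonneg hc0 (sub_nonneg.2 hv1), mul_nonneg (sub_nonneg.2 hc1) hv0,
      mul_nonneg (sub_nonneg.2 hc1) (sub_nonneg.2 hv1)]

theorem expect_ber_sq {v c : ℝ} (hc : c ∈ Set.Icc (0 : ℝ) 1) :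
    expect (ber c) (fun y => ENNReal.ofReal ((v - bit y) ^ 2)) = ENNReal.ofReal (labelLoss v c) := by
  rw [expect_ber hc, ← ENNReal.ofReal_mul hc.1, ← ENNReal.ofReal_mul (sub_nonneg.2 hc.2),
    ← ENNReal.ofReal_add (mul_nonneg hc.1 (sq_nonneg _))
      (mul_nonneg (sub_nonneg.2 hc.2) (sq_nonneg _))]
  congr 1
  simp only [bit, cond_true, cond_false, labelLoss]
  ring

/-- If the policy `π` succeeds almost as often as a grid policy `ρ` that predicts well, then it
predicts well itself. -/
theorem expect_sq_le_of_success {Ω : Type} {η ε : ℝ} (hη : 0 ≤ η) (μ : PMF Ω) (w : Ω → ℝ≥0∞)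
    (hw : ∀ ω, w ω ≤ 1) (x : Ω → X) {c : Ω → ℝ} (hc : ∀ ω, c ω ∈ Set.Icc (0 : ℝ) 1)
    {π ρ : Policy X (gridSize η)}
    (hρ : ∀ ω ∈ μ.support, w ω ≠ 0 →
      expect (ρ 0 (x ω)) (fun a => ENNReal.ofReal (((a : ℕ) * η - c ω) ^ 2)) ≤
        ENNReal.ofReal (η ^ 2))
    (h : expect μ (fun ω => w ω * expect (ρ 0 (x ω)) fun a =>
        ENNReal.ofReal (1 - labelLoss ((a : ℕ) * η) (c ω))) ≤
      expect μ (fun ω => w ω * expect (π 0 (x ω)) fun a =>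
        ENNReal.ofReal (1 - labelLoss ((a : ℕ) * η) (c ω))) + ENNReal.ofReal ε) :
    expect μ (fun ω => w ω * ENNReal.ofReal (((playedValue η π (x ω)).val - c ω) ^ 2)) ≤
      ENNReal.ofReal (η ^ 2) + ENNReal.ofReal ε := by
  set V : Policy X (gridSize η) → ℝ≥0∞ := fun π =>
    expect μ fun ω => w ω * expect (π 0 (x ω)) fun a =>
        ENNReal.ofReal (1 - labelLoss ((a : ℕ) * η) (c ω)) with hV
  set L : Policy X (gridSize η) → ℝ≥0∞ := fun π =>
    expect μ fun ω => w ω * expect (π 0 (x ω)) fun a =>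
        ENNReal.ofReal (((a : ℕ) * η - c ω) ^ 2) with hL
  set s := expect μ fun ω => w ω * ENNReal.ofReal (c ω * (1 - c ω)) with hs
  -- Success probability, squared error and label variance add up to `1` pointwise, whatever the
  -- policy. More success therefore means less squared error.
  have hsum : ∀ π, V π + L π + s = expect μ w := by
    intro π
    simp only [hV, hL, hs, ← expect_add]
    refine expect_congr fun ω _ => ?_
    rw [← mul_add, ← mul_add, ← expect_add]
    conv_rhs => rw [← mul_one (w ω)]
    congr 1
    rw [← expect_const (π 0 (x ω)) (ENNReal.ofReal (c ω * (1 - c ω))), ← expect_add]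
    refine (expect_congr fun a _ => ?_).trans (expect_const (π 0 (x ω)) 1)
    have ha := labelLoss_mem ⟨by positivity, natCast_mul_le_one hη a⟩ (hc ω)
    have hcc : 0 ≤ c ω * (1 - c ω) := mul_nonneg (hc ω).1 (sub_nonneg.2 (hc ω).2)
    rw [← ENNReal.ofReal_add (sub_nonneg.2 ha.2) (sq_nonneg _),
      ← ENNReal.ofReal_add (add_nonneg (sub_nonneg.2 ha.2) (sq_nonneg _)) hcc]
    rw [← ENNReal.ofReal_one]
    congr 1
    simp only [labelLoss]
    ring
  have hW : expect μ w ≤ 1 := expect_le_of_le fun ω _ => hw ω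
  -- Finiteness is what permits cancelling `V π + s` in `ℝ≥0∞`.
  have hfin : V π + s ≠ ∞ := by
    refine ne_top_of_le_ne_top ENNReal.one_ne_top (le_trans ?_ hW)
    rw [← hsum π]
    gcongr
    exact le_self_add
  have hLρ : L ρ ≤ ENNReal.ofReal (η ^ 2) := by
    refine expect_le_of_le fun ω hω => ?_
    by_cases h0 : w ω = 0
    · simp [h0]
    · calc _ ≤ 1 * ENNReal.ofReal (η ^ 2) := mul_le_mul' (hw ω) (hρ ω hω h0)
        _ = _ := one_mul _
  have hLπ : L π ≤ L ρ + ENNReal.ofReal ε := by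
    have : (V π + s) + L π ≤ (V π + s) + (L ρ + ENNReal.ofReal ε) := by
      calc (V π + s) + L π = V ρ + L ρ + s := by rw [hsum ρ, ← hsum π]; ring
        _ ≤ (V π + ENNReal.ofReal ε) + L ρ + s := by gcongr
        _ = _ := by ring
    exact (ENNReal.add_le_add_iff_left hfin).1 this
  calc _ ≤ L π := expect_mono fun ω _ => by gcongr; exact playedValue_sq_le _ _ _ _
    _ ≤ L ρ + ENNReal.ofReal ε := hLπ
    _ ≤ _ := by gcongr

end Grid

/-! ## Conditional distributions -/

section Fiber

variable {α β : Type}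

open Classical in
/-- The conditional distribution of `a ∼ p` given `f a = b`. -/
def fiber (p : PMF α) (f : α → β) (b : β) : PMF α :=
  -- The default value `p` on null fibers is arbitrary: such fibers carry weight zero in every
  -- identity below.
  if h : ∃ a ∈ f ⁻¹' {b}, a ∈ p.support then p.filter (f ⁻¹' {b}) h else p

theorem mem_fiber_support {p : PMF α} {f : α → β} {b : β} (hb : b ∈ (p.map f).support) {a : α} :
    a ∈ (fiber p f b).support ↔ f a = b ∧ a ∈ p.support := by
  have h : ∃ a ∈ f ⁻¹' {b}, a ∈ p.support := by
    obtain ⟨a, ha, rfl⟩ := (PMF.mem_support_map_iff _ _ _).1 hb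
    exact ⟨a, rfl, ha⟩
  rw [fiber, dif_pos h, PMF.mem_support_filter_iff]
  rfl

open Classical in
theorem expect_filter (p : PMF α) (s : Set α) (h : ∃ a ∈ s, a ∈ p.support) (F : α → ℝ≥0∞) :
    prob p (· ∈ s) * expect (p.filter s h) F = expect p fun a => if a ∈ s then F a else 0 := by
  have h0 : ∑' a, s.indicator p a = prob p (· ∈ s) := by
    refine tsum_congr fun a => ?_
    by_cases ha : a ∈ s <;> simp [ha]
  have hne : prob p (· ∈ s) ≠ 0 := by
    obtain ⟨a, ha, hp⟩ := h
    intro h1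
    simpa [ha] using expect_eq_zero h1 a hp
  have hfin : prob p (· ∈ s) ≠ ∞ := ne_top_of_le_ne_top ENNReal.one_ne_top (prob_le_one _ _)
  unfold expect
  rw [← ENNReal.tsum_mul_left]
  refine tsum_congr fun a => ?_
  rw [PMF.filter_apply, h0]
  by_cases ha : a ∈ s
  · simp only [ha, Set.indicator_of_mem, if_true]
    rw [← mul_assoc, mul_comm (p a), ← mul_assoc, ENNReal.mul_inv_cancel hne hfin, one_mul]
  · simp [ha]

-- The product form of conditioning avoids division and stays true on null fibers, where both sides
-- vanish.
open Classical in
theorem prob_mul_expect_fiber (p : PMF α) (f : α → β) (b : β) (F : α → ℝ≥0∞) :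
    prob p (fun a => f a = b) * expect (fiber p f b) F =
      expect p fun a => if f a = b then F a else 0 := by
  by_cases hs : ∃ a ∈ f ⁻¹' {b}, a ∈ p.support
  · rw [fiber, dif_pos hs]
    exact expect_filter p (f ⁻¹' {b}) hs F
  · push Not at hs
    rw [prob_eq_zero (P := fun a => f a = b) fun a ha h => hs a h ha, zero_mul]
    symm
    refine le_antisymm (expect_le_of_le fun a ha => ?_) zero_le
    rw [if_neg (show ¬ f a = b from fun h => hs a h ha)]

theorem expect_fiber (p : PMF α) (f : α → β) (F : α → ℝ≥0∞) :
    expect (p.map f) (fun b => expect (fiber p f b) F) = expect p F := by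
  classical
  have h : ∀ b, (p.map f) b * expect (fiber p f b) F =
      expect p fun a => if f a = b then F a else 0 := by
    intro b
    have hb : (p.map f) b = prob p (fun a => f a = b) := by
      rw [PMF.map_apply]
      refine tsum_congr fun a => ?_
      by_cases ha : b = f a <;> simp [ha, eq_comm]
    rw [hb]
    exact prob_mul_expect_fiber p f b F
  rw [expect]
  simp_rw [h]
  unfold expect
  rw [ENNReal.tsum_comm]
  refine tsum_congr fun a => ?_
  rw [tsum_eq_single (f a)]
  · simp
  · intro b hb
    simp [hb.symm]

/-- The tower property, with an integrand that may mention the condition. It identifies "latent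
state first, then observation" with "observation first, then decode", and likewise for a pair of
states and one of its components. -/
theorem expect_map_fiber (p : PMF α) (f : α → β) (F : β → α → ℝ≥0∞) :
    expect (p.map f) (fun b => expect (fiber p f b) (F b)) = expect p fun a => F (f a) a := by
  rw [← expect_fiber p f]
  refine expect_congr fun b hb => expect_congr fun a ha => ?_
  rw [((mem_fiber_support hb).1 ha).1]

end Fiber

/-! ## One-context regression -/

section OneContext

variable {X S : Type}

theorem bit_sq_mem {v : ℝ} (hv : v ∈ Set.Icc (0 : ℝ) 1) (y : Bool) :
    (v - bit y) ^ 2 ∈ Set.Icc (0 : ℝ) 1 := by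
  obtain ⟨h0, h1⟩ := hv
  cases y <;> simp only [bit, cond_true, cond_false] <;> constructor <;> nlinarith

/-- A coin whose bias is itself random is a coin with the mean bias, here `c(v - 1)² + (1 - c)v²`.
So the failure probability in a simulated episode is a function of the latent state and the action.
-/
theorem expect_ber_ber {v c : ℝ} (hv : v ∈ Set.Icc (0 : ℝ) 1) (hc : c ∈ Set.Icc (0 : ℝ) 1)
    (F : Bool → ℝ≥0∞) :
    expect (ber c) (fun y => expect (ber ((v - bit y) ^ 2)) F) =
      expect (ber (labelLoss v c)) F := by
  have h1 : labelLoss v c = c * (v - 1) ^ 2 + (1 - c) * (v - 0) ^ 2 := by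
    unfold labelLoss; ring
  have h2 : 1 - labelLoss v c = c * (1 - (v - 1) ^ 2) + (1 - c) * (1 - (v - 0) ^ 2) := by
    unfold labelLoss; ring
  have b1 := bit_sq_mem hv true
  have b0 := bit_sq_mem hv false
  have hc0 := hc.1
  have hc1 : 0 ≤ 1 - c := sub_nonneg.2 hc.2
  rw [expect_ber hc, expect_ber b1, expect_ber b0, expect_ber (labelLoss_mem hv hc), h2, h1]
  simp only [bit, cond_true, cond_false] at b1 b0 ⊢
  rw [ENNReal.ofReal_add (mul_nonneg hc0 b1.1) (mul_nonneg hc1 b0.1),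
    ENNReal.ofReal_add (mul_nonneg hc0 (sub_nonneg.2 b1.2)) (mul_nonneg hc1 (sub_nonneg.2 b0.2)),
    ENNReal.ofReal_mul hc0, ENNReal.ofReal_mul hc1, ENNReal.ofReal_mul hc0, ENNReal.ofReal_mul hc1]
  ring

/-- The law of `(x, z)` with `x ∼ D` and `z ∼ Ber(c x)`. -/
def labelLaw (D : PMF X) (c : X → ℝ) : PMF (X × Bool) :=
  D.bind fun x => (ber (c x)).map fun z => (x, z)

theorem expect_labelLaw (D : PMF X) (c : X → ℝ) (F : X × Bool → ℝ≥0∞) :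
    expect (labelLaw D c) F = expect D fun x => expect (ber (c x)) fun z => F (x, z) := by
  simp [labelLaw, expect_bind, expect_map]

/-! ### Selection by empirical risk -/

theorem sumSqErr_val (R : Predictor1 X) (l : List (X × Bool)) :
    (sumSqErr R l).val = (l.map fun d => ((R d.1).val - bit d.2) ^ 2).sum := by
  induction l with
  | nil => rfl
  | cons d l ih => simp [sumSqErr, sqErr, ih]

/-- The bias-variance decomposition. The second term does not involve `R`, so differences of label
risks are differences of squared errors. -/
theorem expect_labelLaw_sq {D : PMF X} {c : X → ℝ} (hc : ∀ x, c x ∈ Set.Icc (0 : ℝ) 1)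
    (R : X → ℝ) :
    expect (labelLaw D c) (fun d => ENNReal.ofReal ((R d.1 - bit d.2) ^ 2)) =
      expect D (fun x => ENNReal.ofReal ((R x - c x) ^ 2)) +
        expect D (fun x => ENNReal.ofReal (c x * (1 - c x))) := by
  rw [expect_labelLaw, ← expect_add]
  refine expect_congr fun x _ => ?_
  refine (expect_ber_sq (v := R x) (hc x)).trans ?_
  rw [labelLoss,
    ENNReal.ofReal_add (sq_nonneg _) (mul_nonneg (hc x).1 (sub_nonneg.2 (hc x).2))]

/-- The selected candidate has the least empirical risk. Two deviations of size `t` must be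
controlled: a lower tail for whichever candidate is selected, hence for all `l.length + 1` of them,
and one upper tail for the comparator `i`. That makes `l.length + 2` events. The label variance
cancels. -/
theorem prob_argmin_le {ι : Type} {D : PMF X} {c : X → ℝ} (hc : ∀ x, c x ∈ Set.Icc (0 : ℝ) 1)
    (R : ι → Predictor1 X) (hR : ∀ i x, (R i x).val ∈ Set.Icc (0 : ℝ) 1)
    (i₀ : ι) (l : List ι) {i : ι} (hi : i ∈ i₀ :: l) {t : ℝ} (ht0 : 0 ≤ t) (ht : t ≤ 1 / 2)
    {m : ℕ} (hm : 0 < m) :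
    prob (iid (labelLaw D c) m) (fun test =>
      ¬ expect D (fun x => ENNReal.ofReal (((R (argmin (fun j => do
          let r ← sumSqErr (R j) test
          op (r / m)) i₀ l).val x).val - c x) ^ 2)) ≤
        expect D (fun x => ENNReal.ofReal (((R i x).val - c x) ^ 2)) + ENNReal.ofReal (2 * t)) ≤
      ENNReal.ofReal ((l.length + 2) * Real.exp (-(m * t ^ 2))) := by
  set W := labelLaw D c with hW
  set Y : ι → X × Bool → ℝ := fun j d => ((R j d.1).val - bit d.2) ^ 2 with hY
  have hYm : ∀ j d, Y j d ∈ Set.Icc (0 : ℝ) 1 := fun j d => bit_sq_mem (hR j d.1) d.2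
  have hYle : ∀ j, expect W (fun d => ENNReal.ofReal (Y j d)) ≤ 1 := fun j =>
    expect_le_of_le fun d _ => by simpa using (hYm j d).2
  have hYfin : ∀ j, expect W (fun d => ENNReal.ofReal (Y j d)) ≠ ∞ := fun j =>
    ne_top_of_le_ne_top ENNReal.one_ne_top (hYle j)
  have hdec := fun j => expect_labelLaw_sq (D := D) hc fun x => (R j x).val
  have hm' : (0 : ℝ) < m := by exact_mod_cast hm
  calc _ ≤ prob (iid W m) (fun test =>
        (∃ j ∈ i₀ :: l, (test.map (Y j)).sum ≤
          m * ((expect W fun d => ENNReal.ofReal (Y j d)).toReal - t)) ∨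
        m * ((expect W fun d => ENNReal.ofReal (Y i d)).toReal + t) ≤ (test.map (Y i)).sum) := by
        refine prob_mono fun test _ hbad => ?_
        by_contra! hgood
        obtain ⟨h1, h2⟩ := hgood
        refine hbad ?_
        set best := (argmin (fun j => do
          let r ← sumSqErr (R j) test
          op (r / m)) i₀ l).val with hbest
        have h3 := h1 best (argmin_mem _ _ _)
        have h4 : (test.map (Y best)).sum ≤ (test.map (Y i)).sum := by
          have := argmin_le (fun j => do
            let r ← sumSqErr (R j) test
            op (r / m)) i₀ l hi
          simp only [Timed.val_bind, val_op, sumSqErr_val] at this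
          exact (div_le_div_iff_of_pos_right hm').1 this
        have h5 : (expect W fun d => ENNReal.ofReal (Y best d)).toReal ≤
            (expect W fun d => ENNReal.ofReal (Y i d)).toReal + 2 * t := by
          have : m * ((expect W fun d => ENNReal.ofReal (Y best d)).toReal - t) <
            m * ((expect W fun d => ENNReal.ofReal (Y i d)).toReal + t) := by linarith
          linarith [lt_of_mul_lt_mul_left this hm'.le]
        have h6 : (expect W fun d => ENNReal.ofReal (Y best d)) ≤
            (expect W fun d => ENNReal.ofReal (Y i d)) + ENNReal.ofReal (2 * t) := by
          rw [← ENNReal.ofReal_toReal (hYfin best), ← ENNReal.ofReal_toReal (hYfin i),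
            ← ENNReal.ofReal_add ENNReal.toReal_nonneg (by linarith)]
          exact ENNReal.ofReal_le_ofReal h5
        have hs : expect D (fun x => ENNReal.ofReal (c x * (1 - c x))) ≠ ∞ := by
          refine ne_top_of_le_ne_top (hYfin i) ?_
          rw [hY, hdec i]
          exact le_add_self
        refine (ENNReal.add_le_add_iff_right hs).1 ?_
        calc _ = expect W fun d => ENNReal.ofReal (Y best d) := (hdec best).symm
          _ ≤ _ := h6
          _ = _ := by rw [hY, hdec i]; ring
    _ ≤ ((i₀ :: l).map fun _ => ENNReal.ofReal (Real.exp (-(m * t ^ 2)))).sum +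
        ENNReal.ofReal (Real.exp (-(m * t ^ 2))) := by
        refine (prob_or_le _ _ _).trans (add_le_add ?_ (prob_sum_ge_le (hYm i) ht0 ht m))
        refine (prob_exists_mem_le _ _ _).trans ?_
        exact List.sum_le_sum fun j _ => prob_sum_le_le (hYm j) ht0 ht m
    _ = _ := by
        rw [List.map_const', List.sum_replicate, nsmul_eq_mul, ENNReal.ofReal_mul (by positivity),
          ← add_one_mul]
        congr 1
        rw [ENNReal.ofReal_add (by positivity) (by positivity)]
        simp only [List.length_cons, ENNReal.ofReal_natCast, ENNReal.ofReal_ofNat]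
        push_cast
        ring

/-! ### The simulated Block MDP -/

variable {ιX : Bool → X} {ιS : Bool → S} {Φ : Set (X → S)} {φ : X → S}

open Classical in
/-- The Block MDP that `oneRed` simulates: an episode fails (second state `0`) with the
probability that the played value incurs as squared error. -/
def oneMDP (ιX : Bool → X) (ιS : Bool → S) (φ : X → S) (D : PMF X) (g : S → ℝ) (η : ℝ) :
    BlockMDP S X (gridSize η) where
  init := D.map φ
  -- A failure is `b = true` and leads to state `0`, which is `ιS false`.
  trans _ s a := (ber (labelLoss ((a : ℕ) * η) (g s))).map fun b => ιS (!b)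
  emit h s := if h = 0 then fiber D φ s else PMF.pure (if s = ιS false then ιX false else ιX true)

/-- The second observation that `oneRed` simulates. -/
def oneSnd (zero one : X) (η : ℝ) (d : X × Bool) (a : Fin (gridSize η)) : Comp X := do
  let q ← sqErr ((a : ℕ) * η) d.2
  let fail ← ask (ber q)
  op (if fail then zero else one)

theorem oneMDP_decodedBy (hφ0 : ∀ b, φ (ιX b) = ιS b) (D : PMF X) (g : S → ℝ) (η : ℝ) :
    (oneMDP ιX ιS φ D g η).DecodedBy 2 φ := by
  constructor
  · intro s hs x hx
    simp only [oneMDP, if_true] at hs hx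
    exact ((mem_fiber_support hs).1 hx).1
  · intro h _ s a s' hs' x hx
    simp only [oneMDP, PMF.mem_support_map_iff] at hs'
    obtain ⟨b, -, rfl⟩ := hs'
    simp only [oneMDP, Nat.add_eq_zero_iff, one_ne_zero, and_false, if_false, PMF.support_pure,
      Set.mem_singleton_iff] at hx
    subst hx
    split_ifs with h0
    · rw [h0, hφ0]
    · cases b
      · exact hφ0 true
      · exact absurd rfl h0

-- Drawing a state and then an observation from its fiber is drawing `x ∼ D`. The label and the
-- failure coin merge by `expect_ber_ber`. Injectivity of `ιS` makes the second observation reveal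
-- success or failure.
open Classical in
theorem simulates_oneMDP (hιS : Function.Injective ιS) (D : PMF X) {g : S → ℝ}
    (hg : ∀ s, g s ∈ Set.Icc (0 : ℝ) 1) {η : ℝ} (hη : 0 ≤ η) :
    Simulates (labelLaw D fun x => g (φ x)) Prod.fst (oneSnd (ιX false) (ιX true) η)
      (oneMDP ιX ιS φ D g η) := by
  intro a F
  have hv : ((a : ℕ) : ℝ) * η ∈ Set.Icc (0 : ℝ) 1 := ⟨by positivity, natCast_mul_le_one hη a⟩
  simp only [expect_labelLaw, oneSnd, sqErr, Comp.law_bind, Comp.law_lift, val_op, Comp.law_ask,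
    PMF.pure_bind, expect_bind, expect_pure]
  simp only [oneMDP, if_true, one_ne_zero, if_false, expect_pure]
  refine Eq.trans ?_ (expect_map_fiber D φ fun s x =>
    expect ((ber (labelLoss ((a : ℕ) * η) (g s))).map fun b => ιS (!b)) fun s' =>
      F x (if s' = ιS false then ιX false else ιX true)).symm
  refine expect_congr fun x _ => ?_
  rw [expect_map]
  rw [expect_ber_ber hv (hg _) fun b => F x (if b then ιX false else ιX true)]
  refine expect_congr fun b _ => ?_
  cases b <;> simp [hιS.eq_iff]

theorem ber_false {q : ℝ} (hq : q ∈ Set.Icc (0 : ℝ) 1) : ber q false = ENNReal.ofReal (1 - q) := by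
  have := expect_ber hq fun b => if b then 0 else 1
  simpa [expect_fintype] using this

theorem visit_one {A : ℕ} (M : BlockMDP S X A) (π : Policy X A) (s : S) :
    M.visit π 1 s = expect M.init fun s₀ => expect (M.emit 0 s₀) fun x =>
      expect (π 0 x) fun a => M.trans 0 s₀ a s := rfl

theorem visit_oneMDP (hιS : Function.Injective ιS) (D : PMF X) {g : S → ℝ}
    (hg : ∀ s, g s ∈ Set.Icc (0 : ℝ) 1) {η : ℝ} (hη : 0 ≤ η) (π : Policy X (gridSize η)) :
    (oneMDP ιX ιS φ D g η).visit π 1 (ιS true) = expect D fun x => expect (π 0 x) fun a =>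
      ENNReal.ofReal (1 - labelLoss ((a : ℕ) * η) (g (φ x))) := by
  have h : ∀ s (a : Fin (gridSize η)), (oneMDP ιX ιS φ D g η).trans 0 s a (ιS true) =
      ENNReal.ofReal (1 - labelLoss ((a : ℕ) * η) (g s)) := by
    intro s a
    have hv : ((a : ℕ) : ℝ) * η ∈ Set.Icc (0 : ℝ) 1 := ⟨by positivity, natCast_mul_le_one hη a⟩
    rw [← ber_false (labelLoss_mem hv (hg s))]
    simp [oneMDP, PMF.map_apply, hιS.eq_iff, tsum_fintype]
  simp only [visit_one, h]
  simp only [oneMDP, if_true]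
  exact expect_map_fiber D φ fun s x => expect (π 0 x) fun a =>
      ENNReal.ofReal (1 - labelLoss ((a : ℕ) * η) (g s))

/-! ### The guarantee -/

/-- The predictor that `oneRed` selects from the oracle's output. -/
def onePick (η ε δ : ℝ) (data : List (X × Bool)) :
    Option (List (Policy X (gridSize η))) → Predictor1 X
  | none => fun _ => op 0
  | some [] => fun _ => op 0
  | some (π₀ :: Ψ) =>
      playedValue η (argmin (fun π => do
        let r ← sumSqErr (playedValue η π) (data.drop (data.length -
          ⌈16 / ε ^ 2 * Real.log (4 * ((Ψ.length + 1 : ℕ) : ℝ) / δ)⌉₊))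
        op (r / (⌈16 / ε ^ 2 * Real.log (4 * ((Ψ.length + 1 : ℕ) : ℝ) / δ)⌉₊ : ℝ))) π₀ Ψ).val

theorem law_oneRed (O : RLOracle X) (zero one : X) (data : List (X × Bool)) (ε δ : ℝ) :
    (oneRed O zero one data ε δ).law =
      (simulate (O (ε / 4) (δ / 2) 2 (gridSize (Real.sqrt (ε / 4)))) Prod.fst
        (oneSnd zero one (Real.sqrt (ε / 4))) data []).law.bind fun o =>
          PMF.pure (onePick (Real.sqrt (ε / 4)) ε δ data o) := by
  simp only [oneRed, Comp.law_bind, Comp.law_lift, PMF.pure_bind, val_op]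
  refine congrArg _ (funext fun o => ?_)
  rcases o with _ | _ | ⟨π₀, Ψ⟩
  · simp [onePick]
  · simp [onePick]
  · simp [onePick]

/-- The test size is chosen for Hoeffding's inequality with deviation `ε/4`. The `k + 1 ≤ 2k` events
of `prob_argmin_le` then cost at most `δ/2` in total. -/
theorem exp_neg_ceil_le {ε δ k : ℝ} (hε : 0 < ε) (hδ : 0 < δ) (hk : 0 < k) :
    Real.exp (-((⌈16 / ε ^ 2 * Real.log (4 * k / δ)⌉₊ : ℝ) * (ε / 4) ^ 2)) ≤ δ / (4 * k) := by
  have h1 : Real.log (4 * k / δ) ≤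
      (⌈16 / ε ^ 2 * Real.log (4 * k / δ)⌉₊ : ℝ) * (ε / 4) ^ 2 := by
    calc Real.log (4 * k / δ) = 16 / ε ^ 2 * Real.log (4 * k / δ) * (ε / 4) ^ 2 := by
          field_simp
          ring
      _ ≤ _ := by gcongr; exact Nat.le_ceil _
  calc _ ≤ Real.exp (-Real.log (4 * k / δ)) := Real.exp_le_exp.2 (by linarith)
    _ = δ / (4 * k) := by
        rw [Real.exp_neg, Real.exp_log (by positivity), inv_div]

/-- Error budget: `η² = ε/4` for the grid, `ε/4` for the cover's tolerance and `2 · ε/4` for the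
selection. Failure budget: `δ/2` for the oracle and `δ/2` for the test samples. -/
theorem prob_oneRed_le (hreg : IsRegular ιX ιS Φ) {O : RLOracle X} {N K : ℝ → ℝ → ℕ → ℕ → ℕ}
    (hO : IsEfficientRL Φ O N K) (hφ : φ ∈ Φ) (D : PMF X) {g : S → ℝ}
    (hg : ∀ s, g s ∈ Set.Icc (0 : ℝ) 1) {ε δ : ℝ} (hε : ε ∈ Set.Ioo (0 : ℝ) (1 / 2))
    (hδ : δ ∈ Set.Ioo (0 : ℝ) (1 / 2)) {n : ℕ} (hn : oneRedSamples N K ε δ ≤ n) :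
    expect (iid (labelLaw D fun x => g (φ x)) n) (fun data =>
      prob (oneRed O (ιX false) (ιX true) data ε δ).law fun R =>
        ¬ expect D (fun x => ENNReal.ofReal (((R x).val - g (φ x)) ^ 2)) ≤ ENNReal.ofReal ε) ≤
      ENNReal.ofReal δ := by
  obtain ⟨hε0, hε1⟩ := hε
  obtain ⟨hδ0, hδ1⟩ := hδ
  have hη0 : 0 < Real.sqrt (ε / 4) := Real.sqrt_pos.2 (by linarith)
  have hηsq : Real.sqrt (ε / 4) ^ 2 = ε / 4 := Real.sq_sqrt (by linarith)
  obtain ⟨r, hr⟩ : ∃ r, n = N (ε / 4) (δ / 2) 2 (gridSize (Real.sqrt (ε / 4))) + r :=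
    ⟨n - N (ε / 4) (δ / 2) 2 (gridSize (Real.sqrt (ε / 4))), by
      unfold oneRedSamples at hn; omega⟩
  simp only [law_oneRed]
  unfold oneRedSamples at hn
  set η := Real.sqrt (ε / 4) with hη
  rw [hr] at hn ⊢
  have hrK := Nat.le_of_add_le_add_left hn
  calc _ ≤ ENNReal.ofReal (δ / 2) + ENNReal.ofReal (δ / 2) := ?_
    _ = ENNReal.ofReal δ := by rw [← ENNReal.ofReal_add (by linarith) (by linarith)]; congr 1; ring
  refine (simulates_oneMDP hreg.2.1 D hg hη0.le).prob_le hO ⟨by linarith, by linarith⟩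
    ⟨by linarith, by linarith⟩ hφ (oneMDP_decodedBy (hreg.2.2 φ hφ).1 D g η) r
    (fun data o => PMF.pure (onePick η ε δ data o)) _ _ ?_
  intro Ψ hcov hlen l hl
  obtain ⟨ρ, hρ⟩ := exists_grid_policy hη0 fun x => hg (φ x)
  obtain ⟨π, hπ, hvis⟩ := hcov 1 (by norm_num) (ιS true) ρ
  rw [visit_oneMDP hreg.2.1 D hg hη0.le, visit_oneMDP hreg.2.1 D hg hη0.le] at hvis
  have hbest := expect_sq_le_of_success hη0.le D (fun _ => 1) (fun _ => le_rfl) id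
    (c := fun x => g (φ x)) (fun x => hg _) (π := π) (ρ := ρ) (ε := ε / 4)
    (fun x _ _ => hρ x) (by simpa using hvis)
  simp only [one_mul, id, hηsq] at hbest
  cases Ψ with
  | nil => simp at hπ
  | cons π₀ Ψ =>
    set m := ⌈16 / ε ^ 2 * Real.log (4 * ((Ψ.length + 1 : ℕ) : ℝ) / δ)⌉₊ with hm
    have hlog : 0 < Real.log (4 * ((Ψ.length + 1 : ℕ) : ℝ) / δ) := by
      refine Real.log_pos ?_
      rw [one_lt_div hδ0]
      push_cast
      nlinarith [(Nat.cast_nonneg Ψ.length : (0 : ℝ) ≤ Ψ.length)]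
    have hm0 : 0 < m := Nat.ceil_pos.2 (by positivity)
    -- The test size for the actual cover is at most the one computed from the bound `K`, because
    -- the logarithm is monotone.
    have hmr : m ≤ r := by
      refine le_trans (Nat.ceil_le_ceil ?_) hrK
      gcongr
      exact hlen
    obtain ⟨j, rfl⟩ : ∃ j, r = j + m := ⟨r - m, by omega⟩
    -- The last `m` samples all lie in `l'`, which the oracle did not use, so the candidates are
    -- independent of the test set.
    have hdrop : ∀ l' ∈ (iid (labelLaw D fun x => g (φ x)) (j + m)).support,
        (l ++ l').drop ((l ++ l').length - m) = l'.drop j := by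
      intro l' hl'
      have := (mem_support_iid.1 hl').1
      rw [List.length_append, this, show l.length + (j + m) - m = l.length + j by omega,
        List.drop_append, List.drop_of_length_le (by omega)]
      simp
    set G : List (X × Bool) → ℝ≥0∞ := fun test =>
      prob (PMF.pure (playedValue η (argmin (fun π => do
            let r ← sumSqErr (playedValue η π) test
            op (r / (m : ℝ))) π₀ Ψ).val)) (fun R =>
          ¬ expect D (fun x => ENNReal.ofReal (((R x).val - g (φ x)) ^ 2)) ≤ ENNReal.ofReal ε)
      with hG
    have hstep : ∀ l' ∈ (iid (labelLaw D fun x => g (φ x)) (j + m)).support,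
        prob (PMF.pure (onePick η ε δ (l ++ l') (some (π₀ :: Ψ)))) (fun R =>
          ¬ expect D (fun x => ENNReal.ofReal (((R x).val - g (φ x)) ^ 2)) ≤ ENNReal.ofReal ε) =
        G (l'.drop j) := by
      intro l' hl'
      simp only [onePick, hG]
      rw [← hm, hdrop l' hl']
    rw [expect_congr hstep, expect_iid_drop, hG, expect_prob_pure]
    have hsel := prob_argmin_le (D := D) (c := fun x => g (φ x)) (fun x => hg _)
        (fun π => playedValue η π) (fun π x => playedValue_mem hη0.le π x) π₀ Ψ hπ
        (t := ε / 4) (by linarith) (by linarith) hm0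
    refine le_trans ?_ (hsel.trans ?_)
    · refine prob_mono fun test _ hbad hgood => hbad ?_
      refine hgood.trans ?_
      calc _ ≤ ENNReal.ofReal (ε / 4) + ENNReal.ofReal (ε / 4) + ENNReal.ofReal (2 * (ε / 4)) := by
            gcongr
        _ = ENNReal.ofReal ε := by
            rw [← ENNReal.ofReal_add (by linarith) (by linarith),
              ← ENNReal.ofReal_add (by linarith) (by linarith)]
            congr 1
            ring
    · refine ENNReal.ofReal_le_ofReal ?_
      have hk : (0 : ℝ) < ((Ψ.length + 1 : ℕ) : ℝ) := by positivity
      have hexp := exp_neg_ceil_le hε0 hδ0 hk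
      rw [← hm] at hexp
      calc ((Ψ.length : ℝ) + 2) * Real.exp (-(m * (ε / 4) ^ 2))
          ≤ (2 * ((Ψ.length + 1 : ℕ) : ℝ)) * (δ / (4 * ((Ψ.length + 1 : ℕ) : ℝ))) := by
            gcongr
            push_cast
            linarith [(Nat.cast_nonneg Ψ.length : (0 : ℝ) ≤ Ψ.length)]
        _ = δ / 2 := by field_simp; norm_num

end OneContext

/-! ## Two-context regression over the base class -/

section PairLaw

variable {X S : Type}

/-- The law of `(x₁, x₂)` when `(s₁, s₂) ∼ p` and, independently given the states,
`x₁ ∼ q₁ s₁` and `x₂ ∼ q₂ s₂`. -/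
def pairLaw (p : PMF (S × S)) (q₁ q₂ : S → PMF X) : PMF (X × X) :=
  p.bind fun st => (q₁ st.1).bind fun x => (q₂ st.2).map fun y => (x, y)

/-- The emissions of all states that occur under `p` are decoded by `φ`. -/
def Decodes (φ : X → S) (p : PMF (S × S)) (q₁ q₂ : S → PMF X) : Prop :=
  ∀ st ∈ p.support,
    (∀ x ∈ (q₁ st.1).support, φ x = st.1) ∧ ∀ x ∈ (q₂ st.2).support, φ x = st.2

theorem expect_pairLaw (p : PMF (S × S)) (q₁ q₂ : S → PMF X) (F : X × X → ℝ≥0∞) :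
    expect (pairLaw p q₁ q₂) F =
      expect p fun st => expect (q₁ st.1) fun x => expect (q₂ st.2) fun y => F (x, y) := by
  simp [pairLaw, expect_bind, expect_map]

theorem pairLaw_apply (p : PMF (S × S)) (q₁ q₂ : S → PMF X) (x y : X) :
    pairLaw p q₁ q₂ (x, y) = ∑' st, p st * q₁ st.1 x * q₂ st.2 y := by
  unfold pairLaw
  rw [PMF.bind_apply]
  refine tsum_congr fun st => ?_
  rw [PMF.bind_apply, tsum_eq_single x, PMF.map_apply, tsum_eq_single y, mul_assoc]
  · simp
  · intro y' hy'
    simp [hy'.symm]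
  · intro x' hx'
    rw [PMF.map_apply]
    simp [hx'.symm]

/-- `D (x, y)` is one of the nonnegative terms whose sum is `pairLaw p q₁ q₂ (x, y)`, so `D` lies
below a probability distribution and equals it. Hence all the other terms vanish, which says that
the emissions of every pair of states in the support of `p` decode correctly. -/
theorem Realizable.exists_pairLaw {φ : X → S} {D : PMF (X × X)} (h : Realizable φ D) :
    ∃ p q₁ q₂, D = pairLaw p q₁ q₂ ∧ Decodes φ p q₁ q₂ := by
  obtain ⟨p, q₁, q₂, hD⟩ := h
  have heq : D = pairLaw p q₁ q₂ := by
    refine eq_of_forall_le fun ⟨x, y⟩ => ?_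
    rw [hD, pairLaw_apply]
    exact ENNReal.le_tsum (f := fun st : S × S => p st * q₁ st.1 x * q₂ st.2 y) (φ x, φ y)
  refine ⟨p, q₁, q₂, heq, fun st hst => ?_⟩
  have key : ∀ x ∈ (q₁ st.1).support, ∀ y ∈ (q₂ st.2).support, st = (φ x, φ y) := by
    classical
    intro x hx y hy
    by_contra hne
    have h1 : D (x, y) = ∑' st : S × S, p st * q₁ st.1 x * q₂ st.2 y := by
      rw [heq, pairLaw_apply]
    have h2 := ENNReal.sum_le_tsum (f := fun st : S × S => p st * q₁ st.1 x * q₂ st.2 y)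
      {st, (φ x, φ y)}
    rw [← h1, hD, Finset.sum_pair hne] at h2
    have hfin : p (φ x, φ y) * q₁ (φ x) x * q₂ (φ y) y ≠ ∞ := by
      rw [← hD]; exact D.apply_ne_top _
    have h3 : p st * q₁ st.1 x * q₂ st.2 y = 0 := by
      by_contra h0
      exact absurd h2 (not_le.2 (by
        rw [add_comm]; exact ENNReal.lt_add_right hfin h0))
    rw [PMF.mem_support_iff] at hst hx hy
    exact mul_ne_zero (mul_ne_zero hst hx) hy h3
  -- `key` concerns both observations at once. A fixed possible observation on one side isolates the
  -- claim about the other.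
  obtain ⟨x₀, hx₀⟩ := (q₁ st.1).support_nonempty
  obtain ⟨y₀, hy₀⟩ := (q₂ st.2).support_nonempty
  exact ⟨fun x hx => (congrArg Prod.fst (key x hx y₀ hy₀)).symm,
    fun y hy => (congrArg Prod.snd (key x₀ hx₀ y hy)).symm⟩

theorem expect_sampleLaw (φ : X → S) (D : PMF (X × X)) (f : S → S → ℝ)
    (F : X × X × Bool → ℝ≥0∞) :
    expect (sampleLaw φ D f) F =
      expect D fun x => expect (ber (f (φ x.1) (φ x.2))) fun y => F (x.1, x.2, y) := by
  simp [sampleLaw, expect_bind, expect_map]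

theorem expect_pairLaw_decode {φ : X → S} {p : PMF (S × S)} {q₁ q₂ : S → PMF X}
    (h : Decodes φ p q₁ q₂) (F : S → S → X → X → ℝ≥0∞) :
    expect (pairLaw p q₁ q₂) (fun x => F (φ x.1) (φ x.2) x.1 x.2) =
      expect p fun st => expect (q₁ st.1) fun x => expect (q₂ st.2) fun y =>
        F st.1 st.2 x y := by
  rw [expect_pairLaw]
  refine expect_congr fun st hst => expect_congr fun x hx => expect_congr fun y hy => ?_
  rw [(h st hst).1 x hx, (h st hst).2 y hy]

theorem expect_sampleLaw_decode {φ : X → S} {p : PMF (S × S)} {q₁ q₂ : S → PMF X}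
    (h : Decodes φ p q₁ q₂) (f : S → S → ℝ) (F : X × X × Bool → ℝ≥0∞) :
    expect (sampleLaw φ (pairLaw p q₁ q₂) f) F =
      expect p fun st => expect (q₁ st.1) fun x => expect (q₂ st.2) fun y =>
        expect (ber (f st.1 st.2)) fun z => F (x, y, z) := by
  rw [expect_sampleLaw]
  exact expect_pairLaw_decode h fun s t x y => expect (ber (f s t)) fun z => F (x, y, z)

end PairLaw

section TwoContext

variable {X S : Type} {ιX : Bool → X} {ιS : Bool → S} {Φ : Set (X → S)} {φ : X → S}
  {p : PMF (S × S)} {q₁ q₂ : S → PMF X} {f : S → S → ℝ}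

/-! ### The simulated Block MDP -/

open Classical in
/-- The Block MDP that `twoRed` simulates: an episode fails (second state `0`) with the
probability that the played value incurs as squared error, and otherwise moves to the state of
the second context. -/
def twoMDP (ιX : Bool → X) (ιS : Bool → S) (p : PMF (S × S)) (q₁ q₂ : S → PMF X)
    (f : S → S → ℝ) (η : ℝ) : BlockMDP S X (gridSize η) where
  init := p.map Prod.fst
  -- The second state is drawn from its conditional law given the first one, and the failure coin
  -- depends on both states.
  trans _ s a := (fiber p Prod.fst s).bind fun st =>
    (ber (labelLoss ((a : ℕ) * η) (f st.1 st.2))).map fun b => if b then ιS false else st.2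
  emit h s := if h = 0 then q₁ s else if s = ιS false then PMF.pure (ιX false) else q₂ s

/-- The second observation that `twoRed` simulates. -/
def twoSnd (zero : X) (η : ℝ) (d : X × X × Bool) (a : Fin (gridSize η)) : Comp X := do
  let q ← sqErr ((a : ℕ) * η) d.2.2
  let fail ← ask (ber q)
  op (if fail then zero else d.2.1)

theorem fiber_support_subset {α β : Type} (p : PMF α) (g : α → β) (b : β) :
    (fiber p g b).support ⊆ p.support := by
  unfold fiber
  split_ifs with h
  · rw [PMF.support_filter]
    exact Set.inter_subset_right
  · exact subset_rfl

theorem twoMDP_decodedBy (hφ0 : ∀ b, φ (ιX b) = ιS b) (hdec : Decodes φ p q₁ q₂)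
    (f : S → S → ℝ) (η : ℝ) : (twoMDP ιX ιS p q₁ q₂ f η).DecodedBy 2 φ := by
  constructor
  · intro s hs x hx
    simp only [twoMDP, if_true, PMF.mem_support_map_iff] at hs hx
    obtain ⟨st, hst, rfl⟩ := hs
    exact (hdec st hst).1 x hx
  · intro h _ s a s' hs' x hx
    simp only [twoMDP, PMF.mem_support_bind_iff, PMF.mem_support_map_iff] at hs'
    obtain ⟨st, hst, b, -, hb⟩ := hs'
    simp only [twoMDP, Nat.add_eq_zero_iff, one_ne_zero, and_false, if_false] at hx
    split_ifs at hx with h0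
    · simp only [PMF.support_pure, Set.mem_singleton_iff] at hx
      rw [hx, h0, hφ0]
    · cases b
      · simp only [Bool.false_eq_true, if_false] at hb
        subst hb
        exact (hdec st (fiber_support_subset _ _ _ hst)).2 x hx
      · exact absurd hb.symm h0

/-- Given the two states, the contexts and the label are independent, so the label and the failure
coin merge by `expect_ber_ber` before `x₂` is revealed. By `hns`, no genuine second state is
confused with the failure state. -/
theorem simulates_twoMDP (hdec : Decodes φ p q₁ q₂)
    (hns : ∀ st ∈ p.support, st.2 ∉ Set.range ιS)
    (hf : ∀ s t, f s t ∈ Set.Icc (0 : ℝ) 1) {η : ℝ} (hη : 0 ≤ η) :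
    Simulates (sampleLaw φ (pairLaw p q₁ q₂) f) (fun d => d.1) (twoSnd (ιX false) η)
      (twoMDP ιX ιS p q₁ q₂ f η) := by
  intro a F
  have hv : ((a : ℕ) : ℝ) * η ∈ Set.Icc (0 : ℝ) 1 := ⟨by positivity, natCast_mul_le_one hη a⟩
  simp only [expect_sampleLaw_decode hdec, twoSnd, sqErr, Comp.law_bind, Comp.law_lift, val_op,
    Comp.law_ask, PMF.pure_bind, expect_bind, expect_pure]
  -- In the Block MDP `x₁` is drawn before the second state. Given the first state the two draws are
  -- independent, so they can be exchanged.
  have hR : ∀ s : S, expect ((twoMDP ιX ιS p q₁ q₂ f η).emit 0 s) (fun x =>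
      expect ((twoMDP ιX ιS p q₁ q₂ f η).trans 0 s a) fun s' =>
        expect ((twoMDP ιX ιS p q₁ q₂ f η).emit 1 s') (F x)) =
      expect (fiber p Prod.fst s) fun st => expect (q₁ s) fun x =>
        expect (ber (labelLoss ((a : ℕ) * η) (f st.1 st.2))) fun b =>
          expect ((twoMDP ιX ιS p q₁ q₂ f η).emit 1 (if b then ιS false else st.2)) (F x) := by
    intro s
    rw [expect_comm]
    simp only [twoMDP, expect_bind, expect_map, if_true]
    exact expect_congr fun st _ => expect_comm _ _ _
  simp only [hR]
  refine Eq.trans ?_ (expect_map_fiber p Prod.fst fun s st => expect (q₁ s) fun x =>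
        expect (ber (labelLoss ((a : ℕ) * η) (f st.1 st.2))) fun b =>
          expect ((twoMDP ιX ιS p q₁ q₂ f η).emit 1 (if b then ιS false else st.2)) (F x)).symm
  refine expect_congr fun st hst => expect_congr fun x _ => ?_
  have h1 : ∀ y : X, expect (ber (f st.1 st.2)) (fun z =>
      expect (ber (((a : ℕ) * η - bit z) ^ 2)) fun b => F x (if b = true then ιX false else y)) =
      expect (ber (labelLoss ((a : ℕ) * η) (f st.1 st.2))) fun b =>
        F x (if b = true then ιX false else y) := fun y =>
    expect_ber_ber hv (hf _ _) fun b => F x (if b = true then ιX false else y)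
  simp only [h1]
  rw [expect_comm]
  refine expect_congr fun b _ => ?_
  have hne : st.2 ≠ ιS false := fun h => hns st hst ⟨false, h.symm⟩
  cases b
  · simp [twoMDP, hne]
  · simp [twoMDP, expect_const, expect_pure]

-- A non-special state `t` can only be entered by an episode that does not fail, so its visitation
-- probability is the success probability jointly with `st.2 = t`.
open Classical in
theorem visit_twoMDP {t : S} (ht : t ∉ Set.range ιS)
    (hf : ∀ s t, f s t ∈ Set.Icc (0 : ℝ) 1) {η : ℝ} (hη : 0 ≤ η) (π : Policy X (gridSize η)) :
    (twoMDP ιX ιS p q₁ q₂ f η).visit π 1 t = expect p fun st => expect (q₁ st.1) fun x =>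
      (if st.2 = t then 1 else 0) * expect (π 0 x) fun a =>
        ENNReal.ofReal (1 - labelLoss ((a : ℕ) * η) (f st.1 st.2)) := by
  have hne : t ≠ ιS false := fun h => ht ⟨false, h.symm⟩
  have h : ∀ s (a : Fin (gridSize η)), (twoMDP ιX ιS p q₁ q₂ f η).trans 0 s a t =
      expect (fiber p Prod.fst s) fun st => (if st.2 = t then 1 else 0) *
        ENNReal.ofReal (1 - labelLoss ((a : ℕ) * η) (f st.1 st.2)) := by
    intro s a
    have hv : ((a : ℕ) : ℝ) * η ∈ Set.Icc (0 : ℝ) 1 := ⟨by positivity, natCast_mul_le_one hη a⟩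
    simp only [twoMDP, PMF.bind_apply]
    refine tsum_congr fun st => ?_
    congr 1
    beta_reduce
    rw [← ber_false (labelLoss_mem hv (hf st.1 st.2)), PMF.map_apply, tsum_fintype,
      Fintype.sum_bool]
    by_cases hst : st.2 = t
    · simp [hst, hne]
    · simp [hst, hne, Ne.symm hst]
  simp only [visit_one, h]
  simp only [twoMDP, if_true]
  refine Eq.trans (expect_congr fun s _ => ?_) (expect_map_fiber p Prod.fst fun s st =>
    expect (q₁ s) fun x => (if st.2 = t then 1 else 0) * expect (π 0 x) fun a =>
        ENNReal.ofReal (1 - labelLoss ((a : ℕ) * η) (f st.1 st.2)))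
  rw [expect_comm]
  refine expect_congr fun x _ => ?_
  simp only [← expect_const_mul]
  rw [expect_comm]

open Classical in
/-- In a policy cover, each second state has a policy that predicts well jointly with it. -/
theorem exists_good_policy (hdec : Decodes φ p q₁ q₂) {t : S} (ht : t ∉ Set.range ιS)
    (hf : ∀ s t, f s t ∈ Set.Icc (0 : ℝ) 1) {η ε : ℝ} (hη : 0 < η)
    {Ψ : List (Policy X (gridSize η))} (hΨ : (twoMDP ιX ιS p q₁ q₂ f η).IsCover 2 ε Ψ) :
    ∃ π ∈ Ψ, expect p (fun st => (if st.2 = t then 1 else 0) * expect (q₁ st.1) fun x =>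
      ENNReal.ofReal (((playedValue η π x).val - f st.1 st.2) ^ 2)) ≤
        ENNReal.ofReal (η ^ 2) + ENNReal.ofReal ε := by
  -- With `t` fixed, the ideal prediction `f (φ x) t` is a function of the first context, so a
  -- policy can play its rounding. It need only be good on the event `st.2 = t`.
  obtain ⟨ρ, hρ⟩ := exists_grid_policy hη fun x => hf (φ x) t
  obtain ⟨π, hπ, hvis⟩ := hΨ 1 (by norm_num) t ρ
  refine ⟨π, hπ, ?_⟩
  rw [visit_twoMDP ht hf hη.le, visit_twoMDP ht hf hη.le] at hvis
  have key := expect_sq_le_of_success hη.le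
    (p.bind fun st => (q₁ st.1).map fun x => (st, x)) (fun ω => if ω.1.2 = t then 1 else 0)
    (fun ω => by split_ifs <;> simp) (fun ω => ω.2) (c := fun ω => f ω.1.1 ω.1.2)
    (fun ω => hf _ _) (π := π) (ρ := ρ) (ε := ε) ?_ ?_
  · rw [expect_bind] at key
    refine le_trans (le_of_eq (expect_congr fun st _ => ?_)) key
    rw [← expect_const_mul, expect_map]
  · rintro ⟨st, x⟩ hω hw
    simp only [PMF.mem_support_bind_iff, PMF.mem_support_map_iff, Prod.mk.injEq] at hω
    obtain ⟨st', hst, x', hx, rfl, rfl⟩ := hω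
    have h2 : st'.2 = t := by
      by_contra h
      simp [h] at hw
    have := hρ x'
    rw [(hdec st' hst).1 x' hx, ← h2] at this
    exact this
  · simp only [expect_bind, expect_map]
    exact hvis

/-! ### Relabeling -/

theorem expect_ber_mix {Ω : Type} (μ : PMF Ω) {c : Ω → ℝ} (hc : ∀ ω, c ω ∈ Set.Icc (0 : ℝ) 1)
    (F : Bool → ℝ≥0∞) :
    expect μ (fun ω => expect (ber (c ω)) F) =
      expect (ber (expect μ fun ω => ENNReal.ofReal (c ω)).toReal) F := by
  have h1 : expect μ (fun ω => ENNReal.ofReal (c ω)) ≤ 1 :=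
    expect_le_of_le fun ω _ => by simpa using (hc ω).2
  simp only [expect_ber (hc _)]
  rw [expect_add, expect_mul_const, expect_mul_const, expect_ofReal_one_sub hc,
    expect_ber ⟨ENNReal.toReal_nonneg, ENNReal.toReal_mono ENNReal.one_ne_top h1⟩,
    ENNReal.ofReal_toReal (ne_top_of_le_ne_top ENNReal.one_ne_top h1)]

/-- The first context's expectation given the second state. -/
def condExpect (p : PMF (S × S)) (q₁ : S → PMF X) (t : S) (F : S → S → X → ℝ≥0∞) : ℝ≥0∞ :=
  expect (fiber p Prod.snd t) fun st => expect (q₁ st.1) fun x => F st.1 st.2 x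

/-- The probability that a label drawn for the predictor `v` is `1`, given the second state. -/
def condLoss (p : PMF (S × S)) (q₁ : S → PMF X) (f : S → S → ℝ) (v : X → ℝ) (t : S) : ℝ :=
  (condExpect p q₁ t fun s t x => ENNReal.ofReal (labelLoss (v x) (f s t))).toReal

theorem condExpect_labelLoss_le {v : X → ℝ} (hv : ∀ x, v x ∈ Set.Icc (0 : ℝ) 1)
    (hf : ∀ s t, f s t ∈ Set.Icc (0 : ℝ) 1) (t : S) :
    (condExpect p q₁ t fun s t x => ENNReal.ofReal (labelLoss (v x) (f s t))) ≤ 1 :=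
  expect_le_of_le fun st _ => expect_le_of_le fun x _ => by
    simpa using (labelLoss_mem (hv x) (hf st.1 st.2)).2

theorem condLoss_mem {v : X → ℝ} (hv : ∀ x, v x ∈ Set.Icc (0 : ℝ) 1)
    (hf : ∀ s t, f s t ∈ Set.Icc (0 : ℝ) 1) (t : S) :
    condLoss p q₁ f v t ∈ Set.Icc (0 : ℝ) 1 :=
  ⟨ENNReal.toReal_nonneg,
    ENNReal.toReal_mono ENNReal.one_ne_top (condExpect_labelLoss_le hv hf t)⟩

/-- Conditional bias-variance decomposition: for a fixed second state, ranking predictors by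
`condLoss` ranks them by conditional squared error. -/
theorem ofReal_condLoss {v : X → ℝ} (hv : ∀ x, v x ∈ Set.Icc (0 : ℝ) 1)
    (hf : ∀ s t, f s t ∈ Set.Icc (0 : ℝ) 1) (t : S) :
    ENNReal.ofReal (condLoss p q₁ f v t) =
      (condExpect p q₁ t fun s t x => ENNReal.ofReal ((v x - f s t) ^ 2)) +
      condExpect p q₁ t fun s t _ => ENNReal.ofReal (f s t * (1 - f s t)) := by
  rw [condLoss, ENNReal.ofReal_toReal
    (ne_top_of_le_ne_top ENNReal.one_ne_top (condExpect_labelLoss_le hv hf t))]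
  unfold condExpect
  rw [← expect_add]
  refine expect_congr fun st _ => ?_
  rw [← expect_add]
  refine expect_congr fun x _ => ?_
  beta_reduce
  rw [labelLoss, ENNReal.ofReal_add (sq_nonneg _)
    (mul_nonneg (hf _ _).1 (sub_nonneg.2 (hf _ _).2))]

/-- Disintegration along the second state. -/
theorem expect_eq_condExpect (p : PMF (S × S)) (q₁ q₂ : S → PMF X)
    (F : S → S → X → X → ℝ≥0∞) :
    (expect p fun st => expect (q₁ st.1) fun x => expect (q₂ st.2) fun y => F st.1 st.2 x y) =
      expect (p.map Prod.snd) fun t => expect (q₂ t) fun y =>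
        condExpect p q₁ t fun s t x => F s t x y := by
  have h : ∀ t, (expect (q₂ t) fun y => condExpect p q₁ t fun s t x => F s t x y) =
      expect (fiber p Prod.snd t) fun st => expect (q₁ st.1) fun x =>
        expect (q₂ t) fun y => F st.1 st.2 x y := by
    intro t
    unfold condExpect
    rw [expect_comm]
    refine expect_congr fun st _ => ?_
    rw [expect_comm]
  simp only [h]
  exact (expect_map_fiber p Prod.snd fun t st => expect (q₁ st.1) fun x =>
        expect (q₂ t) fun y => F st.1 st.2 x y).symm

theorem expect_map_snd_pairLaw (F : X → ℝ≥0∞) :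
    expect ((pairLaw p q₁ q₂).map Prod.snd) F =
      expect (p.map Prod.snd) fun t => expect (q₂ t) F := by
  rw [expect_map, expect_pairLaw, expect_map]
  simp [expect_const]

theorem mem_support_of_map_snd (hdec : Decodes φ p q₁ q₂) {t : S}
    (ht : t ∈ (p.map Prod.snd).support) {y : X} (hy : y ∈ (q₂ t).support) : φ y = t := by
  obtain ⟨st, hst, rfl⟩ := (PMF.mem_support_map_iff _ _ _).1 ht
  exact (hdec st hst).2 y hy

/-- Given the second state, `x₂` is independent of the first context and of the label. So the mean
of `z` given `x₂` is a function of `φ x₂`, and the relabeled samples form a one-context problem for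
the same concept. -/
theorem bind_relabel (hdec : Decodes φ p q₁ q₂) (hf : ∀ s t, f s t ∈ Set.Icc (0 : ℝ) 1)
    {R : Predictor1 X} (hR : ∀ x, (R x).val ∈ Set.Icc (0 : ℝ) 1) :
    ((sampleLaw φ (pairLaw p q₁ q₂) f).bind fun d => (relabel R d).law) =
      labelLaw ((pairLaw p q₁ q₂).map Prod.snd)
        fun x => condLoss p q₁ f (fun x => (R x).val) (φ x) := by
  refine ext_of_expect fun F => ?_
  have hlaw : ∀ d : X × X × Bool, expect (relabel R d).law F =
      expect (ber (((R d.1).val - bit d.2.2) ^ 2)) fun z => F (d.2.1, z) := by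
    intro d
    simp [relabel, sqErr, expect_bind, expect_pure]
  rw [expect_bind]
  simp only [hlaw]
  rw [expect_sampleLaw_decode hdec, expect_labelLaw, expect_map_snd_pairLaw]
  simp only [expect_ber_ber (hR _) (hf _ _)]
  rw [expect_eq_condExpect p q₁ q₂ fun s t x y =>
    expect (ber (labelLoss (R x).val (f s t))) fun z => F (y, z)]
  refine expect_congr fun t ht => expect_congr fun y hy => ?_
  rw [mem_support_of_map_snd hdec ht hy]
  have := expect_ber_mix ((fiber p Prod.snd t).bind fun st => (q₁ st.1).map fun x => (st, x))
    (c := fun ω => labelLoss (R ω.2).val (f ω.1.1 ω.1.2))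
    (fun ω => labelLoss_mem (hR _) (hf _ _)) fun z => F (y, z)
  simp only [expect_bind, expect_map] at this
  exact this

/-! ### From the estimated losses to the final predictor -/

/-- The predictor of `twoRed`, from the scored policies. -/
def twoPick {A : ℕ} (η : ℝ) : List (Policy X A × Predictor1 X) → Predictor2 X
  | [] => fun _ _ => op 0
  | q :: l => fun x₁ x₂ => do
      let best ← argmin (fun q => q.2 x₂) q l
      playedValue η best.1 x₁

/-- The true loss of `b` exceeds that of `i` by at most the estimation errors of the two, since `r b
≤ r i`. AM-GM turns each error `u` into `α/2 + u²/(2α)`, so that only mean squared errors need to be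
controlled. -/
theorem condExpect_argmin_le {ι : Type} {v : ι → X → ℝ} (hv : ∀ i x, v i x ∈ Set.Icc (0 : ℝ) 1)
    (hf : ∀ s t, f s t ∈ Set.Icc (0 : ℝ) 1) {r : ι → ℝ} {l : List ι} {b i : ι} (hb : b ∈ l)
    (hi : i ∈ l) (hle : r b ≤ r i) {α : ℝ} (hα : 0 < α) (t : S) :
    (condExpect p q₁ t fun s t x => ENNReal.ofReal ((v b x - f s t) ^ 2)) ≤
      (condExpect p q₁ t fun s t x => ENNReal.ofReal ((v i x - f s t) ^ 2)) +
        ENNReal.ofReal α + ENNReal.ofReal (1 / α) *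
          (l.map fun j => ENNReal.ofReal ((r j - condLoss p q₁ f (v j) t) ^ 2)).sum := by
  set Q := (l.map fun j => ENNReal.ofReal ((r j - condLoss p q₁ f (v j) t) ^ 2)).sum with hQ
  have hQle : ∀ j ∈ l, ENNReal.ofReal ((r j - condLoss p q₁ f (v j) t) ^ 2) ≤ Q := fun j hj =>
    List.single_le_sum (fun _ _ => zero_le) _ (List.mem_map_of_mem hj)
  have hs : (condExpect p q₁ t fun s t _ => ENNReal.ofReal (f s t * (1 - f s t))) ≠ ∞ := by
    refine ne_top_of_le_ne_top (ENNReal.ofReal_ne_top (r := condLoss p q₁ f (v b) t)) ?_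
    rw [ofReal_condLoss (hv b) hf]
    exact le_add_self
  refine (ENNReal.add_le_add_iff_right hs).1 ?_
  rw [← ofReal_condLoss (hv b) hf]
  calc ENNReal.ofReal (condLoss p q₁ f (v b) t)
      ≤ ENNReal.ofReal (condLoss p q₁ f (v i) t + α +
          1 / (2 * α) * ((r b - condLoss p q₁ f (v b) t) ^ 2 +
            (r i - condLoss p q₁ f (v i) t) ^ 2)) := by
        refine ENNReal.ofReal_le_ofReal ?_
        have amgm : ∀ u : ℝ, u ≤ α / 2 + 1 / (2 * α) * u ^ 2 := by
          intro u
          have : α / 2 + 1 / (2 * α) * u ^ 2 - u = (u - α) ^ 2 / (2 * α) := by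
            field_simp; ring
          have h2 : 0 ≤ (u - α) ^ 2 / (2 * α) := by positivity
          linarith
        have h1 := amgm (-(r b - condLoss p q₁ f (v b) t))
        have h2 := amgm (r i - condLoss p q₁ f (v i) t)
        rw [neg_sq] at h1
        linarith
    _ = ENNReal.ofReal (condLoss p q₁ f (v i) t) + ENNReal.ofReal α +
          ENNReal.ofReal (1 / (2 * α)) * (ENNReal.ofReal ((r b - condLoss p q₁ f (v b) t) ^ 2) +
            ENNReal.ofReal ((r i - condLoss p q₁ f (v i) t) ^ 2)) := by
        rw [ENNReal.ofReal_add (add_nonneg (condLoss_mem (hv i) hf t).1 hα.le) (by positivity),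
          ENNReal.ofReal_add (condLoss_mem (hv i) hf t).1 hα.le, ENNReal.ofReal_mul (by positivity),
          ENNReal.ofReal_add (sq_nonneg _) (sq_nonneg _)]
    -- The selected `b` will vary with the second observation. Bounding each error by the sum `Q`
    -- over all candidates makes the bound uniform in the choice.
    _ ≤ ENNReal.ofReal (condLoss p q₁ f (v i) t) + ENNReal.ofReal α +
          ENNReal.ofReal (1 / (2 * α)) * (Q + Q) := by
        gcongr
        · exact hQle b hb
        · exact hQle i hi
    _ = _ := by
        rw [ofReal_condLoss (hv i) hf, ← two_mul, ← mul_assoc,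
          show ENNReal.ofReal (1 / α) = ENNReal.ofReal (1 / (2 * α)) * 2 by
            rw [← ENNReal.ofReal_ofNat 2, ← ENNReal.ofReal_mul (by positivity)]
            congr 1
            field_simp]
        ring

open Classical in
/-- If every second state `t ∈ T` has a predictor in `l` that is good jointly with it, and the
conditional losses are estimated well by `r`, then it is good to use at `(x, y)` a predictor with
the least estimate at `y`. -/
theorem expect_sq_select_le (hdec : Decodes φ p q₁ q₂)
    (hf : ∀ s t, f s t ∈ Set.Icc (0 : ℝ) 1) {ι : Type} {l : List ι} {v r : ι → X → ℝ}
    (hv : ∀ i x, v i x ∈ Set.Icc (0 : ℝ) 1) {R : X → X → ℝ}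
    (hR : ∀ y, ∃ b ∈ l, (∀ i ∈ l, r b y ≤ r i y) ∧ ∀ x, R x y = v b x) (T : Finset S)
    (hT : ∀ st ∈ p.support, st.2 ∈ T) {α : ℝ} (hα : 0 < α) {a b : ℝ≥0∞}
    (hgood : ∀ t ∈ T, ∃ i ∈ l, expect p (fun st => (if st.2 = t then 1 else 0) *
      expect (q₁ st.1) fun x => ENNReal.ofReal ((v i x - f st.1 st.2) ^ 2)) ≤ a)
    (hest : ∀ i ∈ l, expect ((pairLaw p q₁ q₂).map Prod.snd) (fun x => ENNReal.ofReal
      ((r i x - condLoss p q₁ f (v i) (φ x)) ^ 2)) ≤ b) :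
    expect (pairLaw p q₁ q₂) (fun x => ENNReal.ofReal
      ((R x.1 x.2 - f (φ x.1) (φ x.2)) ^ 2)) ≤
        T.card * a + ENNReal.ofReal α + ENNReal.ofReal (1 / α) * (l.length * b) := by
  have hTmap : ∀ t ∈ (p.map Prod.snd).support, t ∈ T := by
    intro t ht
    obtain ⟨st, hst, rfl⟩ := (PMF.mem_support_map_iff _ _ _).1 ht
    exact hT st hst
  -- `choose!` needs a default value for states outside `T`.
  have hne : Nonempty ι := by
    obtain ⟨st, hst⟩ := p.support_nonempty
    obtain ⟨q, hq, -⟩ := hgood st.2 (hT st hst)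
    exact ⟨q⟩
  choose! best hbest hbest' using hgood
  have hpt : ∀ t ∈ (p.map Prod.snd).support, ∀ y ∈ (q₂ t).support,
      (condExpect p q₁ t fun s t x => ENNReal.ofReal ((R x y - f s t) ^ 2)) ≤
      (condExpect p q₁ t fun s u x => ENNReal.ofReal ((v (best t) x - f s u) ^ 2)) +
        ENNReal.ofReal α + ENNReal.ofReal (1 / α) * (l.map fun i => ENNReal.ofReal
          ((r i y - condLoss p q₁ f (v i) (φ y)) ^ 2)).sum := by
    intro t ht y hy
    rw [mem_support_of_map_snd hdec ht hy]
    obtain ⟨b, hb, hmin, hRb⟩ := hR y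
    simp only [hRb]
    have hi := hbest t (hTmap t ht)
    have hle := hmin (best t) hi
    generalize best t = i at hi hle ⊢
    exact condExpect_argmin_le hv hf (r := fun i => r i y) hb hi hle hα t
  calc _ = expect (p.map Prod.snd) (fun t => expect (q₂ t) fun y =>
        condExpect p q₁ t fun s t x => ENNReal.ofReal ((R x y - f s t) ^ 2)) := by
        rw [expect_pairLaw_decode hdec fun s t x y => ENNReal.ofReal ((R x y - f s t) ^ 2)]
        exact expect_eq_condExpect p q₁ q₂ fun s t x y => ENNReal.ofReal ((R x y - f s t) ^ 2)
    _ ≤ expect (p.map Prod.snd) (fun t => expect (q₂ t) fun y =>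
        (condExpect p q₁ t fun s u x => ENNReal.ofReal ((v (best t) x - f s u) ^ 2)) +
        ENNReal.ofReal α + ENNReal.ofReal (1 / α) * (l.map fun i => ENNReal.ofReal
          ((r i y - condLoss p q₁ f (v i) (φ y)) ^ 2)).sum) :=
        expect_mono fun t ht => expect_mono fun y hy => hpt t ht y hy
    _ = expect p (fun st => expect (q₁ st.1) fun x => ENNReal.ofReal
          ((v (best st.2) x - f st.1 st.2) ^ 2)) +
        ENNReal.ofReal α + ENNReal.ofReal (1 / α) * (l.map fun i =>
          expect ((pairLaw p q₁ q₂).map Prod.snd) fun y => ENNReal.ofReal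
          ((r i y - condLoss p q₁ f (v i) (φ y)) ^ 2)).sum := by
        rw [← expect_list_sum, expect_map_snd_pairLaw]
        simp only [expect_add, expect_const_mul, expect_const]
        congr 2
        exact expect_map_fiber p Prod.snd fun t st => expect (q₁ st.1) fun x => ENNReal.ofReal
          ((v (best t) x - f st.1 st.2) ^ 2)
    _ ≤ T.card * a + ENNReal.ofReal α + ENNReal.ofReal (1 / α) * (l.length * b) := by
        gcongr
        -- Split according to the second state: exactly one term survives for each `st`, and the
        -- term of `t` is bounded by the policy that is good for `t`. This is the source of the
        -- factor `T.card`.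
        · calc _ = expect p (fun st => ∑ t ∈ T, (if st.2 = t then 1 else 0) *
                expect (q₁ st.1) fun x => ENNReal.ofReal
                  ((v (best t) x - f st.1 st.2) ^ 2)) := by
                refine expect_congr fun st hst => ?_
                rw [Finset.sum_eq_single st.2]
                · simp
                · intro t _ ht
                  simp [ht.symm]
                · exact fun h => absurd (hT st hst) h
            _ ≤ ∑ t ∈ T, a := by
                rw [expect_finset_sum]
                exact Finset.sum_le_sum fun t ht => hbest' t ht
            _ = _ := by simp
        · refine (List.sum_le_card_nsmul _ b ?_).trans (by simp)
          intro e he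
          obtain ⟨q, hq, rfl⟩ := List.mem_map.1 he
          exact hest q hq

theorem twoPick_spec {A : ℕ} (η : ℝ) {l : List (Policy X A × Predictor1 X)} (hl : l ≠ []) (y : X) :
    ∃ b ∈ l, (∀ i ∈ l, (b.2 y).val ≤ (i.2 y).val) ∧
      ∀ x, (twoPick η l x y).val = (playedValue η b.1 x).val := by
  cases l with
  | nil => exact absurd rfl hl
  | cons q l =>
    exact ⟨_, argmin_mem (fun q => q.2 y) q l, fun i hi => argmin_le (fun q => q.2 y) q l hi,
      fun x => rfl⟩

end TwoContext

/-! ### The error and failure guarantee of `twoRed`. -/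

section TwoContextGuarantee

variable {X S : Type} {ιX : Bool → X} {ιS : Bool → S} {Φ : Set (X → S)} {φ : X → S}
  {p : PMF (S × S)} {q₁ q₂ : S → PMF X} {f : S → S → ℝ}

/-- The part of `twoRed` that estimates the conditional loss of one policy. -/
def twoFit {A : ℕ} (O : RLOracle X) (zero one : X) (η ε δ : ℝ) (half : List (X × X × Bool))
    (π : Policy X A) : Comp (Policy X A × Predictor1 X) := do
  let c ← forEach (relabel (playedValue η π)) half
  let R ← oneRed O zero one c ε δ
  return (π, R)

/-- The part of `twoRed` that follows the simulation. -/
def twoRest {A : ℕ} (O : RLOracle X) (zero one : X) (S : ℕ) (η ε δ : ℝ)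
    (half : List (X × X × Bool)) : Option (List (Policy X A)) → PMF (Predictor2 X)
  | none => PMF.pure fun _ _ => op 0
  | some Ψ => (forEach (twoFit O zero one η (ε ^ 4 / (16 * (S : ℝ) ^ 4 * (Ψ.length : ℝ)))
      (δ / (2 * (Ψ.length : ℝ))) half) Ψ).law.map (twoPick η)

theorem law_twoRed (O : RLOracle X) (zero one : X) (S : ℕ) (data : List (X × X × Bool))
    (ε δ : ℝ) :
    (twoRed O zero one S data ε δ).law =
      (simulate (O (ε ^ 2 / (4 * (S : ℝ) ^ 2)) (δ / 2) 2 (gridSize (ε / (2 * (S : ℝ)))))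
        (fun d => d.1) (twoSnd zero (ε / (2 * (S : ℝ)))) (data.take (data.length / 2)) []).law.bind
        (twoRest O zero one S (ε / (2 * (S : ℝ))) ε δ (data.drop (data.length / 2))) := by
  simp only [twoRed, Comp.law_bind, Comp.law_lift, PMF.pure_bind, val_op]
  refine congrArg _ (funext fun o => ?_)
  rcases o with _ | Ψ
  · simp [twoRest]
  · simp only [Comp.law_bind, Comp.law_lift, PMF.pure_bind, val_op, twoRest]
    rw [← PMF.bind_pure_comp]
    refine congrArg _ (funext fun l => ?_)
    cases l <;> simp [twoPick]

theorem twoFit_fst {A : ℕ} {O : RLOracle X} {zero one : X} {η ε δ : ℝ}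
    {half : List (X × X × Bool)} {π : Policy X A} {q : Policy X A × Predictor1 X}
    (hq : q ∈ (twoFit O zero one η ε δ half π).law.support) : q.1 = π := by
  simp only [twoFit, Comp.law_bind, Comp.law_pure, PMF.mem_support_bind_iff, PMF.support_pure,
    Set.mem_singleton_iff] at hq
  obtain ⟨c, -, R, -, rfl⟩ := hq
  rfl

/-- Relabeled i.i.d. samples are i.i.d. (`iid_bind_forEach`) with regression function `condLoss` of
the decoded second state (`bind_relabel`). So this is `prob_oneRed_le` for the law of `x₂`. -/
theorem prob_twoFit_le (hreg : IsRegular ιX ιS Φ) {O : RLOracle X} {N K : ℝ → ℝ → ℕ → ℕ → ℕ}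
    (hO : IsEfficientRL Φ O N K) (hφ : φ ∈ Φ) (hdec : Decodes φ p q₁ q₂)
    (hf : ∀ s t, f s t ∈ Set.Icc (0 : ℝ) 1) {η : ℝ} (hη : 0 ≤ η) {ε δ : ℝ}
    (hε : ε ∈ Set.Ioo (0 : ℝ) (1 / 2)) (hδ : δ ∈ Set.Ioo (0 : ℝ) (1 / 2)) {n : ℕ}
    (hn : oneRedSamples N K ε δ ≤ n) (π : Policy X (gridSize η)) :
    expect (iid (sampleLaw φ (pairLaw p q₁ q₂) f) n) (fun half =>
      prob (twoFit O (ιX false) (ιX true) η ε δ half π).law fun q =>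
        ¬ expect ((pairLaw p q₁ q₂).map Prod.snd) (fun x => ENNReal.ofReal
          (((q.2 x).val - condLoss p q₁ f (fun x => (playedValue η q.1 x).val) (φ x)) ^ 2)) ≤
            ENNReal.ofReal ε) ≤ ENNReal.ofReal δ := by
  have hv : ∀ x, (playedValue η π x).val ∈ Set.Icc (0 : ℝ) 1 := fun x => playedValue_mem hη π x
  refine le_trans (le_of_eq ?_) (prob_oneRed_le hreg hO hφ ((pairLaw p q₁ q₂).map Prod.snd)
    (g := condLoss p q₁ f fun x => (playedValue η π x).val)
    (fun t => condLoss_mem hv hf t) hε hδ hn)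
  rw [← bind_relabel hdec hf hv, ← iid_bind_forEach, expect_bind]
  refine expect_congr fun half _ => ?_
  simp only [twoFit, Comp.law_bind, Comp.law_pure]
  rw [prob_bind]
  refine expect_congr fun c _ => ?_
  rw [prob_bind, expect_prob_pure]

theorem card_not_special [Fintype S] [DecidablePred (· ∉ Set.range ιS)]
    (hιS : Function.Injective ιS) :
    (Finset.univ.filter (· ∉ Set.range ιS)).card = Fintype.card S - 2 := by
  classical
  have h : Finset.univ.filter (· ∉ Set.range ιS) = (Finset.univ.image ιS)ᶜ := by
    ext s
    simp [and_comm]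
  rw [h, Finset.card_compl, Finset.card_image_of_injective _ hιS]
  simp

/-- Let `α = ε²/(4σ²)`, which is both the oracle tolerance and `η²`. Each of the `σ` second states
has a policy of joint error at most `2α`. Selection with AM-GM parameter `α`, from `k` estimates of
accuracy `α²/k`, adds `α + α`. The total `2σα + 2α` is at most `ε/2`, because `σα ≤ ε/8`. The
failures are `δ/2` for the oracle and `k · δ/(2k)` for the estimates. -/
theorem prob_twoRed_le [Fintype S] (hreg : IsRegular ιX ιS Φ) {O : RLOracle X}
    {N K : ℝ → ℝ → ℕ → ℕ → ℕ} (hO : IsEfficientRL Φ O N K) (hφ : φ ∈ Φ)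
    (hdec : Decodes φ p q₁ q₂) (hns : ∀ st ∈ p.support, st.2 ∉ Set.range ιS)
    (hf : ∀ s t, f s t ∈ Set.Icc (0 : ℝ) 1) {ε δ : ℝ} (hε : ε ∈ Set.Ioo (0 : ℝ) (1 / 2))
    (hδ : δ ∈ Set.Ioo (0 : ℝ) (1 / 2)) {n : ℕ}
    (hn : twoRedSamples N K (Fintype.card S - 2) ε δ ≤ n) :
    expect (iid (sampleLaw φ (pairLaw p q₁ q₂) f) n) (fun data =>
      prob (twoRed O (ιX false) (ιX true) (Fintype.card S - 2) data ε δ).law fun R =>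
        ¬ expect (pairLaw p q₁ q₂) (fun x => ENNReal.ofReal
          (((R x.1 x.2).val - f (φ x.1) (φ x.2)) ^ 2)) ≤ ENNReal.ofReal ε) ≤
      ENNReal.ofReal δ := by
  classical
  set T : Finset S := Finset.univ.filter (· ∉ Set.range ιS) with hTdef
  have hcard : T.card = Fintype.card S - 2 := card_not_special hreg.2.1
  have hT : ∀ st ∈ p.support, st.2 ∈ T := fun st hst => by simpa [hTdef] using hns st hst
  set σ := Fintype.card S - 2 with hσ
  -- A second state that occurs is non-special, which rules out division by `σ = 0`.
  have hσ1 : 1 ≤ σ := by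
    obtain ⟨st, hst⟩ := p.support_nonempty
    rw [← hcard]
    exact Finset.card_pos.2 ⟨_, hT st hst⟩
  have hσ1' : (1 : ℝ) ≤ (σ : ℝ) := by exact_mod_cast hσ1
  have hσ0 : (0 : ℝ) < (σ : ℝ) := by linarith
  obtain ⟨hε0, hε1⟩ := hε
  obtain ⟨hδ0, hδ1⟩ := hδ
  set P := sampleLaw φ (pairLaw p q₁ q₂) f with hP
  unfold twoRedSamples at hn
  set bad : Predictor2 X → Prop := fun R => ¬ expect (pairLaw p q₁ q₂) (fun x => ENNReal.ofReal
          (((R x.1 x.2).val - f (φ x.1) (φ x.2)) ^ 2)) ≤ ENNReal.ofReal ε with hbad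
  simp only [law_twoRed]
  set η := ε / (2 * (σ : ℝ)) with hη
  set α := ε ^ 2 / (4 * (σ : ℝ) ^ 2) with hα
  have hη0 : 0 < η := by positivity
  have hα0 : 0 < α := by positivity
  have hηα : η ^ 2 = α := by rw [hη, hα, div_pow]; congr 1; ring
  have hε2 : ε ^ 2 < 1 / 4 := by nlinarith
  have hα1 : α < 1 / 2 := by
    rw [hα, div_lt_iff₀ (by positivity)]
    nlinarith
  set N' := N α (δ / 2) 2 (gridSize η) with hN'
  set M' := (Finset.Icc 1 (coverSize K σ ε δ)).sup fun k =>
      oneRedSamples N K (ε ^ 4 / (16 * (σ : ℝ) ^ 4 * (k : ℝ))) (δ / (2 * (k : ℝ))) with hM'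
  -- From `2 (N' + M') ≤ n`, both the rounded-down first half and the rounded-up second half contain
  -- at least `N' + M'` samples.
  obtain ⟨r, hr⟩ : ∃ r, n / 2 = N' + r := ⟨n / 2 - N', by omega⟩
  have hsplit : n = n / 2 + (n - n / 2) := by omega
  calc expect (iid P n) (fun data => prob
        ((simulate (O α (δ / 2) 2 (gridSize η)) (fun d => d.1) (twoSnd (ιX false) η)
          (data.take (data.length / 2)) []).law.bind
          (twoRest O (ιX false) (ιX true) σ η ε δ (data.drop (data.length / 2)))) bad)
      = expect (iid P (N' + r)) (fun l => prob
        ((simulate (O α (δ / 2) 2 (gridSize η)) (fun d => d.1) (twoSnd (ιX false) η)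
          l []).law.bind fun o => (iid P (n - n / 2)).bind fun l' =>
          twoRest O (ιX false) (ιX true) σ η ε δ l' o) bad) := by
        conv_lhs => rw [hsplit]
        rw [expect_iid_add, ← hr]
        refine expect_congr fun l hl => ?_
        rw [mem_support_iid] at hl
        simp only [prob_bind]
        rw [expect_comm]
        refine expect_congr fun l' hl' => ?_
        rw [mem_support_iid] at hl'
        have hlen : (l ++ l').length / 2 = l.length := by
          rw [List.length_append, hl.1, hl'.1]
          omega
        rw [hlen, List.take_left', List.drop_left'] <;> rfl
    _ ≤ ENNReal.ofReal (δ / 2) + ENNReal.ofReal (δ / 2) := ?_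
    _ = ENNReal.ofReal δ := by
        rw [← ENNReal.ofReal_add (by linarith) (by linarith)]
        congr 1
        ring
  -- The continuation ignores the first half and draws the second half itself, so the surplus
  -- samples of the first half play no role.
  refine (simulates_twoMDP hdec hns hf hη0.le).prob_le hO ⟨hα0, hα1⟩
    ⟨by linarith, by linarith⟩ hφ (twoMDP_decodedBy (hreg.2.2 φ hφ).1 hdec f η) r
    (fun _ o => (iid P (n - n / 2)).bind fun l' =>
      twoRest O (ιX false) (ιX true) σ η ε δ l' o) bad _ ?_
  intro Ψ hcov hlen l _
  have hgood : ∀ t ∈ T, ∃ π ∈ Ψ, expect p (fun st => (if st.2 = t then 1 else 0) *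
      expect (q₁ st.1) fun x => ENNReal.ofReal (((playedValue η π x).val - f st.1 st.2) ^ 2)) ≤
        ENNReal.ofReal (2 * α) := by
    intro t ht
    obtain ⟨π, hπ, h⟩ := exists_good_policy hdec (by simpa [hTdef] using ht) hf hη0 hcov
    refine ⟨π, hπ, h.trans (le_of_eq ?_)⟩
    rw [hηα, ← ENNReal.ofReal_add hα0.le hα0.le, two_mul]
  have hΨ : Ψ ≠ [] := by
    rintro rfl
    obtain ⟨st, hst⟩ := p.support_nonempty
    obtain ⟨π, hπ, -⟩ := hgood st.2 (hT st hst)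
    simp at hπ
  have hk : 1 ≤ Ψ.length := List.length_pos_iff.2 hΨ
  have hk' : (1 : ℝ) ≤ (Ψ.length : ℝ) := by exact_mod_cast hk
  have hk0 : (0 : ℝ) < (Ψ.length : ℝ) := by linarith
  set k := Ψ.length with hkdef
  have hn1 : oneRedSamples N K (ε ^ 4 / (16 * (σ : ℝ) ^ 4 * (k : ℝ))) (δ / (2 * (k : ℝ))) ≤
      n - n / 2 := by
    -- The cover size `k` is random. The supremum in the sample size covers every admissible value.
    refine le_trans ?_ (show M' ≤ n - n / 2 by omega)
    exact Finset.le_sup (f := fun k : ℕ =>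
      oneRedSamples N K (ε ^ 4 / (16 * (σ : ℝ) ^ 4 * (k : ℝ))) (δ / (2 * (k : ℝ))))
      (Finset.mem_Icc.2 ⟨hk, hlen⟩)
  have hε₁ : ε ^ 4 / (16 * (σ : ℝ) ^ 4 * (k : ℝ)) = α ^ 2 / k := by
    rw [hα]
    field_simp
    norm_num
  have hε₁lt : α ^ 2 / k < 1 / 2 := by
    rw [div_lt_iff₀ hk0]
    nlinarith
  rw [expect_const, prob_bind]
  set badq : Policy X (gridSize η) × Predictor1 X → Prop := fun q =>
        ¬ expect ((pairLaw p q₁ q₂).map Prod.snd) (fun x => ENNReal.ofReal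
          (((q.2 x).val - condLoss p q₁ f (fun x => (playedValue η q.1 x).val) (φ x)) ^ 2)) ≤
            ENNReal.ofReal (α ^ 2 / k) with hbadq
  calc _ ≤ expect (iid P (n - n / 2)) (fun half => (Ψ.map fun π =>
        prob (twoFit O (ιX false) (ιX true) η (α ^ 2 / k) (δ / (2 * (k : ℝ))) half π).law
          badq).sum) := by
        refine expect_mono fun half _ => le_trans ?_ (prob_forEach_le _ _ _)
        simp only [twoRest]
        rw [prob_map, ← hkdef, hε₁]
        refine prob_mono fun qs hqs hb => ?_
        by_contra! hno
        refine hb ?_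
        have hall := forall₂_of_mem_support_forEach hqs
        have hlen' : qs.length = k := hall.length_eq.symm
        have hne : qs ≠ [] := by
          rintro rfl
          rw [← hlen'] at hk
          simp at hk
        have hmem : ∀ π ∈ Ψ, ∃ q ∈ qs, q.1 = π := by
          intro π hπ
          obtain ⟨i, hi, rfl⟩ := List.getElem_of_mem hπ
          have hi' : i < qs.length := by rw [hlen']; exact hi
          exact ⟨qs[i], List.getElem_mem hi', twoFit_fst (hall.get hi hi')⟩
        refine (expect_sq_select_le hdec hf (l := qs)
          (v := fun q x => (playedValue η q.1 x).val) (r := fun q x => (q.2 x).val)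
          (fun q x => playedValue_mem hη0.le _ _)
          (R := fun x y => (twoPick η qs x y).val) (twoPick_spec η hne) T hT hα0
          (a := ENNReal.ofReal (2 * α)) (b := ENNReal.ofReal (α ^ 2 / k)) ?_ ?_).trans ?_
        · intro t ht
          obtain ⟨π, hπ, h⟩ := hgood t ht
          obtain ⟨q, hq, rfl⟩ := hmem π hπ
          exact ⟨q, hq, h⟩
        · exact fun q hq => not_not.1 (hno q hq)
        · rw [hcard, hlen', ← ENNReal.ofReal_natCast, ← ENNReal.ofReal_natCast,
            ← ENNReal.ofReal_mul (by positivity), ← ENNReal.ofReal_mul (by positivity),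
            ← ENNReal.ofReal_mul (by positivity), ← ENNReal.ofReal_add (by positivity) (by positivity),
            ← ENNReal.ofReal_add (by positivity) (by positivity)]
          refine ENNReal.ofReal_le_ofReal ?_
          have h1 : 1 / α * (k * (α ^ 2 / k)) = α := by field_simp
          have h2 : σ * α ≤ ε / 8 := by
            rw [hα, mul_div_assoc', div_le_iff₀ (by positivity)]
            nlinarith [mul_nonneg hε0.le hσ0.le, mul_nonneg (mul_nonneg hε0.le hσ0.le) (sub_nonneg.2 hσ1'),
              mul_nonneg (mul_nonneg hε0.le hσ0.le) (sub_nonneg.2 hε1.le)]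
          have h3 : α ≤ σ * α := le_mul_of_one_le_left hα0.le hσ1'
          rw [h1]
          linarith
    _ = (Ψ.map fun π => expect (iid P (n - n / 2)) fun half =>
        prob (twoFit O (ιX false) (ιX true) η (α ^ 2 / k) (δ / (2 * (k : ℝ))) half π).law
          badq).sum := expect_list_sum _ _ _
    _ ≤ Ψ.length • ENNReal.ofReal (δ / (2 * (k : ℝ))) := by
        refine (List.sum_le_card_nsmul _ (ENNReal.ofReal (δ / (2 * (k : ℝ)))) ?_).trans (by simp)
        intro e he
        obtain ⟨π, -, rfl⟩ := List.mem_map.1 he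
        refine prob_twoFit_le hreg hO hφ hdec hf hη0.le ⟨by positivity, hε₁lt⟩ ⟨by positivity, ?_⟩
          (hε₁ ▸ hn1) π
        rw [div_lt_iff₀ (by positivity)]
        nlinarith
    _ = ENNReal.ofReal (δ / 2) := by
        rw [nsmul_eq_mul, ← ENNReal.ofReal_natCast, ← ENNReal.ofReal_mul (by positivity), ← hkdef]
        congr 1
        field_simp

end TwoContextGuarantee

/-! ### Transfer to the base class. -/

section Base

variable {X S : Type}

theorem prob_regressionLaw (alg : TwoContextAlg X) (φ : X → S) (D : PMF (X × X)) (f : S → S → ℝ)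
    (n : ℕ) (ε δ : ℝ) (P : Predictor2 X → Prop) :
    prob (regressionLaw alg φ D f n ε δ) (fun o => P o.val) =
      expect (iid (sampleLaw φ D f) n) fun data => prob (alg data ε δ).law P := by
  rw [regressionLaw, prob_bind]
  refine expect_congr fun data _ => ?_
  rw [Comp.law, prob_map]

theorem mem_law_support {α : Type} {c : Comp α} {o : Timed α} (ho : o ∈ c.run.support) :
    o.val ∈ c.law.support :=
  (PMF.mem_support_map_iff _ _ _).2 ⟨o, ho, rfl⟩

theorem twoPick_mem {η : ℝ} (hη : 0 ≤ η) (l : List (Policy X (gridSize η) × Predictor1 X))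
    (x y : X) : (twoPick η l x y).val ∈ Set.Icc (0 : ℝ) 1 := by
  cases l with
  | nil => simp [twoPick]
  | cons q l => exact playedValue_mem hη _ x

theorem twoRed_mem {O : RLOracle X} {zero one : X} {σ : ℕ} {data : List (X × X × Bool)} {ε δ : ℝ}
    (hε : 0 ≤ ε) {R : Predictor2 X} (hR : R ∈ (twoRed O zero one σ data ε δ).law.support)
    (x y : X) : (R x y).val ∈ Set.Icc (0 : ℝ) 1 := by
  rw [law_twoRed, PMF.mem_support_bind_iff] at hR
  obtain ⟨o, -, ho⟩ := hR
  cases o with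
  | none =>
    simp only [twoRest, PMF.support_pure, Set.mem_singleton_iff] at ho
    subst ho
    simp
  | some Ψ =>
    simp only [twoRest, PMF.mem_support_map_iff] at ho
    obtain ⟨l, -, rfl⟩ := ho
    exact twoPick_mem (by positivity) l x y

variable {ιX : Bool → X} {ιS : Bool → S} {Φ : Set (X → S)}

theorem law_twoRedBase (O : RLOracle X) (ιX : Bool → X) (σ : ℕ)
    (data : List ({x // x ∉ Set.range ιX} × {x // x ∉ Set.range ιX} × Bool)) (ε δ : ℝ) :
    (twoRedBase O ιX σ data ε δ).law =
      (twoRed O (ιX false) (ιX true) σ (data.map fun d => (d.1.1, d.2.1.1, d.2.2)) ε δ).law.map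
        fun R x₁ x₂ => R x₁.1 x₂.1 := by
  simp only [twoRedBase, Comp.law_bind, Comp.law_pure]
  exact PMF.bind_pure_comp _ _

open Classical in
/-- Emissions of the base class, as emissions of the regular class. -/
def extendEmit (ιX : Bool → X) (ιS : Bool → S)
    (q : {s // s ∉ Set.range ιS} → PMF {x // x ∉ Set.range ιX}) (s : S) : PMF X :=
  if h : s ∉ Set.range ιS then (q ⟨s, h⟩).map Subtype.val else PMF.pure (ιX false)

theorem extendEmit_coe (q : {s // s ∉ Set.range ιS} → PMF {x // x ∉ Set.range ιX})
    (s : {s // s ∉ Set.range ιS}) :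
    extendEmit ιX ιS q s.1 = (q s).map Subtype.val := by
  rw [extendEmit, dif_pos s.2]

-- Push the base problem forward along the inclusion of non-special observations, with `f` extended
-- by `0`. The sample laws correspond, the extended law is decoded by a concept in `Φ`, and the
-- error of a predictor is unchanged.
open Classical in
theorem isEfficientTwoContext_twoRedBase [Fintype S] (hreg : IsRegular ιX ιS Φ) {O : RLOracle X}
    {N K : ℝ → ℝ → ℕ → ℕ → ℕ} (hO : IsEfficientRL Φ O N K) :
    IsEfficientTwoContext (baseClass ιX ιS Φ) (twoRedBase O ιX (Fintype.card S - 2))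
      (twoRedSamples N K (Fintype.card S - 2)) := by
  intro ε hε δ hδ n hn ψ hψ D hD f hf
  obtain ⟨φ, hφ, hψφ⟩ := hψ
  obtain ⟨p, q₁, q₂, rfl, hdec⟩ := hD.exists_pairLaw
  constructor
  · intro o ho x₁ x₂
    rw [regressionLaw, PMF.mem_support_bind_iff] at ho
    obtain ⟨data, -, ho⟩ := ho
    have := mem_law_support ho
    rw [law_twoRedBase, PMF.mem_support_map_iff] at this
    obtain ⟨R, hR, hR'⟩ := this
    rw [← hR']
    exact twoRed_mem hε.1.le hR _ _
  · refine (le_toOuterMeasure_iff hδ.1.le (by linarith [hδ.2])).2 ?_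
    set p' : PMF (S × S) := p.map fun st => (st.1.1, st.2.1) with hp'
    set f' : S → S → ℝ := fun s t =>
      if h : s ∉ Set.range ιS ∧ t ∉ Set.range ιS then f ⟨s, h.1⟩ ⟨t, h.2⟩ else 0 with hf'
    have hf'coe : ∀ s t : {s // s ∉ Set.range ιS}, f' s.1 t.1 = f s t := fun s t => by
      rw [hf']
      simp only
      rw [dif_pos ⟨s.2, t.2⟩]
    have hdec' : Decodes φ p' (extendEmit ιX ιS q₁) (extendEmit ιX ιS q₂) := by
      intro st hst
      obtain ⟨st, hst₀, rfl⟩ := (PMF.mem_support_map_iff _ _ _).1 hst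
      simp only [extendEmit_coe, PMF.mem_support_map_iff]
      constructor
      · rintro _ ⟨x, hx, rfl⟩
        rw [hψφ, (hdec st hst₀).1 x hx]
      · rintro _ ⟨x, hx, rfl⟩
        rw [hψφ, (hdec st hst₀).2 x hx]
    have hns : ∀ st ∈ p'.support, st.2 ∉ Set.range ιS := by
      intro st hst
      obtain ⟨st, hst, rfl⟩ := (PMF.mem_support_map_iff _ _ _).1 hst
      exact st.2.2
    have hfm : ∀ s t, f' s t ∈ Set.Icc (0 : ℝ) 1 := by
      intro s t
      rw [hf']
      simp only
      split_ifs with h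
      · exact hf _ _
      · simp
    have key := prob_twoRed_le hreg hO hφ hdec' hns hfm hε hδ hn
    have hlaw : sampleLaw φ (pairLaw p' (extendEmit ιX ιS q₁) (extendEmit ιX ιS q₂)) f' =
        (sampleLaw ψ (pairLaw p q₁ q₂) f).map fun d => (d.1.1, d.2.1.1, d.2.2) := by
      refine ext_of_expect fun F => ?_
      rw [expect_map, expect_sampleLaw_decode hdec', expect_sampleLaw_decode hdec, hp', expect_map]
      simp only [extendEmit_coe, expect_map, hf'coe]
    rw [hlaw, expect_iid_map] at key
    refine (le_of_eq (prob_regressionLaw (twoRedBase O ιX (Fintype.card S - 2)) ψ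
      (pairLaw p q₁ q₂) f n ε δ fun R => ¬ expect (pairLaw p q₁ q₂) (fun x => ENNReal.ofReal
        (((R x.1 x.2).val - f (ψ x.1) (ψ x.2)) ^ 2)) ≤ ENNReal.ofReal ε)).trans ?_
    refine le_trans (le_of_eq (expect_congr fun data _ => ?_)) key
    rw [law_twoRedBase, prob_map]
    congr 1
    funext R
    rw [expect_pairLaw_decode hdec fun s t x y => ENNReal.ofReal (((R x.1 y.1).val - f s t) ^ 2),
      expect_pairLaw_decode hdec' fun s t x y => ENNReal.ofReal (((R x y).val - f' s t) ^ 2), hp',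
      expect_map]
    simp only [extendEmit_coe, expect_map, hf'coe]

end Base

/-! ## Subsamples of an i.i.d. sample -/

section Subsample

variable {α β : Type} {P : PMF α} {Q : PMF β} {g : α → Option β}

/-- Given its length, the part of an i.i.d. sample that `g` selects is i.i.d. again. -/
theorem expect_iid_filterMap
    (h : ∀ F : β → ℝ≥0∞, expect P (fun a => (g a).elim 0 F) =
      prob P (fun a => (g a).isSome) * expect Q F) (n : ℕ) (H : List β → ℝ≥0∞) :
    expect (iid P n) (fun l => H (l.filterMap g)) =
      expect (iid P n) fun l => expect (iid Q (l.filterMap g).length) H := by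
  induction n generalizing H with
  | zero => simp [expect_iid_zero]
  | succ n ih =>
    have hl : ∀ a, expect (iid P n) (fun l => H ((a :: l).filterMap g)) =
        (g a).elim (expect (iid P n) fun l => H (l.filterMap g)) (fun _ => 0) +
        (g a).elim 0 fun b => expect (iid P n) fun l => H (b :: l.filterMap g) := by
      intro a
      cases hg : g a <;> simp [hg]
    have hr : ∀ a, expect (iid P n) (fun l => expect (iid Q ((a :: l).filterMap g).length) H) =
        (g a).elim (expect (iid P n) fun l => expect (iid Q (l.filterMap g).length) H)
          (fun _ => 0) +
        (g a).elim 0 fun _ => expect (iid P n) fun l =>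
          expect Q fun b => expect (iid Q (l.filterMap g).length) fun l' => H (b :: l') := by
      intro a
      cases hg : g a <;> simp [hg, expect_iid_succ]
    rw [expect_iid_succ, expect_iid_succ]
    simp only [hl, hr]
    rw [expect_add, expect_add, ih, h, h, expect_const]
    congr 2
    refine Eq.trans ?_ (expect_comm _ _ _)
    exact expect_congr fun b _ => ih fun l => H (b :: l)

/-- With probability at most `a` fewer than `M` samples are selected, and then `H ≤ 1` is used.
Otherwise, given their number, they are i.i.d. and `hb` applies. -/
theorem expect_iid_filterMap_le
    (h : ∀ F : β → ℝ≥0∞, expect P (fun a => (g a).elim 0 F) =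
      prob P (fun a => (g a).isSome) * expect Q F) {n M : ℕ} {H : List β → ℝ≥0∞}
    (hH : ∀ l, H l ≤ 1) {a b : ℝ≥0∞} (ha : prob (iid P n) (fun l => (l.filterMap g).length < M) ≤ a)
    (hb : ∀ m, M ≤ m → expect (iid Q m) H ≤ b) :
    expect (iid P n) (fun l => H (l.filterMap g)) ≤ a + b := by
  rw [expect_iid_filterMap h]
  calc _ ≤ expect (iid P n) (fun l =>
        (@ite _ ((l.filterMap g).length < M) (Classical.dec _) 1 0) + b) := by
        refine expect_mono fun l _ => ?_
        by_cases hM : (l.filterMap g).length < M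
        · rw [if_pos hM]
          exact (expect_le_of_le fun l _ => hH l).trans le_self_add
        · rw [if_neg hM, zero_add]
          exact hb _ (not_lt.1 hM)
    _ ≤ _ := by
        rw [expect_add, expect_const]
        gcongr
        exact le_of_eq_of_le (by unfold prob; congr 1) ha

/-- Hoeffding's inequality for the indicator of selection, with deviation equal to half of its mean.
-/
theorem prob_length_filterMap_lt_le {n M : ℕ}
    (hM : 2 * (M : ℝ) ≤ n * (prob P fun a => (g a).isSome).toReal) :
    prob (iid P n) (fun l => (l.filterMap g).length < M) ≤
      ENNReal.ofReal (Real.exp (-(n * ((prob P fun a => (g a).isSome).toReal / 2) ^ 2))) := by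
  set Y : α → ℝ := fun a => if (g a).isSome then 1 else 0 with hY
  have hYm : ∀ a, Y a ∈ Set.Icc (0 : ℝ) 1 := fun a => by
    simp only [hY]; split_ifs <;> simp
  have hmean : expect P (fun a => ENNReal.ofReal (Y a)) = prob P fun a => (g a).isSome := by
    refine expect_congr fun a _ => ?_
    simp only [hY]
    by_cases h : (g a).isSome = true <;> simp [h]
  have hsum : ∀ l : List α, ((l.filterMap g).length : ℝ) = (l.map Y).sum := by
    intro l
    induction l with
    | nil => simp
    | cons a l ih =>
      cases hg : g a with
      | none => simp [hg, ih, hY]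
      | some b => simp [hg, ih, hY, add_comm]
  have h1 : (prob P fun a => (g a).isSome).toReal ≤ 1 :=
    ENNReal.toReal_mono ENNReal.one_ne_top (prob_le_one _ _)
  have key := prob_sum_le_le (W := P) hYm
    (t := (prob P fun a => (g a).isSome).toReal / 2) (by positivity) (by linarith) n
  rw [hmean] at key
  refine le_trans (prob_mono fun l _ hl => ?_) key
  rw [← hsum]
  have : ((l.filterMap g).length : ℝ) ≤ M := by exact_mod_cast hl.le
  linarith

end Subsample

/-! ## Two-context regression over a regular class -/

section Regions

variable {X S : Type} {ιX : Bool → X} {ιS : Bool → S} {Φ : Set (X → S)} {φ : X → S}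
  {p : PMF (S × S)} {q₁ q₂ : S → PMF X} {f : S → S → ℝ} {xbar : X}

open Classical in
theorem kind_val (x : X) : (kind ιX x).val =
    if x = ιX false then some false else if x = ιX true then some true else none := by
  unfold kind
  by_cases h0 : x = ιX false
  · simp [h0]
  · by_cases h1 : x = ιX true
    · rw [if_neg h0, if_pos h1]
      simp only [Timed.val_bind, val_op, decide_eq_true h1, decide_eq_false h0,
        Bool.false_eq_true, if_false, if_true, Timed.val_pure]
    · simp [h0, h1]

theorem kind_eq_none_iff {x : X} : (kind ιX x).val = none ↔ x ∉ Set.range ιX := by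
  rw [kind_val]
  split_ifs with h0 h1
  · simp [h0]
  · simp [h1]
  · simpa using ⟨h0, h1⟩

theorem kind_eq_some {x : X} {b : Bool} (h : (kind ιX x).val = some b) : x = ιX b := by
  rw [kind_val] at h
  split_ifs at h with h0 h1
  · rwa [← Option.some.inj h]
  · rwa [← Option.some.inj h]

theorem kind_apply (hι : Function.Injective ιX) (b : Bool) : (kind ιX (ιX b)).val = some b := by
  cases h : (kind ιX (ιX b)).val with
  | none => exact absurd ⟨b, rfl⟩ (kind_eq_none_iff.1 h)
  | some c => rw [hι (kind_eq_some h)]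

/-- This is where regularity enters: the region of a pair of observations is a function of the
latent states, so conditioning on it preserves realizability. -/
theorem kind_decode (hreg : IsRegular ιX ιS Φ) (hφ : φ ∈ Φ) (x : X) :
    (kind ιS (φ x)).val = (kind ιX x).val := by
  cases h : (kind ιX x).val with
  | none => exact kind_eq_none_iff.2 ((hreg.2.2 φ hφ).2 x (kind_eq_none_iff.1 h))
  | some b =>
    rw [kind_eq_some h, (hreg.2.2 φ hφ).1, kind_apply hreg.2.1]

/-- The kinds of a pair of observations (or states). -/
def kinds (ι : Bool → X) (x y : X) : Option Bool × Option Bool := ((kind ι x).val, (kind ι y).val)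

/-- The state for the base class that replaces a state of kind `k`. -/
def baseState (sbar : S) (k : Option Bool) (s : S) : S := if k.isSome then sbar else s

/-- The original state of kind `k`. -/
def origState (ιS : Bool → S) (k : Option Bool) (s : S) : S := k.elim s ιS

/-- The emissions for the base class when the state is of kind `k`. -/
def baseEmit (xbar : X) (k : Option Bool) (q : S → PMF X) (s : S) : PMF X :=
  if k.isSome then PMF.pure xbar else q s

/-- The law of the states in the region `r`, as states for the base class. -/
def regionStates (ιS : Bool → S) (sbar : S) (r : Option Bool × Option Bool) (p : PMF (S × S)) :
    PMF (S × S) :=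
  (fiber p (fun st => kinds ιS st.1 st.2) r).map fun st =>
    (baseState sbar r.1 st.1, baseState sbar r.2 st.2)

/-- The law of the contexts in the region `r`, as contexts for the base class. -/
def regionLaw (ιS : Bool → S) (sbar : S) (xbar : X) (r : Option Bool × Option Bool)
    (p : PMF (S × S)) (q₁ q₂ : S → PMF X) : PMF (X × X) :=
  pairLaw (regionStates ιS sbar r p) (baseEmit xbar r.1 q₁) (baseEmit xbar r.2 q₂)

/-- The probability of the region `r`. -/
def regionProb (ιS : Bool → S) (r : Option Bool × Option Bool) (p : PMF (S × S)) : ℝ≥0∞ :=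
  prob p fun st => kinds ιS st.1 st.2 = r

theorem expect_baseEmit (k : Option Bool) (q : S → PMF X) (sbar s : S) (F : X → ℝ≥0∞) :
    expect (baseEmit xbar k q (baseState sbar k s)) F =
      expect (q s) fun x => F (toBase xbar k x) := by
  cases k <;> simp [baseEmit, baseState, toBase, expect_pure, expect_const]

theorem origState_baseState {k : Option Bool} {s : S} (h : (kind ιS s).val = k) (sbar : S) :
    origState ιS k (baseState sbar k s) = s := by
  cases k with
  | none => rfl
  | some b => exact (kind_eq_some h).symm

theorem mem_support_regionStates {r : Option Bool × Option Bool} (hr : regionProb ιS r p ≠ 0)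
    {sbar : S} {st : S × S} (hst : st ∈ (regionStates ιS sbar r p).support) :
    ∃ st' ∈ p.support, kinds ιS st'.1 st'.2 = r ∧
      st = (baseState sbar r.1 st'.1, baseState sbar r.2 st'.2) := by
  obtain ⟨st', hst', rfl⟩ := (PMF.mem_support_map_iff _ _ _).1 hst
  have hmem : r ∈ (p.map fun st => kinds ιS st.1 st.2).support := by
    by_contra hno
    refine hr (prob_eq_zero fun st hst h => hno ?_)
    exact (PMF.mem_support_map_iff _ _ _).2 ⟨st, hst, h⟩
  obtain ⟨h1, h2⟩ := (mem_fiber_support hmem).1 hst'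
  exact ⟨st', h2, h1, rfl⟩

theorem decodes_region (hdec : Decodes φ p q₁ q₂) {r : Option Bool × Option Bool}
    (hr : regionProb ιS r p ≠ 0) :
    Decodes φ (regionStates ιS (φ xbar) r p) (baseEmit xbar r.1 q₁) (baseEmit xbar r.2 q₂) := by
  intro st hst
  obtain ⟨st', hst', -, rfl⟩ := mem_support_regionStates hr hst
  obtain ⟨r₁, r₂⟩ := r
  constructor
  · intro x hx
    cases r₁ with
    | none => exact (hdec st' hst').1 x hx
    | some b =>
      simp only [baseEmit, Option.isSome_some, if_true, PMF.support_pure,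
        Set.mem_singleton_iff] at hx
      rw [hx]
      rfl
  · intro x hx
    cases r₂ with
    | none => exact (hdec st' hst').2 x hx
    | some b =>
      simp only [baseEmit, Option.isSome_some, if_true, PMF.support_pure,
        Set.mem_singleton_iff] at hx
      rw [hx]
      rfl

/-- A possible region with a non-special coordinate witnesses a non-special observation. Hence
`xbar` is non-special, and so is its state `φ xbar`, which replaces special ones. -/
theorem notMem_range_of_region (hreg : IsRegular ιX ιS Φ) (hφ : φ ∈ Φ)
    (hdec : Decodes φ p q₁ q₂) (hxbar : (∃ x, x ∉ Set.range ιX) → xbar ∉ Set.range ιX)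
    {r : Option Bool × Option Bool} (hr : regionProb ιS r p ≠ 0)
    (hbase : (r.1.isSome && r.2.isSome) = false) :
    ∀ st ∈ (regionStates ιS (φ xbar) r p).support, st.2 ∉ Set.range ιS := by
  intro st hst
  obtain ⟨st', hst', hk, rfl⟩ := mem_support_regionStates hr hst
  subst hk
  have hsbar : φ xbar ∉ Set.range ιS := by
    refine (hreg.2.2 φ hφ).2 xbar (hxbar ?_)
    simp only [kinds, Bool.and_eq_false_iff, Option.isSome_eq_false_iff,
      Option.isNone_iff_eq_none] at hbase
    rcases hbase with h | h
    · obtain ⟨x, hx⟩ := (q₁ st'.1).support_nonempty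
      refine ⟨x, kind_eq_none_iff.1 ?_⟩
      rw [← kind_decode hreg hφ, (hdec st' hst').1 x hx, h]
    · obtain ⟨x, hx⟩ := (q₂ st'.2).support_nonempty
      refine ⟨x, kind_eq_none_iff.1 ?_⟩
      rw [← kind_decode hreg hφ, (hdec st' hst').2 x hx, h]
  change (if (kind ιS st'.2).val.isSome then φ xbar else st'.2) ∉ _
  by_cases h : (kind ιS st'.2).val.isSome
  · rwa [if_pos h]
  · rw [if_neg h]
    exact kind_eq_none_iff.1 (by simpa using h)

open Classical in
/-- Restricting to a region amounts to passing to the corresponding law for the base class. -/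
theorem expect_region (hreg : IsRegular ιX ιS Φ) (hφ : φ ∈ Φ) (hdec : Decodes φ p q₁ q₂)
    (r : Option Bool × Option Bool) (G : S → S → X → X → ℝ≥0∞) :
    expect (pairLaw p q₁ q₂) (fun x => if kinds ιX x.1 x.2 = r then
      G (φ x.1) (φ x.2) (toBase xbar r.1 x.1) (toBase xbar r.2 x.2) else 0) =
    regionProb ιS r p * expect (regionLaw ιS (φ xbar) xbar r p q₁ q₂) fun x =>
      G (origState ιS r.1 (φ x.1)) (origState ιS r.2 (φ x.2)) x.1 x.2 := by
  -- On a null region `fiber` has its default value and `decodes_region` does not apply, so both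
  -- sides are shown to vanish directly.
  by_cases hr : regionProb ιS r p = 0
  · rw [hr, zero_mul]
    refine le_antisymm (expect_le_of_le fun x hx => ?_) zero_le
    rw [if_neg]
    intro h
    simp only [pairLaw, PMF.mem_support_bind_iff, PMF.mem_support_map_iff] at hx
    obtain ⟨st, hst, x₁, hx₁, x₂, hx₂, rfl⟩ := hx
    have := expect_eq_zero hr st hst
    simp only [kinds, ← kind_decode hreg hφ] at h this
    rw [(hdec st hst).1 x₁ hx₁, (hdec st hst).2 x₂ hx₂] at h
    simp [h] at this
  have hk : ∀ x : X × X, kinds ιX x.1 x.2 = kinds ιS (φ x.1) (φ x.2) := fun x => by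
    simp only [kinds, kind_decode hreg hφ]
  simp only [hk]
  rw [expect_pairLaw_decode hdec fun s t x y => if kinds ιS s t = r then
      G s t (toBase xbar r.1 x) (toBase xbar r.2 y) else 0, regionLaw,
    expect_pairLaw_decode (decodes_region hdec hr) fun s t x y =>
      G (origState ιS r.1 s) (origState ιS r.2 t) x y, regionStates, expect_map, regionProb,
      prob_mul_expect_fiber]
  refine expect_congr fun st _ => ?_
  by_cases h : kinds ιS st.1 st.2 = r
  · have h1 : (kind ιS st.1).val = r.1 := congrArg Prod.fst h
    have h2 : (kind ιS st.2).val = r.2 := congrArg Prod.snd h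
    simp only [h, if_true, origState_baseState h1, origState_baseState h2, expect_baseEmit]
  · simp [h, expect_const]

/-- The base-class sample that stands for a sample in the region `r`. -/
def toRegion (ιX : Bool → X) (xbar : X) (r : Option Bool × Option Bool) (d : X × X × Bool) :
    Option (X × X × Bool) :=
  if kinds ιX d.1 d.2.1 = r then
    some (toBase xbar r.1 d.1, toBase xbar r.2 d.2.1, d.2.2) else none

theorem select_val (r : Option Bool × Option Bool) (l : List (X × X × Bool)) :
    (select ιX xbar r l).val = l.filterMap (toRegion ιX xbar r) := by
  induction l with
  | nil => rfl
  | cons d l ih =>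
    simp only [select, Timed.val_bind, val_op, List.filterMap_cons, ih]
    by_cases h : ((kind ιX d.1).val, (kind ιX d.2.1).val) = r
    · have h' : kinds ιX d.1 d.2.1 = r := h
      rw [toRegion, if_pos h']
      subst h
      simp
    · have h' : ¬ kinds ιX d.1 d.2.1 = r := h
      rw [toRegion, if_neg h']
      simp [h]

theorem expect_toRegion (hreg : IsRegular ιX ιS Φ) (hφ : φ ∈ Φ) (hdec : Decodes φ p q₁ q₂)
    (f : S → S → ℝ) (r : Option Bool × Option Bool) (F : X × X × Bool → ℝ≥0∞) :
    expect (sampleLaw φ (pairLaw p q₁ q₂) f) (fun d => (toRegion ιX xbar r d).elim 0 F) =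
      regionProb ιS r p * expect (sampleLaw φ (regionLaw ιS (φ xbar) xbar r p q₁ q₂)
        fun s t => f (origState ιS r.1 s) (origState ιS r.2 t)) F := by
  classical
  rw [expect_sampleLaw, expect_sampleLaw]
  rw [← expect_region hreg hφ hdec r fun s t x y => expect (ber (f s t)) fun z => F (x, y, z)]
  refine expect_congr fun x _ => ?_
  simp only [toRegion]
  split_ifs
  · rfl
  · simp [expect_const]

theorem prob_toRegion (hreg : IsRegular ιX ιS Φ) (hφ : φ ∈ Φ) (hdec : Decodes φ p q₁ q₂)
    (f : S → S → ℝ) (r : Option Bool × Option Bool) :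
    prob (sampleLaw φ (pairLaw p q₁ q₂) f) (fun d => (toRegion ιX xbar r d).isSome) =
      regionProb ιS r p := by
  have := expect_toRegion (xbar := xbar) hreg hφ hdec f r fun _ => 1
  rw [expect_const, mul_one] at this
  rw [← this]
  refine expect_congr fun d _ => ?_
  cases h : toRegion ιX xbar r d <;> simp [h]

end Regions

/-! ### Fitting the nine regions and stitching the predictors. -/

section Augmented

variable {X S : Type} {ιX : Bool → X} {ιS : Bool → S} {Φ : Set (X → S)} {φ : X → S}
  {p : PMF (S × S)} {q₁ q₂ : S → PMF X} {f : S → S → ℝ} {xbar : X}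

/-- The part of `fitRegion` that follows the selection of samples. -/
def fitSub (alg : TwoContextAlg X) (ε δ : ℝ) (r : Option Bool × Option Bool) :
    List (X × X × Bool) → Comp (Predictor2 X)
  | [] => return fun _ _ => op 0
  | d :: l =>
      if r.1.isSome && r.2.isSome then do
        let t ← sumLabels (d :: l)
        charge (l.length + 1)
        let v ← op (t / ((l.length + 1 : ℕ) : ℝ))
        return fun _ _ => op v
      else alg (d :: l) (ε / 2) (δ / 18)

theorem fitRegion_eq (alg : TwoContextAlg X) (data : List (X × X × Bool)) (ε δ : ℝ)
    (r : Option Bool × Option Bool) :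
    fitRegion alg ιX xbar data ε δ r = (do
      let sub ← (liftM (select ιX xbar r data) : Comp (List (X × X × Bool)))
      fitSub alg ε δ r sub) := by
  unfold fitRegion
  refine congrArg _ (funext fun sub => ?_)
  cases sub <;> rfl

theorem law_fitRegion (alg : TwoContextAlg X) (data : List (X × X × Bool)) (ε δ : ℝ)
    (r : Option Bool × Option Bool) :
    (fitRegion alg ιX xbar data ε δ r).law =
      (fitSub alg ε δ r (data.filterMap (toRegion ιX xbar r))).law := by
  rw [fitRegion_eq, Comp.law_bind, Comp.law_lift, PMF.pure_bind, select_val]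

theorem sumLabels_val (l : List (X × X × Bool)) :
    (sumLabels l).val = (l.map fun d => bit d.2.2).sum := by
  induction l with
  | nil => rfl
  | cons d l ih => simp [sumLabels, ih]

theorem bit_mem (b : Bool) : bit b ∈ Set.Icc (0 : ℝ) 1 := by
  cases b <;> simp [bit]

theorem mean_labels_mem (l : List (X × X × Bool)) (m : ℕ) (hm : l.length ≤ m) :
    (sumLabels l).val / (m : ℝ) ∈ Set.Icc (0 : ℝ) 1 := by
  have h : (sumLabels l).val ∈ Set.Icc (0 : ℝ) l.length := by
    clear hm
    rw [sumLabels_val]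
    induction l with
    | nil => simp
    | cons d l ih =>
      simp only [List.map_cons, List.sum_cons, List.length_cons]
      push_cast
      have := bit_mem d.2.2
      exact ⟨add_nonneg this.1 ih.1, by linarith [this.2, ih.2]⟩
  have hm' : (l.length : ℝ) ≤ m := by exact_mod_cast hm
  exact ⟨div_nonneg h.1 (Nat.cast_nonneg _), div_le_one_of_le₀ (h.2.trans hm') (Nat.cast_nonneg _)⟩

theorem fitSub_mem {alg : TwoContextAlg X} {ε δ : ℝ} {r : Option Bool × Option Bool}
    (halg : ∀ data, ∀ R ∈ (alg data (ε / 2) (δ / 18)).law.support,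
      ∀ x y, (R x y).val ∈ Set.Icc (0 : ℝ) 1)
    {sub : List (X × X × Bool)} {R : Predictor2 X} (hR : R ∈ (fitSub alg ε δ r sub).law.support)
    (x y : X) : (R x y).val ∈ Set.Icc (0 : ℝ) 1 := by
  cases sub with
  | nil =>
    simp only [fitSub, Comp.law_pure, PMF.support_pure, Set.mem_singleton_iff] at hR
    subst hR
    simp
  | cons d l =>
    unfold fitSub at hR
    split_ifs at hR
    · simp only [Comp.law_bind, Comp.law_lift, Comp.law_pure, PMF.pure_bind, val_op,
        PMF.support_pure, Set.mem_singleton_iff] at hR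
      subst hR
      exact mean_labels_mem (d :: l) (l.length + 1) le_rfl
    · exact halg _ R hR x y

/-- The final predictor of `twoAug`, from the table of the regions' predictors. -/
def augPick (ιX : Bool → X) (xbar : X)
    (table : List ((Option Bool × Option Bool) × Predictor2 X)) : Predictor2 X :=
  fun x₁ x₂ => do
    let k₁ ← kind ιX x₁
    let k₂ ← kind ιX x₂
    charge 9
    match table.find? (fun p => decide (p.1 = (k₁, k₂))) with
    | none => op 0
    | some p => p.2 (toBase xbar k₁ x₁) (toBase xbar k₂ x₂)

/-- `fitRegion`, labeled by the region. -/
def fitEntry (alg : TwoContextAlg X) (ιX : Bool → X) (xbar : X) (data : List (X × X × Bool))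
    (ε δ : ℝ) (r : Option Bool × Option Bool) :
    Comp ((Option Bool × Option Bool) × Predictor2 X) := do
  let R ← fitRegion alg ιX xbar data ε δ r
  return (r, R)

theorem twoAug_eq (alg : TwoContextAlg X) (data : List (X × X × Bool)) (ε δ : ℝ) :
    twoAug alg ιX xbar data ε δ = (do
      let table ← forEach (fitEntry alg ιX xbar data ε δ) regions
      return augPick ιX xbar table) := rfl

theorem law_twoAug (alg : TwoContextAlg X) (data : List (X × X × Bool)) (ε δ : ℝ) :
    (twoAug alg ιX xbar data ε δ).law =
      (forEach (fitEntry alg ιX xbar data ε δ) regions).law.map (augPick ιX xbar) := by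
  rw [twoAug_eq, Comp.law_bind, ← PMF.bind_pure_comp]
  simp only [Comp.law_pure]
  rfl

theorem mem_support_fitEntry {alg : TwoContextAlg X} {data : List (X × X × Bool)} {ε δ : ℝ}
    {r : Option Bool × Option Bool} {q : (Option Bool × Option Bool) × Predictor2 X} :
    q ∈ (fitEntry alg ιX xbar data ε δ r).law.support ↔
      q.1 = r ∧ q.2 ∈ (fitRegion alg ιX xbar data ε δ r).law.support := by
  simp only [fitEntry, Comp.law_bind, Comp.law_pure, PMF.mem_support_bind_iff, PMF.support_pure,
    Set.mem_singleton_iff]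
  constructor
  · rintro ⟨R, hR, rfl⟩
    exact ⟨rfl, hR⟩
  · rintro ⟨rfl, hR⟩
    exact ⟨q.2, hR, rfl⟩

theorem mem_regions (r : Option Bool × Option Bool) : r ∈ regions := by
  revert r
  decide

theorem augPick_spec {table : List ((Option Bool × Option Bool) × Predictor2 X)}
    (h : table.map Prod.fst = regions) (x y : X) :
    ∃ q ∈ table, kinds ιX x y = q.1 ∧ (augPick ιX xbar table x y).val =
      (q.2 (toBase xbar q.1.1 x) (toBase xbar q.1.2 y)).val := by
  have hmem : kinds ιX x y ∈ table.map Prod.fst := h ▸ mem_regions _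
  obtain ⟨q₀, hq₀, hq₀'⟩ := List.mem_map.1 hmem
  have hsome : (table.find? fun p => decide (p.1 = kinds ιX x y)).isSome := by
    rw [List.find?_isSome]
    exact ⟨q₀, hq₀, by simpa using hq₀'⟩
  obtain ⟨q, hq⟩ := Option.isSome_iff_exists.1 hsome
  have hqk : q.1 = kinds ιX x y := by simpa using List.find?_some hq
  refine ⟨q, List.mem_of_find?_eq_some hq, hqk.symm, ?_⟩
  have hq' : (table.find? fun p => decide (p.1 = ((kind ιX x).val, (kind ιX y).val))) = some q := hq
  simp only [augPick, Timed.val_bind, hq', hqk, kinds]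

theorem map_fst_of_mem_support {alg : TwoContextAlg X} {data : List (X × X × Bool)} {ε δ : ℝ}
    {l : List (Option Bool × Option Bool)}
    {table : List ((Option Bool × Option Bool) × Predictor2 X)}
    (h : table ∈ (forEach (fitEntry alg ιX xbar data ε δ) l).law.support) :
    table.map Prod.fst = l ∧
      ∀ q ∈ table, q.2 ∈ (fitRegion alg ιX xbar data ε δ q.1).law.support := by
  have := forall₂_of_mem_support_forEach h
  induction this with
  | nil => simp
  | cons hb hl ih =>
    rename_i a b l₁ l₂
    obtain ⟨h1, h2⟩ := mem_support_fitEntry.1 hb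
    have ih' := ih ?_
    · refine ⟨by simp [h1, ih'.1], ?_⟩
      simp only [List.mem_cons, forall_eq_or_imp]
      exact ⟨h1 ▸ h2, ih'.2⟩
    · simp only [forEach, Comp.law_bind, Comp.law_pure, PMF.mem_support_bind_iff,
        PMF.support_pure, Set.mem_singleton_iff] at h
      obtain ⟨b', -, l', hl', heq⟩ := h
      rw [(List.cons.inj heq).2]
      exact hl'

theorem exp_neg_le_inv {x y : ℝ} (hx : 0 < x) (h : x ≤ y) : Real.exp (-y) ≤ x⁻¹ := by
  rw [Real.exp_neg]
  refine inv_anti₀ hx (h.trans ?_)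
  linarith [Real.add_one_le_exp y]

/-- The empirical mean estimates a constant label probability. -/
theorem prob_mean_le {D : PMF (X × X)} {c : ℝ} (hc : c ∈ Set.Icc (0 : ℝ) 1)
    (hf : ∀ x ∈ D.support, f (φ x.1) (φ x.2) = c) {ε δ : ℝ} (hε : ε ∈ Set.Ioo (0 : ℝ) (1 / 2))
    (hδ : δ ∈ Set.Ioo (0 : ℝ) (1 / 2)) {m : ℕ} (hm : 72 / (ε * δ) ≤ m) :
    prob (iid (sampleLaw φ D f) m) (fun l =>
      ¬ ((l.map fun d => bit d.2.2).sum / (m : ℝ) - c) ^ 2 ≤ ε / 2) ≤ ENNReal.ofReal (δ / 18) := by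
  obtain ⟨hε0, hε1⟩ := hε
  obtain ⟨hδ0, hδ1⟩ := hδ
  have hm0 : (0 : ℝ) < m := lt_of_lt_of_le (by positivity) hm
  set t := Real.sqrt (ε / 2) with ht
  have ht0 : 0 ≤ t := Real.sqrt_nonneg _
  have htsq : t ^ 2 = ε / 2 := Real.sq_sqrt (by linarith)
  have ht1 : t ≤ 1 / 2 := by
    rw [ht, Real.sqrt_le_left (by norm_num)]
    linarith
  set Y : X × X × Bool → ℝ := fun d => bit d.2.2
  have hmean : (expect (sampleLaw φ D f) fun d => ENNReal.ofReal (Y d)).toReal = c := by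
    rw [expect_sampleLaw]
    have : ∀ x ∈ D.support, expect (ber (f (φ x.1) (φ x.2)))
        (fun y => ENNReal.ofReal (Y (x.1, x.2, y))) = ENNReal.ofReal c := by
      intro x hx
      rw [hf x hx, expect_ber hc]
      simp [Y, bit]
    rw [expect_congr this, expect_const, ENNReal.toReal_ofReal hc.1]
  have hup := prob_sum_ge_le (W := sampleLaw φ D f) (Y := Y) (fun d => bit_mem _) ht0 ht1 m
  have hlo := prob_sum_le_le (W := sampleLaw φ D f) (Y := Y) (fun d => bit_mem _) ht0 ht1 m
  rw [hmean] at hup hlo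
  -- With `t² = ε/2`, having `72/(εδ)` samples gives `m t² ≥ 36/δ`. The two tails together cost
  -- `δ/18`.
  have hexp : Real.exp (-(m * t ^ 2)) ≤ δ / 36 := by
    have := exp_neg_le_inv (x := 36 / δ) (y := m * t ^ 2) (by positivity) (by
      rw [htsq]
      rw [div_le_iff₀ (by positivity)] at hm ⊢
      linarith)
    rwa [inv_div] at this
  calc _ ≤ prob (iid (sampleLaw φ D f) m) (fun l => m * (c + t) ≤ (l.map Y).sum ∨
        (l.map Y).sum ≤ m * (c - t)) := by
        refine prob_mono fun l _ hbad => ?_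
        by_contra! hno
        refine hbad ?_
        have h1 : (l.map Y).sum / m < c + t := by
          rw [div_lt_iff₀ hm0]; linarith [hno.1]
        have h2 : c - t < (l.map Y).sum / m := by
          rw [lt_div_iff₀ hm0]; linarith [hno.2]
        rw [← htsq]
        exact sq_le_sq' (by linarith) (by linarith)
    _ ≤ ENNReal.ofReal (δ / 36) + ENNReal.ofReal (δ / 36) :=
        (prob_or_le _ _ _).trans (add_le_add (hup.trans (ENNReal.ofReal_le_ofReal hexp))
          (hlo.trans (ENNReal.ofReal_le_ofReal hexp)))
    _ = _ := by
        rw [← ENNReal.ofReal_add (by linarith) (by linarith)]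
        congr 1
        ring

theorem regionLaw_decode_eq {r : Option Bool × Option Bool} (f : S → S → ℝ) {b₁ b₂ : Bool} (hr : r = (some b₁, some b₂))
    (x : X × X) :
    f (origState ιS r.1 (φ x.1)) (origState ιS r.2 (φ x.2)) = f (ιS b₁) (ιS b₂) := by
  subst hr
  rfl

theorem one_le_card_sub_two [Fintype S] (hιS : Function.Injective ιS) {p : PMF (S × S)}
    (hns : ∀ st ∈ p.support, st.2 ∉ Set.range ιS) : 1 ≤ Fintype.card S - 2 := by
  classical
  obtain ⟨st, hst⟩ := p.support_nonempty
  rw [← card_not_special hιS, Nat.one_le_iff_ne_zero, Finset.card_ne_zero]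
  exact ⟨st.2, by simpa using hns st hst⟩

/-- The guarantee for one region. -/
theorem prob_fitSub_le [Fintype S] (hreg : IsRegular ιX ιS Φ) {O : RLOracle X}
    {N K : ℝ → ℝ → ℕ → ℕ → ℕ} (hO : IsEfficientRL Φ O N K) (hφ : φ ∈ Φ)
    (hdec : Decodes φ p q₁ q₂) (hxbar : (∃ x, x ∉ Set.range ιX) → xbar ∉ Set.range ιX)
    (hf : ∀ s t, f s t ∈ Set.Icc (0 : ℝ) 1) {ε δ : ℝ} (hε : ε ∈ Set.Ioo (0 : ℝ) (1 / 2))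
    (hδ : δ ∈ Set.Ioo (0 : ℝ) (1 / 2)) {r : Option Bool × Option Bool}
    (hr : regionProb ιS r p ≠ 0) {m : ℕ}
    (hm : 1 ≤ Fintype.card S - 2 → twoRedSamples N K (Fintype.card S - 2) (ε / 2) (δ / 18) ≤ m)
    (hm' : 72 / (ε * δ) ≤ m) :
    expect (iid (sampleLaw φ (regionLaw ιS (φ xbar) xbar r p q₁ q₂)
        fun s t => f (origState ιS r.1 s) (origState ιS r.2 t)) m) (fun sub =>
      prob (fitSub (twoRed O (ιX false) (ιX true) (Fintype.card S - 2)) ε δ r sub).law fun R =>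
        ¬ expect (regionLaw ιS (φ xbar) xbar r p q₁ q₂) (fun x => ENNReal.ofReal
          (((R x.1 x.2).val - f (origState ιS r.1 (φ x.1)) (origState ιS r.2 (φ x.2))) ^ 2)) ≤
            ENNReal.ofReal (ε / 2)) ≤ ENNReal.ofReal (δ / 18) := by
  have hε0 := hε.1
  have hδ0 := hδ.1
  have hε1 := hε.2
  have hδ1 := hδ.2
  have hm0 : (0 : ℝ) < m := lt_of_lt_of_le (by positivity) hm'
  have hm1 : 0 < m := by exact_mod_cast hm0
  by_cases hbase : (r.1.isSome && r.2.isSome) = true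
  · obtain ⟨b₁, b₂, hb⟩ : ∃ b₁ b₂, r = (some b₁, some b₂) := by
      obtain ⟨r₁, r₂⟩ := r
      cases r₁ <;> cases r₂ <;> simp at hbase ⊢
    set c := f (ιS b₁) (ιS b₂) with hcdef
    have hfc : ∀ x : X × X, f (origState ιS r.1 (φ x.1)) (origState ιS r.2 (φ x.2)) = c :=
      fun x => regionLaw_decode_eq f hb x
    refine le_trans ?_ (prob_mean_le (φ := φ) (D := regionLaw ιS (φ xbar) xbar r p q₁ q₂)
      (f := fun s t => f (origState ιS r.1 s) (origState ιS r.2 t)) (hf _ _)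
      (fun x _ => hfc x) hε hδ hm')
    refine expect_mono fun sub hsub => ?_
    obtain ⟨hlen, -⟩ := mem_support_iid.1 hsub
    cases sub with
    | nil => simp at hlen; omega
    | cons d l =>
      have hl : (l.length + 1 : ℕ) = m := hlen
      simp only [fitSub, hbase, if_true, Comp.law_bind, Comp.law_lift, Comp.law_pure,
        PMF.pure_bind, val_op, hl, sumLabels_val, hfc]
      by_cases h : (((d :: l).map fun d => bit d.2.2).sum / (m : ℝ) - c) ^ 2 ≤ ε / 2
      · rw [prob_pure_of_not]
        · exact zero_le
        · simp only [not_not, expect_const]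
          exact ENNReal.ofReal_le_ofReal h
      · rw [if_pos h]
        exact prob_le_one _ _
  · have hbase' : (r.1.isSome && r.2.isSome) = false := by simpa using hbase
    have hns := notMem_range_of_region hreg hφ hdec hxbar hr hbase'
    refine le_trans (expect_mono fun sub hsub => ?_)
      (prob_twoRed_le hreg hO hφ (decodes_region hdec hr) hns
        (f := fun s t => f (origState ιS r.1 s) (origState ιS r.2 t)) (fun s t => hf _ _)
        (ε := ε / 2) (δ := δ / 18) ⟨by linarith, by linarith⟩ ⟨by linarith, by linarith⟩
        (hm (one_le_card_sub_two hreg.2.1 hns)))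
    obtain ⟨hlen, -⟩ := mem_support_iid.1 hsub
    cases sub with
    | nil => simp at hlen; omega
    | cons d l =>
      simp only [fitSub, hbase']
      exact le_rfl

theorem sum_regionProb : (regions.map fun r => regionProb ιS r p).sum = 1 := by
  unfold regionProb prob
  rw [← expect_list_sum]
  refine (expect_congr fun st _ => ?_).trans (expect_const p 1)
  beta_reduce
  generalize kinds ιS st.1 st.2 = k
  obtain ⟨k₁, k₂⟩ := k
  rcases k₁ with _ | _ | _ <;> rcases k₂ with _ | _ | _ <;> simp [regions]

/-- The error of the stitched predictor is at most the sum of the errors in the regions. -/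
theorem expect_augPick_le (hreg : IsRegular ιX ιS Φ) (hφ : φ ∈ Φ) (hdec : Decodes φ p q₁ q₂)
    {table : List ((Option Bool × Option Bool) × Predictor2 X)}
    (h : table.map Prod.fst = regions) :
    expect (pairLaw p q₁ q₂) (fun x => ENNReal.ofReal
      (((augPick ιX xbar table x.1 x.2).val - f (φ x.1) (φ x.2)) ^ 2)) ≤
    (table.map fun q => regionProb ιS q.1 p *
      expect (regionLaw ιS (φ xbar) xbar q.1 p q₁ q₂) fun x => ENNReal.ofReal
        (((q.2 x.1 x.2).val - f (origState ιS q.1.1 (φ x.1)) (origState ιS q.1.2 (φ x.2))) ^ 2)).sum := by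
  classical
  simp only [← fun q : (Option Bool × Option Bool) × Predictor2 X =>
    expect_region (xbar := xbar) hreg hφ hdec q.1 fun s t x y =>
      ENNReal.ofReal (((q.2 x y).val - f s t) ^ 2)]
  rw [← expect_list_sum]
  refine expect_mono fun x _ => ?_
  obtain ⟨q, hq, hk, hval⟩ := augPick_spec (ιX := ιX) (xbar := xbar) h x.1 x.2
  refine le_trans (le_of_eq ?_) (List.single_le_sum (fun _ _ => zero_le) _
    (List.mem_map_of_mem hq))
  simp only [if_pos hk, hval]

/-- The nine regions cost at most `ε/18` each for being unlikely, together `ε/2`. The likely ones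
have error at most `ε/2`, weighted by probabilities that sum to `1`. Each likely region fails with
probability at most `δ/18` for too few samples and `δ/18` for the fit. For such a region, `n ≥
36M/ε` makes its expected sample count at least `2M`, and `n ≥ 23328/(ε²δ)`, where `23328 = 18 ·
36²`, makes the Hoeffding exponent at least `18/δ`. -/
theorem isEfficientTwoContext_regToRL [Fintype S] (hreg : IsRegular ιX ιS Φ) {O : RLOracle X}
    {N K : ℝ → ℝ → ℕ → ℕ → ℕ} (hO : IsEfficientRL Φ O N K)
    (hxbar : (∃ x, x ∉ Set.range ιX) → xbar ∉ Set.range ιX) {Nreg : ℝ → ℝ → ℕ}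
    (hN : ∀ ε ∈ Set.Ioo (0 : ℝ) (1 / 2), ∀ δ ∈ Set.Ioo (0 : ℝ) (1 / 2), ∃ M : ℕ,
      (1 ≤ Fintype.card S - 2 → twoRedSamples N K (Fintype.card S - 2) (ε / 2) (δ / 18) ≤ M) ∧ 72 / (ε * δ) ≤ M ∧
      36 * M / ε ≤ Nreg ε δ ∧ 23328 / (ε ^ 2 * δ) ≤ Nreg ε δ) :
    IsEfficientTwoContext Φ (regToRL O ιX xbar (Fintype.card S)) Nreg := by
  intro ε hε δ hδ n hn φ hφ D hD f hf
  obtain ⟨p, q₁, q₂, rfl, hdec⟩ := hD.exists_pairLaw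
  obtain ⟨M, hM1, hM2, hM3, hM4⟩ := hN ε hε δ hδ
  have hn' : (Nreg ε δ : ℝ) ≤ n := by exact_mod_cast hn
  have hε0 := hε.1
  have hδ0 := hδ.1
  have hε1 := hε.2
  have hδ1 := hδ.2
  set alg := twoRed O (ιX false) (ιX true) (Fintype.card S - 2) with halg
  have hmem : ∀ data r, ∀ R ∈ (fitRegion alg ιX xbar data ε δ r).law.support, ∀ x y,
      (R x y).val ∈ Set.Icc (0 : ℝ) 1 := by
    intro data r R hR x y
    rw [law_fitRegion] at hR
    exact fitSub_mem (fun data R hR x y => twoRed_mem (by linarith) hR x y) hR x y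
  constructor
  · intro o ho x y
    rw [regressionLaw, PMF.mem_support_bind_iff] at ho
    obtain ⟨data, -, ho⟩ := ho
    have := mem_law_support ho
    rw [regToRL, law_twoAug, PMF.mem_support_map_iff] at this
    obtain ⟨table, ht, hval⟩ := this
    obtain ⟨h1, h2⟩ := map_fst_of_mem_support ht
    obtain ⟨q, hq, -, hv⟩ := augPick_spec (ιX := ιX) (xbar := xbar) h1 x y
    rw [← hval, hv]
    exact hmem data _ _ (h2 q hq) _ _
  · refine (le_toOuterMeasure_iff hδ.1.le (by linarith [hδ.2])).2 ?_
    refine (le_of_eq (prob_regressionLaw (regToRL O ιX xbar (Fintype.card S)) φ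
      (pairLaw p q₁ q₂) f n ε δ fun R => ¬ expect (pairLaw p q₁ q₂) (fun x => ENNReal.ofReal
        (((R x.1 x.2).val - f (φ x.1) (φ x.2)) ^ 2)) ≤ ENNReal.ofReal ε)).trans ?_
    set err : (Option Bool × Option Bool) → Predictor2 X → ℝ≥0∞ := fun r R =>
      expect (regionLaw ιS (φ xbar) xbar r p q₁ q₂) fun x => ENNReal.ofReal
        (((R x.1 x.2).val - f (origState ιS r.1 (φ x.1)) (origState ιS r.2 (φ x.2))) ^ 2) with herr
    -- Only a likely region can be bad. For the others, no accuracy is claimed and the trivial error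
    -- bound `1` is used.
    set bad : (Option Bool × Option Bool) × Predictor2 X → Prop := fun q =>
      ENNReal.ofReal (ε / 18) ≤ regionProb ιS q.1 p ∧ ¬ err q.1 q.2 ≤ ENNReal.ofReal (ε / 2)
      with hbad
    have hstep : ∀ data, prob (regToRL O ιX xbar (Fintype.card S) data ε δ).law (fun R =>
        ¬ expect (pairLaw p q₁ q₂) (fun x => ENNReal.ofReal
        (((R x.1 x.2).val - f (φ x.1) (φ x.2)) ^ 2)) ≤ ENNReal.ofReal ε) ≤
        (regions.map fun r => prob (fitEntry alg ιX xbar data ε δ r).law bad).sum := by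
      intro data
      rw [regToRL, law_twoAug, prob_map]
      refine le_trans (prob_mono fun table ht hb => ?_) (prob_forEach_le _ _ _)
      by_contra! hno
      refine hb ?_
      obtain ⟨h1, h2⟩ := map_fst_of_mem_support ht
      refine (expect_augPick_le hreg hφ hdec h1).trans ?_
      calc _ ≤ (table.map fun q => ENNReal.ofReal (ε / 18) +
            regionProb ιS q.1 p * ENNReal.ofReal (ε / 2)).sum := by
            refine List.sum_le_sum fun q hq => ?_
            have hnb := hno q hq
            simp only [hbad, not_and, not_not] at hnb
            by_cases hρ : ENNReal.ofReal (ε / 18) ≤ regionProb ιS q.1 p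
            · refine le_trans ?_ le_add_self
              gcongr
              exact hnb hρ
            · refine le_trans ?_ le_self_add
              have herr1 : err q.1 q.2 ≤ 1 := by
                refine expect_le_of_le fun x _ => ?_
                have ha := hmem data _ _ (h2 q hq) x.1 x.2
                have hb := hf (origState ιS q.1.1 (φ x.1)) (origState ιS q.1.2 (φ x.2))
                rw [ENNReal.ofReal_le_one]
                rw [sq_le_one_iff_abs_le_one, abs_le]
                constructor <;> linarith [ha.1, ha.2, hb.1, hb.2]
              calc _ ≤ regionProb ιS q.1 p * 1 := by gcongr
                _ ≤ _ := by rw [mul_one]; exact (not_le.1 hρ).le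
        _ = (regions.map fun r => ENNReal.ofReal (ε / 18) +
            regionProb ιS r p * ENNReal.ofReal (ε / 2)).sum := by
            rw [← h1, List.map_map]
            rfl
        _ = ENNReal.ofReal ε := by
            rw [List.sum_map_add, List.sum_map_mul_right, sum_regionProb, one_mul]
            simp only [regions, List.map_cons, List.map_nil, List.sum_cons, List.sum_nil, add_zero]
            repeat rw [← ENNReal.ofReal_add (by positivity) (by positivity)]
            congr 1
            ring
    calc _ ≤ expect (iid (sampleLaw φ (pairLaw p q₁ q₂) f) n) (fun data =>
          (regions.map fun r => prob (fitEntry alg ιX xbar data ε δ r).law bad).sum) :=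
          expect_mono fun data _ => hstep data
      _ = (regions.map fun r => expect (iid (sampleLaw φ (pairLaw p q₁ q₂) f) n) fun data =>
          prob (fitEntry alg ιX xbar data ε δ r).law bad).sum := expect_list_sum _ _ _
      _ ≤ (regions.map fun _ => ENNReal.ofReal (δ / 9)).sum := by
          refine List.sum_le_sum fun r _ => ?_
          have hentry : ∀ data, prob (fitEntry alg ιX xbar data ε δ r).law bad =
              prob (fitSub alg ε δ r (data.filterMap (toRegion ιX xbar r))).law fun R =>
                bad (r, R) := by
            intro data
            simp only [fitEntry, Comp.law_bind, Comp.law_pure]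
            rw [prob_bind, expect_prob_pure, law_fitRegion]
          simp only [hentry]
          by_cases hρ : ENNReal.ofReal (ε / 18) ≤ regionProb ιS r p
          swap
          · refine le_trans (expect_le_of_le (c := 0) fun data _ => ?_) zero_le
            rw [prob_eq_zero]
            intro R _ hb
            exact hρ hb.1
          have hr0 : regionProb ιS r p ≠ 0 := by
            intro h0
            rw [h0] at hρ
            simp only [nonpos_iff_eq_zero, ENNReal.ofReal_eq_zero] at hρ
            linarith
          have hrfin : regionProb ιS r p ≠ ∞ :=
            ne_top_of_le_ne_top ENNReal.one_ne_top (prob_le_one _ _)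
          set ρ := (regionProb ιS r p).toReal with hρdef
          have hρ' : ε / 18 ≤ ρ := (ENNReal.ofReal_le_iff_le_toReal hrfin).1 hρ
          have hprob := prob_toRegion (xbar := xbar) hreg hφ hdec f r
          have hsplit : ENNReal.ofReal (δ / 9) =
              ENNReal.ofReal (δ / 18) + ENNReal.ofReal (δ / 18) := by
            rw [← ENNReal.ofReal_add (by linarith) (by linarith)]
            congr 1
            ring
          rw [hsplit]
          refine expect_iid_filterMap_le (M := M)
            (Q := sampleLaw φ (regionLaw ιS (φ xbar) xbar r p q₁ q₂)
              fun s t => f (origState ιS r.1 s) (origState ιS r.2 t))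
            (H := fun sub => prob (fitSub alg ε δ r sub).law fun R => bad (r, R))
            (fun F => ?_) (fun l => prob_le_one _ _) ?_ ?_
          · rw [hprob]
            exact expect_toRegion hreg hφ hdec f r F
          · refine (prob_length_filterMap_lt_le ?_).trans ?_
            · rw [hprob, ← hρdef]
              have h1 : 36 * (M : ℝ) ≤ n * ε := (div_le_iff₀ hε0).1 (hM3.trans hn')
              have h2 : (n : ℝ) * (ε / 18) ≤ n * ρ := by gcongr
              linarith
            · rw [hprob, ← hρdef]
              refine ENNReal.ofReal_le_ofReal ?_
              have h1 : 23328 ≤ n * (ε ^ 2 * δ) :=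
                (div_le_iff₀ (by positivity)).1 (hM4.trans hn')
              have h2 : 18 / δ ≤ n * (ρ / 2) ^ 2 := by
                calc 18 / δ ≤ n * ((ε / 18) / 2) ^ 2 := by
                      rw [div_le_iff₀ hδ0]
                      linarith
                  _ ≤ _ := by gcongr
              have := exp_neg_le_inv (by positivity) h2
              rwa [inv_div] at this
          · intro m hm
            have hm' : (M : ℝ) ≤ m := by exact_mod_cast hm
            refine le_trans (expect_mono fun sub _ => ?_) (prob_fitSub_le hreg hO hφ hdec hxbar hf
              hε hδ hr0 (fun h => (hM1 h).trans hm) (hM2.trans hm'))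
            exact prob_mono fun R _ hb => hb.2
      _ = ENNReal.ofReal δ := by
          simp only [regions, List.map_cons, List.map_nil, List.sum_cons, List.sum_nil, add_zero]
          repeat rw [← ENNReal.ofReal_add (by positivity) (by positivity)]
          congr 1
          ring

end Augmented

/-! ## Numbers of steps -/

section CostLe

variable {α β : Type}

/-- Almost surely, `c` takes at most `b` steps and its result satisfies `Q`. -/
def CostLe (c : Comp α) (b : ℕ) (Q : α → Prop) : Prop :=
  ∀ t ∈ c.run.support, t.cost ≤ b ∧ Q t.val

theorem CostLe.mono {c : Comp α} {b b' : ℕ} {Q Q' : α → Prop} (h : CostLe c b Q) (hb : b ≤ b')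
    (hQ : ∀ a, Q a → Q' a) : CostLe c b' Q' :=
  fun t ht => ⟨(h t ht).1.trans hb, hQ _ (h t ht).2⟩

/-- Records that an intermediate result can actually occur. This is how the oracle's almost sure
bound on cover sizes enters a step count. -/
theorem CostLe.and_mem_support {c : Comp α} {b : ℕ} {Q : α → Prop} (h : CostLe c b Q) :
    CostLe c b fun a => Q a ∧ a ∈ c.law.support :=
  fun t ht => ⟨(h t ht).1, (h t ht).2, mem_law_support ht⟩

theorem costLe_pure {a : α} {b : ℕ} {Q : α → Prop} (h : Q a) : CostLe (pure a : Comp α) b Q := by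
  intro t ht
  have : t ∈ (PMF.pure (⟨a, 0⟩ : Timed α)).support := ht
  rw [PMF.support_pure, Set.mem_singleton_iff] at this
  subst this
  exact ⟨Nat.zero_le _, h⟩

theorem costLe_lift {t : Timed α} {b : ℕ} {Q : α → Prop} (hb : t.cost ≤ b) (h : Q t.val) :
    CostLe (liftM t : Comp α) b Q := by
  intro t' ht
  have : t' ∈ (PMF.pure t).support := ht
  rw [PMF.support_pure, Set.mem_singleton_iff] at this
  subst this
  exact ⟨hb, h⟩

theorem costLe_ask (p : PMF α) : CostLe (ask p) 1 fun a => a ∈ p.support := by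
  intro t ht
  obtain ⟨a, ha, rfl⟩ := (PMF.mem_support_map_iff _ _ _).1 ht
  exact ⟨le_rfl, ha⟩

/-- The sequencing rule: step bounds add, and the postcondition of the first part is the
precondition of the second. -/
theorem CostLe.bind {x : Comp α} {f : α → Comp β} {b₁ b₂ b : ℕ} {Q₁ : α → Prop} {Q₂ : β → Prop}
    (h₁ : CostLe x b₁ Q₁) (h₂ : ∀ a, Q₁ a → CostLe (f a) b₂ Q₂) (hb : b₁ + b₂ ≤ b) :
    CostLe (x >>= f) b Q₂ := by
  intro t ht
  have ht' : t ∈ (x.run.bind fun a => (f a.val).run.map fun b =>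
    (⟨b.val, a.cost + b.cost⟩ : Timed β)).support := ht
  simp only [PMF.mem_support_bind_iff, PMF.mem_support_map_iff] at ht'
  obtain ⟨a, ha, c, hc, rfl⟩ := ht'
  have h1 := h₁ a ha
  have h2 := h₂ _ h1.2 c hc
  exact ⟨(Nat.add_le_add h1.1 h2.1).trans hb, h2.2⟩

theorem costLe_forEach {f : α → Comp β} {l : List α} {b : ℕ} {Q : β → Prop}
    (h : ∀ a ∈ l, CostLe (f a) b Q) :
    CostLe (forEach f l) (l.length * b) fun bs => bs.length = l.length ∧ ∀ c ∈ bs, Q c := by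
  induction l with
  | nil => exact costLe_pure ⟨rfl, by simp⟩
  | cons a l ih =>
    refine (h a (by simp)).bind (b₂ := l.length * b) (fun c hc => ?_)
      (le_of_eq (by simp only [List.length_cons]; ring))
    refine (ih fun a ha => h a (by simp [ha])).bind (b₂ := 0) (fun cs hcs => ?_) le_rfl
    refine costLe_pure ⟨by simp [hcs.1], ?_⟩
    simp only [List.mem_cons, forall_eq_or_imp]
    exact ⟨hc, hcs.2⟩

theorem cost_ite_le {c : Prop} [Decidable c] {x y : Timed α} {b : ℕ} (hx : x.cost ≤ b)
    (hy : y.cost ≤ b) : (if c then x else y).cost ≤ b := by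
  split_ifs
  · exact hx
  · exact hy

theorem argminAux_cost_le {score : α → Timed ℝ} {c : ℕ} {l : List α}
    (h : ∀ a ∈ l, (score a).cost ≤ c) (b : α) (v : ℝ) :
    (argminAux score l b v).cost ≤ l.length * (c + 1) := by
  induction l generalizing b v with
  | nil => simp [argminAux]
  | cons a l ih =>
    have ih' := ih fun a ha => h a (List.mem_cons_of_mem _ ha)
    refine (Nat.add_le_add (h a (by simp)) (Nat.add_le_add_left
      (cost_ite_le (ih' a (score a).val) (ih' b v)) 1)).trans ?_
    rw [List.length_cons, Nat.succ_mul]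
    omega

theorem argmin_cost_le {score : α → Timed ℝ} {c : ℕ} {a : α} {l : List α}
    (h : ∀ b ∈ a :: l, (score b).cost ≤ c) :
    (argmin score a l).cost ≤ (l.length + 1) * (c + 1) := by
  have h1 := h a (by simp)
  have h2 := argminAux_cost_le (fun b hb => h b (List.mem_cons_of_mem _ hb)) a (score a).val
  simp only [argmin, Timed.cost_bind]
  rw [Nat.succ_mul]
  omega

end CostLe

/-! ### Step counts of the reduction. -/

section Costs

variable {X S : Type} {ιX : Bool → X} {ιS : Bool → S} {Φ : Set (X → S)} {φ : X → S}
  {O : RLOracle X} {N K : ℝ → ℝ → ℕ → ℕ → ℕ} {p : PMF (S × S)} {q₁ q₂ : S → PMF X}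
  {f : S → S → ℝ} {xbar : X}

theorem playedValue_cost {A : ℕ} (η : ℝ) (π : Policy X A) (x : X) :
    (playedValue η π x).cost = A := rfl

/-- Seven steps per sample: the query to continue, reading the first observation, its action, at
most three for the second observation, and its action. One last query remains when the samples run
out. -/
theorem costLe_simulate {A : ℕ} {δ : Type} (L : Learner X A) (fst : δ → X)
    {snd : δ → Fin A → Comp X} (hsnd : ∀ d a, CostLe (snd d a) 3 fun _ => True) (l : List δ)
    (hist : List (Traj X A)) :
    CostLe (simulate L fst snd l hist) (7 * l.length + 1) fun _ => True := by
  induction l generalizing hist with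
  | nil => exact (costLe_ask _).mono (by simp) fun _ _ => trivial
  | cons d l ih =>
    refine (costLe_ask _).bind (b₂ := 7 * l.length + 7) (fun o _ => ?_)
      (by simp only [List.length_cons]; omega)
    cases o with
    | some Ψ => exact costLe_pure trivial
    | none =>
      refine (costLe_lift (b := 1) (Q := fun _ => True) le_rfl trivial).bind
        (b₂ := 7 * l.length + 6) (fun x₁ _ => ?_) (by omega)
      refine (costLe_ask _).bind (b₂ := 7 * l.length + 5) (fun a₁ _ => ?_) (by omega)
      refine (hsnd d a₁).bind (b₂ := 7 * l.length + 2) (fun x₂ _ => ?_) (by omega)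
      exact (costLe_ask _).bind (b₂ := 7 * l.length + 1) (fun a₂ _ => ih _) (by omega)

theorem sumSqErr_cost_le {R : Predictor1 X} {c : ℕ} (hR : ∀ x, (R x).cost ≤ c)
    (l : List (X × Bool)) : (sumSqErr R l).cost ≤ l.length * (c + 2) + 1 := by
  induction l with
  | nil => simp [sumSqErr]
  | cons d l ih =>
    have := hR d.1
    simp only [sumSqErr, sqErr, Timed.cost_bind, cost_op, List.length_cons]
    rw [Nat.succ_mul]
    omega

theorem costLe_oneSnd (zero one : X) (η : ℝ) (d : X × Bool) (a : Fin (gridSize η)) :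
    CostLe (oneSnd zero one η d a) 3 fun _ => True := by
  refine (costLe_lift (b := 1) (Q := fun _ => True) le_rfl trivial).bind (b₂ := 2)
    (fun q _ => ?_) le_rfl
  exact (costLe_ask _).bind (b₂ := 1) (fun b _ => costLe_lift le_rfl trivial) le_rfl

theorem costLe_twoSnd (zero : X) (η : ℝ) (d : X × X × Bool) (a : Fin (gridSize η)) :
    CostLe (twoSnd zero η d a) 3 fun _ => True := by
  refine (costLe_lift (b := 1) (Q := fun _ => True) le_rfl trivial).bind (b₂ := 2)
    (fun q _ => ?_) le_rfl
  exact (costLe_ask _).bind (b₂ := 1) (fun b _ => costLe_lift le_rfl trivial) le_rfl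

/-- The product term comes from scoring at most `k` policies on at most `data.length` test samples,
each evaluation reading at most `g` action probabilities. -/
theorem costLe_oneRed {zero one : X} {data : List (X × Bool)} {ε δ : ℝ} {k g : ℕ}
    (hk : ∀ Ψ, some Ψ ∈ (simulate (O (ε / 4) (δ / 2) 2 (gridSize (Real.sqrt (ε / 4)))) Prod.fst
      (oneSnd zero one (Real.sqrt (ε / 4))) data []).law.support → Ψ.length ≤ k)
    (hg : gridSize (Real.sqrt (ε / 4)) ≤ g) :
    CostLe (oneRed O zero one data ε δ) ((data.length + 1) * (8 + k * (g + 4)))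
      fun R => ∀ x, (R x).cost ≤ g := by
  have hg1 : 1 ≤ g := le_trans (Nat.succ_le_succ (Nat.zero_le _)) hg
  set n := data.length with hn
  refine (costLe_lift (b := 1) (Q := fun η => η = Real.sqrt (ε / 4)) le_rfl rfl).bind
    (b₂ := 7 * n + 1 + (n + 1 + k * (n * (g + 2) + 4)))
    (fun η hη => ?_) ?_
  swap
  · nlinarith [Nat.zero_le (n * k), Nat.zero_le (n * g), Nat.zero_le (k * g)]
  subst hη
  refine (costLe_simulate _ Prod.fst (costLe_oneSnd zero one _) data []).and_mem_support.bind
    (b₂ := n + 1 + k * (n * (g + 2) + 4)) (fun o ho => ?_) (by omega)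
  match o, ho with
  | none, _ => exact costLe_pure fun x => by simpa using hg1
  | some [], _ => exact costLe_pure fun x => by simpa using hg1
  | some (π₀ :: Ψ), ho =>
    have hlen : Ψ.length + 1 ≤ k := hk _ ho.2
    refine (costLe_lift (b := Ψ.length + 1) (Q := fun _ => True) le_rfl trivial).bind
      (b₂ := n + 1 + (Ψ.length + 1) * (n * (g + 2) + 3)) (fun _ _ => ?_) ?_
    swap
    · have := Nat.mul_le_mul_right (n * (g + 2) + 4) hlen
      nlinarith
    refine (costLe_lift (b := 1) (Q := fun _ => True) le_rfl trivial).bind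
      (b₂ := n + (Ψ.length + 1) * (n * (g + 2) + 3)) (fun m _ => ?_) (by omega)
    refine (costLe_lift (b := n) (Q := fun _ => True) le_rfl trivial).bind
      (b₂ := (Ψ.length + 1) * (n * (g + 2) + 3)) (fun _ _ => ?_) (by omega)
    refine (costLe_lift (b := (Ψ.length + 1) * (n * (g + 2) + 3)) (Q := fun _ => True) ?_
      trivial).bind (b₂ := 0) (fun π _ => costLe_pure fun x => hg) le_rfl
    refine argmin_cost_le (c := n * (g + 2) + 2) fun π _ => ?_
    have h1 := sumSqErr_cost_le (R := playedValue (Real.sqrt (ε / 4)) π) (c := g) (fun x => hg)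
      (data.drop (data.length - m))
    have h2 : (data.drop (data.length - m)).length ≤ n := by simp [hn]
    have h3 := Nat.mul_le_mul_right (g + 2) h2
    simp only [Timed.cost_bind, cost_op]
    omega

theorem costLe_relabel {R : Predictor1 X} {c : ℕ} {d : X × X × Bool} (hR : ∀ x, (R x).cost ≤ c) :
    CostLe (relabel R d) (c + 2) fun _ => True := by
  refine (costLe_lift (b := c) (Q := fun _ => True) (hR _) trivial).bind (b₂ := 2)
    (fun v _ => ?_) le_rfl
  refine (costLe_lift (b := 1) (Q := fun _ => True) le_rfl trivial).bind (b₂ := 1)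
    (fun v _ => ?_) le_rfl
  exact (costLe_ask _).bind (b₂ := 0) (fun _ _ => costLe_pure trivial) le_rfl

/-- The relabeled samples lie in the support of a `labelLaw` of a one-context problem decoded by
`φ`, by `bind_relabel`. Hence `Simulates.length_le` bounds the inner cover almost surely, even when
the samples are too few for accuracy. -/
theorem costLe_twoFit (hreg : IsRegular ιX ιS Φ) (hO : IsEfficientRL Φ O N K) (hφ : φ ∈ Φ)
    (hdec : Decodes φ p q₁ q₂) (hf : ∀ s t, f s t ∈ Set.Icc (0 : ℝ) 1) {η : ℝ} (hη : 0 ≤ η)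
    {ε δ : ℝ} (hε : ε ∈ Set.Ioo (0 : ℝ) (1 / 2)) (hδ : δ ∈ Set.Ioo (0 : ℝ) (1 / 2))
    {half : List (X × X × Bool)}
    (hhalf : ∀ d ∈ half, d ∈ (sampleLaw φ (pairLaw p q₁ q₂) f).support)
    (π : Policy X (gridSize η)) {k g g' : ℕ} (hg : gridSize η ≤ g)
    (hk : K (ε / 4) (δ / 2) 2 (gridSize (Real.sqrt (ε / 4))) ≤ k)
    (hg' : gridSize (Real.sqrt (ε / 4)) ≤ g') :
    CostLe (twoFit O (ιX false) (ιX true) η ε δ half π)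
      ((half.length + 1) * (g + 10 + k * (g' + 4))) fun q => q.1 = π ∧ ∀ x, (q.2 x).cost ≤ g' := by
  have hpv : ∀ x, (playedValue η π x).val ∈ Set.Icc (0 : ℝ) 1 := fun x => playedValue_mem hη _ _
  refine (costLe_forEach (b := g + 2) fun d hd =>
    ((costLe_relabel (R := playedValue η π) (c := g) fun x => hg).and_mem_support.mono le_rfl
      fun c hc => ?_ : CostLe (relabel (playedValue η π) d) (g + 2)
        fun c => c ∈ (labelLaw ((pairLaw p q₁ q₂).map Prod.snd) fun x =>
          condLoss p q₁ f (fun x => (playedValue η π x).val) (φ x)).support)).bind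
    (b₂ := (half.length + 1) * (8 + k * (g' + 4))) (fun c hc => ?_) ?_
  · rw [← bind_relabel hdec hf hpv, PMF.mem_support_bind_iff]
    exact ⟨d, hhalf d hd, hc.2⟩
  · refine ((costLe_oneRed (O := O) (zero := ιX false) (one := ιX true) (data := c) (ε := ε)
      (δ := δ) (k := k) (g := g') (fun Ψ hΨ => ?_) hg').mono
        (b' := (half.length + 1) * (8 + k * (g' + 4))) (by rw [hc.1])
      fun R hR => hR).bind (b₂ := 0) (fun R hR => costLe_pure ⟨rfl, hR⟩) le_rfl
    refine ((simulates_oneMDP hreg.2.1 _ (g := condLoss p q₁ f fun x => (playedValue η π x).val)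
      (condLoss_mem hpv hf) (Real.sqrt_nonneg _)).length_le hO ⟨by linarith [hε.1], by
        linarith [hε.2]⟩ ⟨by linarith [hδ.1], by linarith [hδ.2]⟩ hφ
        (oneMDP_decodedBy (hreg.2.2 φ hφ).1 _ _ _) hc.2 hΨ).trans hk
  · nlinarith [Nat.zero_le g, Nat.zero_le half.length]

theorem twoPick_cost_le {A g g' k : ℕ} (η : ℝ) (hA : A ≤ g)
    {l : List (Policy X A × Predictor1 X)} (hl : l.length ≤ k)
    (h : ∀ q ∈ l, ∀ x, (q.2 x).cost ≤ g') (x y : X) :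
    (twoPick η l x y).cost ≤ 1 + k * (g' + 1) + g := by
  cases l with
  | nil => simp only [twoPick, cost_op]; omega
  | cons q l =>
    have h1 := argmin_cost_le (score := fun q : Policy X A × Predictor1 X => q.2 y) (c := g')
      (a := q) (l := l) fun b hb => h b hb y
    have h2 := Nat.mul_le_mul_right (g' + 1) hl
    simp only [List.length_cons] at h2
    simp only [twoPick, Timed.cost_bind, playedValue_cost]
    omega

/-- The constants `k, g, k', g'` bound the sizes of the covers and of the action grids in the outer
and in the inner simulations of `twoRed`. -/
structure TwoRedBounds (K : ℝ → ℝ → ℕ → ℕ → ℕ) (σ : ℕ) (ε δ : ℝ) (k g k' g' : ℕ) : Prop where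
  cover : coverSize K σ ε δ ≤ k
  grid : gridSize (ε / (2 * (σ : ℝ))) ≤ g
  innerCover : ∀ l : ℕ, 1 ≤ l → l ≤ k → K (ε ^ 4 / (16 * (σ : ℝ) ^ 4 * (l : ℝ)) / 4)
    (δ / (2 * (l : ℝ)) / 2) 2
      (gridSize (Real.sqrt (ε ^ 4 / (16 * (σ : ℝ) ^ 4 * (l : ℝ)) / 4))) ≤ k'
  innerGrid : ∀ l : ℕ, 1 ≤ l → l ≤ k →
    gridSize (Real.sqrt (ε ^ 4 / (16 * (σ : ℝ) ^ 4 * (l : ℝ)) / 4)) ≤ g'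

theorem costLe_twoRed (hreg : IsRegular ιX ιS Φ) (hO : IsEfficientRL Φ O N K) (hφ : φ ∈ Φ)
    (hdec : Decodes φ p q₁ q₂) (hns : ∀ st ∈ p.support, st.2 ∉ Set.range ιS)
    (hf : ∀ s t, f s t ∈ Set.Icc (0 : ℝ) 1) {ε δ : ℝ} (hε : ε ∈ Set.Ioo (0 : ℝ) (1 / 2))
    (hδ : δ ∈ Set.Ioo (0 : ℝ) (1 / 2)) {σ : ℕ} (hσ : 1 ≤ σ) {k g k' g' : ℕ}
    (hb : TwoRedBounds K σ ε δ k g k' g') {data : List (X × X × Bool)}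
    (hdata : ∀ d ∈ data, d ∈ (sampleLaw φ (pairLaw p q₁ q₂) f).support) :
    CostLe (twoRed O (ιX false) (ιX true) σ data ε δ)
      ((data.length + 1) * (8 + k * (g + 11 + k' * (g' + 4))))
      fun R => ∀ x y, (R x y).cost ≤ 1 + k * (g' + 1) + g := by
  have hσ' : (1 : ℝ) ≤ σ := by exact_mod_cast hσ
  obtain ⟨hε0, hε1⟩ := hε
  obtain ⟨hδ0, hδ1⟩ := hδ
  have hη : 0 ≤ ε / (2 * (σ : ℝ)) := by positivity
  have hεo : ε ^ 2 / (4 * (σ : ℝ) ^ 2) ∈ Set.Ioo (0 : ℝ) (1 / 2) := by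
    refine ⟨by positivity, ?_⟩
    rw [div_lt_iff₀ (by positivity)]
    nlinarith
  set n := data.length with hn
  set B := k * (n + 1) * (g + 10 + k' * (g' + 4)) with hB
  refine (costLe_lift (b := 1) (Q := fun η => η = ε / (2 * (σ : ℝ))) le_rfl rfl).bind
    (b₂ := n + (7 * n + 1) + (k + 2 + B)) (fun η hη => ?_) ?_
  swap
  · rw [hB]
    nlinarith [Nat.zero_le (n * k)]
  subst hη
  refine (costLe_lift (b := n) (Q := fun _ => True) le_rfl trivial).bind
    (b₂ := (7 * n + 1) + (k + 2 + B)) (fun _ _ => ?_) (by omega)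
  have htake : ∀ d ∈ data.take (n / 2), d ∈ (sampleLaw φ (pairLaw p q₁ q₂) f).support :=
    fun d hd => hdata d (List.mem_of_mem_take hd)
  refine ((costLe_simulate (O (ε ^ 2 / (4 * (σ : ℝ) ^ 2)) (δ / 2) 2
    (gridSize (ε / (2 * (σ : ℝ))))) (fun d => d.1) (costLe_twoSnd (ιX false)
      (ε / (2 * (σ : ℝ)))) (data.take (n / 2)) []).and_mem_support.mono (b' := 7 * n + 1) (by
        simp only [List.length_take]; omega) fun _ h => h).bind
    (b₂ := k + 2 + B) (fun o ho => ?_) (by omega)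
  match o, ho with
  | none, _ => exact costLe_pure fun x y => by simp only [cost_op]; omega
  | some Ψ, ho =>
    have hlen : Ψ.length ≤ k := ((simulates_twoMDP hdec hns hf hη).length_le hO hεo
      ⟨by linarith, by linarith⟩ hφ (twoMDP_decodedBy (hreg.2.2 φ hφ).1 hdec _ _) htake
        ho.2).trans hb.cover
    refine (costLe_lift (b := k) (Q := fun _ => True) hlen trivial).bind
      (b₂ := 2 + B) (fun _ _ => ?_) (by omega)
    refine (costLe_lift (b := 1) (Q := fun e => e = ε ^ 4 / (16 * (σ : ℝ) ^ 4 * (Ψ.length : ℝ)))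
      le_rfl rfl).bind (b₂ := 1 + B) (fun ε₁ hε₁ => ?_) (by omega)
    subst hε₁
    refine (costLe_lift (b := 1) (Q := fun e => e = δ / (2 * (Ψ.length : ℝ)))
      le_rfl rfl).bind (b₂ := B) (fun δ₁ hδ₁ => ?_) (by omega)
    subst hδ₁
    have hfit : ∀ π ∈ Ψ, CostLe (twoFit O (ιX false) (ιX true) (ε / (2 * (σ : ℝ)))
        (ε ^ 4 / (16 * (σ : ℝ) ^ 4 * (Ψ.length : ℝ))) (δ / (2 * (Ψ.length : ℝ)))
        (data.drop (n / 2)) π) ((n + 1) * (g + 10 + k' * (g' + 4)))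
        fun q => ∀ x, (q.2 x).cost ≤ g' := by
      intro π hπ
      have hl1 : 1 ≤ Ψ.length := List.length_pos_of_mem hπ
      have hl1' : (1 : ℝ) ≤ Ψ.length := by exact_mod_cast hl1
      refine (costLe_twoFit hreg hO hφ hdec hf hη ⟨by positivity, ?_⟩ ⟨by positivity, ?_⟩
        (fun d hd => hdata d (List.mem_of_mem_drop hd)) π hb.grid
        (hb.innerCover _ hl1 hlen) (hb.innerGrid _ hl1 hlen)).mono ?_ fun q hq => hq.2
      · rw [div_lt_iff₀ (by positivity)]
        have h1 : 1 ≤ (σ : ℝ) ^ 4 * (Ψ.length : ℝ) :=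
          one_le_mul_of_one_le_of_one_le (one_le_pow₀ hσ') hl1'
        have h2 : ε ^ 4 < 1 := pow_lt_one₀ hε0.le (by linarith) (by norm_num)
        linarith
      · rw [div_lt_iff₀ (by positivity)]
        linarith
      · refine Nat.mul_le_mul_right _ ?_
        simp only [List.length_drop]
        omega
    refine ((costLe_forEach hfit).mono (b' := B) ?_ fun l hl => hl).bind (b₂ := 0)
      (fun l hl => ?_) le_rfl
    · rw [hB, Nat.mul_assoc]
      exact Nat.mul_le_mul_right _ hlen
    · have hpick := twoPick_cost_le (ε / (2 * (σ : ℝ))) hb.grid (hl.1.trans_le hlen) hl.2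
      cases l with
      | nil => exact costLe_pure hpick
      | cons q l => exact costLe_pure hpick

theorem kind_cost_le (x : X) : (kind ιX x).cost ≤ 2 :=
  Nat.add_le_add_left (cost_ite_le (b := 1) (Nat.zero_le _)
    (Nat.add_le_add_left (cost_ite_le (b := 0) le_rfl le_rfl) 1)) 1

theorem select_cost_le (r : Option Bool × Option Bool) (l : List (X × X × Bool)) :
    (select ιX xbar r l).cost ≤ 5 * l.length := by
  induction l with
  | nil => simp [select]
  | cons d l ih =>
    have h1 := kind_cost_le (ιX := ιX) d.1
    have h2 := kind_cost_le (ιX := ιX) d.2.1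
    simp only [select, Timed.cost_bind, cost_op, List.length_cons]
    split_ifs
    all_goals simp only [Timed.cost_pure]
    all_goals omega

theorem sumLabels_cost (l : List (X × X × Bool)) : (sumLabels l).cost = l.length + 1 := by
  induction l with
  | nil => rfl
  | cons d l ih => simp [sumLabels, ih]

/-- Test `expect_toRegion` against the indicator of `d'`. Positivity of the left side makes both
factors on the right positive. -/
theorem mem_support_of_toRegion (hreg : IsRegular ιX ιS Φ) (hφ : φ ∈ Φ)
    (hdec : Decodes φ p q₁ q₂) {r : Option Bool × Option Bool} {d d' : X × X × Bool}
    (hd : d ∈ (sampleLaw φ (pairLaw p q₁ q₂) f).support) (h : toRegion ιX xbar r d = some d') :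
    regionProb ιS r p ≠ 0 ∧ d' ∈ (sampleLaw φ (regionLaw ιS (φ xbar) xbar r p q₁ q₂)
      fun s t => f (origState ιS r.1 s) (origState ιS r.2 t)).support := by
  classical
  have key := expect_toRegion (xbar := xbar) hreg hφ hdec f r fun e => if e = d' then 1 else 0
  have hne : expect (sampleLaw φ (pairLaw p q₁ q₂) f) (fun d =>
      (toRegion ιX xbar r d).elim 0 fun e => if e = d' then 1 else 0) ≠ 0 := by
    intro h0
    have := expect_eq_zero h0 d hd
    simp [h] at this
  rw [key] at hne
  refine ⟨left_ne_zero_of_mul hne, ?_⟩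
  by_contra hno
  refine right_ne_zero_of_mul hne (le_antisymm (expect_le_of_le fun e he => ?_) zero_le)
  rw [if_neg]
  rintro rfl
  exact hno he

theorem costLe_fitSub [Fintype S] (hreg : IsRegular ιX ιS Φ) (hO : IsEfficientRL Φ O N K)
    (hφ : φ ∈ Φ) (hdec : Decodes φ p q₁ q₂)
    (hxbar : (∃ x, x ∉ Set.range ιX) → xbar ∉ Set.range ιX)
    (hf : ∀ s t, f s t ∈ Set.Icc (0 : ℝ) 1) {ε δ : ℝ} (hε : ε ∈ Set.Ioo (0 : ℝ) (1 / 2))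
    (hδ : δ ∈ Set.Ioo (0 : ℝ) (1 / 2)) {k g k' g' : ℕ}
    (hb : 1 ≤ Fintype.card S - 2 →
      TwoRedBounds K (Fintype.card S - 2) (ε / 2) (δ / 18) k g k' g')
    (r : Option Bool × Option Bool) {data : List (X × X × Bool)}
    (hdata : ∀ d ∈ data, d ∈ (sampleLaw φ (pairLaw p q₁ q₂) f).support) :
    CostLe (fitSub (twoRed O (ιX false) (ιX true) (Fintype.card S - 2)) ε δ r
        (data.filterMap (toRegion ιX xbar r)))
      ((data.length + 1) * (8 + k * (g + 11 + k' * (g' + 4))))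
      fun R => ∀ x y, (R x y).cost ≤ 1 + k * (g' + 1) + g := by
  have hlen := List.length_filterMap_le (toRegion ιX xbar r) data
  have hmem : ∀ d' ∈ data.filterMap (toRegion ιX xbar r), regionProb ιS r p ≠ 0 ∧
      d' ∈ (sampleLaw φ (regionLaw ιS (φ xbar) xbar r p q₁ q₂)
        fun s t => f (origState ιS r.1 s) (origState ιS r.2 t)).support := by
    intro d' hd'
    obtain ⟨d, hd, h⟩ := List.mem_filterMap.1 hd'
    exact mem_support_of_toRegion hreg hφ hdec (hdata d hd) h
  -- From here on only the length and the support of the subsample matter.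
  revert hlen hmem
  generalize data.filterMap (toRegion ιX xbar r) = sub
  intro hlen hmem
  cases sub with
  | nil => exact costLe_pure fun x y => by simp only [cost_op]; omega
  | cons d l =>
    unfold fitSub
    split_ifs with hbase
    · simp only [List.length_cons] at hlen
      refine (costLe_lift (b := l.length + 2) (Q := fun _ => True)
        (sumLabels_cost (d :: l)).le trivial).bind (b₂ := l.length + 2) (fun _ _ => ?_) ?_
      swap
      · nlinarith [Nat.zero_le ((data.length + 1) * (k * (g + 11 + k' * (g' + 4))))]
      refine (costLe_lift (b := l.length + 1) (Q := fun _ => True) le_rfl trivial).bind (b₂ := 1)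
        (fun _ _ => ?_) le_rfl
      refine (costLe_lift (b := 1) (Q := fun _ => True) le_rfl trivial).bind (b₂ := 0)
        (fun v _ => costLe_pure fun x y => ?_) le_rfl
      simp only [cost_op]
      omega
    -- The subsample is nonempty, so the region has positive probability and its law meets the
    -- hypotheses of `costLe_twoRed`.
    · have hr := (hmem d (by simp)).1
      have hns := notMem_range_of_region hreg hφ hdec hxbar hr (by simpa using hbase)
      have hσ := one_le_card_sub_two hreg.2.1 hns
      exact (costLe_twoRed hreg hO hφ (decodes_region hdec hr) hns (fun s t => hf _ _)
        ⟨by linarith [hε.1], by linarith [hε.2]⟩ ⟨by linarith [hδ.1], by linarith [hδ.2]⟩ hσ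
        (hb hσ) fun d hd => (hmem d hd).2).mono (Nat.mul_le_mul_right _ (by omega))
          fun R hR => hR

/-- In the constants, `13 = 8 + 5` accounts for selecting the samples of a region at five steps
each, `9` for the regions, and `14 = 1 + 2 + 2 + 9` for determining two kinds and searching the
table. -/
theorem runsInTime_regToRL [Fintype S] (hreg : IsRegular ιX ιS Φ) (hO : IsEfficientRL Φ O N K)
    (hxbar : (∃ x, x ∉ Set.range ιX) → xbar ∉ Set.range ιX) {T : ℕ → ℝ → ℝ → ℝ} {E : ℝ → ℝ → ℝ}
    (h : ∀ ε ∈ Set.Ioo (0 : ℝ) (1 / 2), ∀ δ ∈ Set.Ioo (0 : ℝ) (1 / 2), ∃ k g k' g' : ℕ,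
      (1 ≤ Fintype.card S - 2 →
        TwoRedBounds K (Fintype.card S - 2) (ε / 2) (δ / 18) k g k' g') ∧
      (∀ n : ℕ, ((9 * ((n + 1) * (13 + k * (g + 11 + k' * (g' + 4)))) : ℕ) : ℝ) ≤ T n ε δ) ∧
      ((14 + k * (g' + 1) + g : ℕ) : ℝ) ≤ E ε δ) :
    RunsInTime Φ (regToRL O ιX xbar (Fintype.card S)) T E := by
  intro ε hε δ hδ n φ hφ D hD f hf o ho
  obtain ⟨p, q₁, q₂, rfl, hdec⟩ := hD.exists_pairLaw
  obtain ⟨k, g, k', g', hb, hT, hE⟩ := h ε hε δ hδ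
  rw [regressionLaw, PMF.mem_support_bind_iff] at ho
  obtain ⟨data, hdata, ho⟩ := ho
  obtain ⟨hlen, hdata⟩ := mem_support_iid.1 hdata
  rw [regToRL, twoAug_eq] at ho
  have hentry : ∀ r ∈ regions, CostLe (fitEntry (twoRed O (ιX false) (ιX true)
      (Fintype.card S - 2)) ιX xbar data ε δ r)
      ((n + 1) * (13 + k * (g + 11 + k' * (g' + 4))))
      fun q => ∀ x y, (q.2 x y).cost ≤ 1 + k * (g' + 1) + g := by
    intro r _
    unfold fitEntry
    rw [fitRegion_eq]
    refine CostLe.bind (b₂ := 0) (CostLe.bind (costLe_lift (b := 5 * n)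
      (Q := fun s => s = data.filterMap (toRegion ιX xbar r)) ?_ (select_val _ _))
        (b₂ := (n + 1) * (8 + k * (g + 11 + k' * (g' + 4)))) (fun sub hsub => ?_) le_rfl)
        (fun R hR => costLe_pure hR) ?_
    · rw [← hlen]
      exact select_cost_le _ _
    · rw [hsub, ← hlen]
      exact costLe_fitSub hreg hO hφ hdec hxbar hf hε hδ hb r hdata
    · nlinarith [Nat.zero_le n]
  have hcost : CostLe (forEach (fitEntry (twoRed O (ιX false) (ιX true) (Fintype.card S - 2)) ιX
      xbar data ε δ) regions >>= fun table => pure (augPick ιX xbar table))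
      (9 * ((n + 1) * (13 + k * (g + 11 + k' * (g' + 4)))))
      fun R => ∀ x y, (R x y).cost ≤ 14 + k * (g' + 1) + g := by
    refine (costLe_forEach hentry).bind (b₂ := 0) (fun table ht => costLe_pure fun x y => ?_)
      (le_of_eq rfl)
    have h1 := kind_cost_le (ιX := ιX) x
    have h2 := kind_cost_le (ιX := ιX) y
    simp only [augPick, Timed.cost_bind, cost_charge]
    split
    · simp only [cost_op]
      omega
    · rename_i q hq
      have := ht.2 q (List.mem_of_find?_eq_some hq) (toBase xbar (kind ιX x).val x)
        (toBase xbar (kind ιX y).val y)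
      omega
  obtain ⟨h1, h2⟩ := hcost o ho
  refine ⟨le_trans (by exact_mod_cast h1) (hT n), fun x y => le_trans ?_ hE⟩
  exact_mod_cast h2 x y

end Costs

/-! ## Polynomial bounds -/

section Bounds

theorem one_le_gridSize (η : ℝ) : 1 ≤ gridSize η := Nat.succ_pos _

theorem gridSize_le_inv_add_one {η : ℝ} (hη : 0 < η) : (gridSize η : ℝ) ≤ η⁻¹ + 1 := by
  unfold gridSize
  push_cast
  have := Nat.floor_le (one_div_pos.2 hη).le
  rw [one_div] at this ⊢
  linarith

theorem gridSize_sqrt_le {x : ℝ} (hx : 0 < x) (hx1 : x ≤ 1) :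
    (gridSize (Real.sqrt x) : ℝ) ≤ x⁻¹ + 1 := by
  refine (gridSize_le_inv_add_one (Real.sqrt_pos.2 hx)).trans ?_
  have : x ≤ Real.sqrt x := Real.le_sqrt_of_sq_le (by nlinarith)
  gcongr

variable {b s ε δ K₀ N₀ cN cK : ℝ} {σ : ℕ} {N K : ℝ → ℝ → ℕ → ℕ → ℕ}

/-- `b` bounds the parameters of the two-context problem. -/
structure ParamBound (b s ε δ K₀ : ℝ) (σ : ℕ) : Prop where
  eight_le : 8 ≤ b
  eps : ε ∈ Set.Ioo (0 : ℝ) (1 / 2)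
  del : δ ∈ Set.Ioo (0 : ℝ) (1 / 2)
  inv_eps : ε⁻¹ ≤ b
  inv_del : δ⁻¹ ≤ b
  s_nonneg : 0 ≤ s
  s_le : s ≤ b
  one_le_σ : 1 ≤ σ
  σ_le : (σ : ℝ) ≤ b
  K₀_le : K₀ ≤ b

/-- The oracle is polynomially efficient. -/
def PolyBounded (N K : ℝ → ℝ → ℕ → ℕ → ℕ) (N₀ K₀ cN cK s : ℝ) : Prop :=
  ∀ ε ∈ Set.Ioo (0 : ℝ) (1 / 2), ∀ δ ∈ Set.Ioo (0 : ℝ) (1 / 2), ∀ H A : ℕ, 1 ≤ H → 1 ≤ A →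
    (N ε δ H A : ℝ) ≤ N₀ * ((H * A * s : ℝ) / (ε * δ)) ^ cN ∧
    (K ε δ H A : ℝ) ≤ K₀ * ((H * A * s : ℝ) / (ε * δ)) ^ cK

namespace ParamBound

theorem outer_eps_mem (h : ParamBound b s ε δ K₀ σ) :
    ε ^ 2 / (4 * (σ : ℝ) ^ 2) ∈ Set.Ioo (0 : ℝ) (1 / 2) := by
  have hσ : (1 : ℝ) ≤ σ := by exact_mod_cast h.one_le_σ
  have h0 := h.eps.1
  have h1 := h.eps.2
  refine ⟨by positivity, ?_⟩
  rw [div_lt_iff₀ (by positivity)]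
  nlinarith

theorem half_del_mem (h : ParamBound b s ε δ K₀ σ) : δ / 2 ∈ Set.Ioo (0 : ℝ) (1 / 2) :=
  ⟨by linarith [h.del.1], by linarith [h.del.1, h.del.2]⟩

theorem outer_grid_le (h : ParamBound b s ε δ K₀ σ) :
    (gridSize (ε / (2 * (σ : ℝ))) : ℝ) ≤ b ^ 3 := by
  have hσ : (1 : ℝ) ≤ σ := by exact_mod_cast h.one_le_σ
  have h0 := h.eps.1
  have hb := h.eight_le
  have hi := inv_pos.2 h0
  have hbσ := h.σ_le
  have hbe := h.inv_eps
  refine (gridSize_le_inv_add_one (by positivity)).trans ?_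
  calc (ε / (2 * (σ : ℝ)))⁻¹ + 1 = 2 * σ * ε⁻¹ + 1 := by rw [inv_div, div_eq_mul_inv]
    _ ≤ 2 * b * b + 1 := by gcongr
    _ ≤ b ^ 3 := by nlinarith [mul_le_mul hb hb (by norm_num) (by linarith)]

/-- This is the argument of the oracle's polynomial bounds in the outer call. Numerical constants
are absorbed into powers of `b`, as `b ≥ 8`. -/
theorem outer_arg_le (h : ParamBound b s ε δ K₀ σ) :
    (2 : ℕ) * (gridSize (ε / (2 * (σ : ℝ))) : ℝ) * s / (ε ^ 2 / (4 * (σ : ℝ) ^ 2) * (δ / 2)) ≤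
      b ^ 12 := by
  have hσ : (1 : ℝ) ≤ σ := by exact_mod_cast h.one_le_σ
  have h0 := h.eps.1
  have hd0 := h.del.1
  have hb := h.eight_le
  have hi := inv_pos.2 h0
  have hid := inv_pos.2 hd0
  have hbσ := h.σ_le
  have hbe := h.inv_eps
  have hbd := h.inv_del
  have hg := h.outer_grid_le
  have hs := h.s_le
  have hs0 := h.s_nonneg
  calc _ = 16 * (gridSize (ε / (2 * (σ : ℝ))) : ℝ) * s * σ ^ 2 * ε⁻¹ ^ 2 * δ⁻¹ := by
        field_simp
        push_cast
        ring
    _ ≤ b ^ 2 * b ^ 3 * b * b ^ 2 * b ^ 2 * b := by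
        gcongr
        nlinarith
    _ = b ^ 11 * 1 := by ring
    _ ≤ b ^ 11 * b := by gcongr; linarith
    _ = b ^ 12 := by ring

variable {c : ℝ} {l : ℕ}

theorem inner_eps_mem (h : ParamBound b s ε δ K₀ σ) (hl : 1 ≤ l) :
    ε ^ 4 / (16 * (σ : ℝ) ^ 4 * (l : ℝ)) ∈ Set.Ioo (0 : ℝ) (1 / 2) := by
  have hσ : (1 : ℝ) ≤ σ := by exact_mod_cast h.one_le_σ
  have hl' : (1 : ℝ) ≤ l := by exact_mod_cast hl
  have h0 := h.eps.1
  refine ⟨by positivity, ?_⟩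
  rw [div_lt_iff₀ (by positivity)]
  have h1 : 1 ≤ (σ : ℝ) ^ 4 * (l : ℝ) :=
    one_le_mul_of_one_le_of_one_le (one_le_pow₀ hσ) hl'
  have h2 : ε ^ 4 < 1 := pow_lt_one₀ h0.le (by linarith [h.eps.2]) (by norm_num)
  linarith

theorem inner_del_mem (h : ParamBound b s ε δ K₀ σ) (hl : 1 ≤ l) :
    δ / (2 * (l : ℝ)) ∈ Set.Ioo (0 : ℝ) (1 / 2) := by
  have hl' : (1 : ℝ) ≤ l := by exact_mod_cast hl
  have h0 := h.del.1
  refine ⟨by positivity, ?_⟩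
  rw [div_lt_iff₀ (by positivity)]
  linarith [h.del.2]

theorem le_of_pow_le (h : ParamBound b s ε δ K₀ σ) (hc : b ^ 12 ≤ c) {j : ℕ} (hj : j ≤ 12) :
    b ^ j ≤ c :=
  (pow_le_pow_right₀ (by linarith [h.eight_le]) hj).trans hc

/-- The inner parameters involve the cover size `l` as well, so a second base `c` is used, which
dominates both `b ^ 12` and `l`. -/
theorem inner_inv_eps_le (h : ParamBound b s ε δ K₀ σ) (hc : b ^ 12 ≤ c) (hl : 1 ≤ l)
    (hlc : (l : ℝ) ≤ c) : (ε ^ 4 / (16 * (σ : ℝ) ^ 4 * (l : ℝ)) / 4)⁻¹ ≤ c ^ 2 := by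
  have hσ : (1 : ℝ) ≤ σ := by exact_mod_cast h.one_le_σ
  have hl' : (1 : ℝ) ≤ l := by exact_mod_cast hl
  have h0 := h.eps.1
  have hb := h.eight_le
  have hi := inv_pos.2 h0
  have hbσ := h.σ_le
  have hbe := h.inv_eps
  have hc0 : 0 ≤ c := by linarith
  calc _ = 64 * (σ : ℝ) ^ 4 * ε⁻¹ ^ 4 * l := by
        field_simp
        norm_num
    _ ≤ b ^ 2 * b ^ 4 * b ^ 4 * c := by
        gcongr
        nlinarith
    _ = b ^ 10 * c := by ring
    _ ≤ c * c := by
        gcongr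
        exact h.le_of_pow_le hc (by norm_num)
    _ = c ^ 2 := by ring

theorem inner_inv_del_le (h : ParamBound b s ε δ K₀ σ) (hc : b ^ 12 ≤ c) (hl : 1 ≤ l)
    (hlc : (l : ℝ) ≤ c) : (δ / (2 * (l : ℝ)) / 2)⁻¹ ≤ c ^ 2 := by
  have hl' : (1 : ℝ) ≤ l := by exact_mod_cast hl
  have h0 := h.del.1
  have hb := h.eight_le
  have hi := inv_pos.2 h0
  have hbd := h.inv_del
  have hc0 : 0 ≤ c := by linarith
  calc _ = 4 * δ⁻¹ * l := by
        field_simp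
        norm_num
    _ ≤ b * b * c := by
        gcongr
        linarith
    _ = b ^ 2 * c := by ring
    _ ≤ c * c := by
        gcongr
        exact h.le_of_pow_le hc (by norm_num)
    _ = c ^ 2 := by ring

theorem b_le (h : ParamBound b s ε δ K₀ σ) (hc : b ^ 12 ≤ c) : b ≤ c := by
  simpa using h.le_of_pow_le hc (j := 1) (by norm_num)

theorem inner_grid_le (h : ParamBound b s ε δ K₀ σ) (hc : b ^ 12 ≤ c) (hl : 1 ≤ l)
    (hlc : (l : ℝ) ≤ c) :
    (gridSize (Real.sqrt (ε ^ 4 / (16 * (σ : ℝ) ^ 4 * (l : ℝ)) / 4)) : ℝ) ≤ c ^ 3 := by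
  have hmem := h.inner_eps_mem hl
  have h8 := h.eight_le.trans (h.b_le hc)
  refine (gridSize_sqrt_le (by linarith [hmem.1]) (by linarith [hmem.1, hmem.2])).trans ?_
  have := h.inner_inv_eps_le hc hl hlc
  nlinarith [mul_le_mul h8 h8 (by norm_num) (by linarith)]

theorem inner_arg_le (h : ParamBound b s ε δ K₀ σ) (hc : b ^ 12 ≤ c) (hl : 1 ≤ l)
    (hlc : (l : ℝ) ≤ c) :
    (2 : ℕ) * (gridSize (Real.sqrt (ε ^ 4 / (16 * (σ : ℝ) ^ 4 * (l : ℝ)) / 4)) : ℝ) * s /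
      (ε ^ 4 / (16 * (σ : ℝ) ^ 4 * (l : ℝ)) / 4 * (δ / (2 * (l : ℝ)) / 2)) ≤ c ^ 8 := by
  have hbc := h.b_le hc
  have hb := h.eight_le
  have hs := h.s_le
  have hs0 := h.s_nonneg
  have hg := h.inner_grid_le hc hl hlc
  have he := h.inner_inv_eps_le hc hl hlc
  have hd := h.inner_inv_del_le hc hl hlc
  have hmem := (h.inner_eps_mem hl).1
  have hmem' := (h.inner_del_mem hl).1
  set e := ε ^ 4 / (16 * (σ : ℝ) ^ 4 * (l : ℝ))
  set d := δ / (2 * (l : ℝ))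
  have hi : 0 < (e / 4)⁻¹ := by positivity
  have hi' : 0 < (d / 2)⁻¹ := by positivity
  have h2 := h.le_of_pow_le hc (j := 2) (by norm_num)
  have hb0 : 0 ≤ b := by linarith
  have hc0 : 0 ≤ c := by linarith
  calc _ = 2 * s * (gridSize (Real.sqrt (e / 4)) : ℝ) * (e / 4)⁻¹ * (d / 2)⁻¹ := by
        push_cast
        field_simp
    _ ≤ b * b * c ^ 3 * c ^ 2 * c ^ 2 := by
        gcongr
        linarith
    _ = b ^ 2 * c ^ 7 := by ring
    _ ≤ c * c ^ 7 := by
        gcongr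
    _ = c ^ 8 := by ring

/-- The prefactor `K₀ ≤ b ^ 12` is absorbed by raising the exponent from `cK` to `1 + cK`. -/
theorem coverSize_le (h : ParamBound b s ε δ K₀ σ) (hP : PolyBounded N K N₀ K₀ cN cK s)
    (hcK : 0 ≤ cK) : (coverSize K σ ε δ : ℝ) ≤ (b ^ 12) ^ (1 + cK) := by
  have hb := h.eight_le
  have hu : b ≤ b ^ 12 := le_self_pow₀ (by linarith) (by norm_num)
  have harg := h.outer_arg_le
  refine (hP _ h.outer_eps_mem _ h.half_del_mem 2 _ (by norm_num) (one_le_gridSize _)).2.trans ?_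
  have h0 := h.outer_eps_mem.1
  have h0' := h.half_del_mem.1
  have hs := h.s_nonneg
  rw [Real.rpow_add (by positivity), Real.rpow_one]
  gcongr
  exact h.K₀_le.trans hu

theorem outer_N_le (h : ParamBound b s ε δ K₀ σ) (hP : PolyBounded N K N₀ K₀ cN cK s)
    (hN₀ : 0 ≤ N₀) (hcN : 0 ≤ cN) :
    (N (ε ^ 2 / (4 * (σ : ℝ) ^ 2)) (δ / 2) 2 (gridSize (ε / (2 * (σ : ℝ)))) : ℝ) ≤
      N₀ * (b ^ 12) ^ cN := by
  refine (hP _ h.outer_eps_mem _ h.half_del_mem 2 _ (by norm_num) (one_le_gridSize _)).1.trans ?_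
  have h0 := h.outer_eps_mem.1
  have h0' := h.half_del_mem.1
  have hs := h.s_nonneg
  have harg := h.outer_arg_le
  gcongr

theorem inner_quarter_mem (h : ParamBound b s ε δ K₀ σ) (hl : 1 ≤ l) :
    ε ^ 4 / (16 * (σ : ℝ) ^ 4 * (l : ℝ)) / 4 ∈ Set.Ioo (0 : ℝ) (1 / 2) := by
  have := h.inner_eps_mem hl
  exact ⟨by linarith [this.1], by linarith [this.1, this.2]⟩

theorem inner_half_mem (h : ParamBound b s ε δ K₀ σ) (hl : 1 ≤ l) :
    δ / (2 * (l : ℝ)) / 2 ∈ Set.Ioo (0 : ℝ) (1 / 2) := by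
  have := h.inner_del_mem hl
  exact ⟨by linarith [this.1], by linarith [this.1, this.2]⟩

theorem inner_K_le (h : ParamBound b s ε δ K₀ σ) (hP : PolyBounded N K N₀ K₀ cN cK s)
    (hcK : 0 ≤ cK) (hc : b ^ 12 ≤ c) (hl : 1 ≤ l) (hlc : (l : ℝ) ≤ c) :
    (K (ε ^ 4 / (16 * (σ : ℝ) ^ 4 * (l : ℝ)) / 4) (δ / (2 * (l : ℝ)) / 2) 2
      (gridSize (Real.sqrt (ε ^ 4 / (16 * (σ : ℝ) ^ 4 * (l : ℝ)) / 4))) : ℝ) ≤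
        (c ^ 8) ^ (1 + cK) := by
  have hb := h.eight_le
  have hbc := h.b_le hc
  have hu : c ≤ c ^ 8 := le_self_pow₀ (by linarith) (by norm_num)
  have harg := h.inner_arg_le hc hl hlc
  refine (hP _ (h.inner_quarter_mem hl) _ (h.inner_half_mem hl) 2 _ (by norm_num)
    (one_le_gridSize _)).2.trans ?_
  have h0 := (h.inner_eps_mem hl).1
  have h0' := (h.inner_del_mem hl).1
  have hs := h.s_nonneg
  have hc0 : 0 < c := by linarith
  rw [Real.rpow_add (by positivity), Real.rpow_one]
  gcongr
  exact h.K₀_le.trans (hbc.trans hu)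

theorem inner_N_le (h : ParamBound b s ε δ K₀ σ) (hP : PolyBounded N K N₀ K₀ cN cK s)
    (hN₀ : 0 ≤ N₀) (hcN : 0 ≤ cN) (hc : b ^ 12 ≤ c) (hl : 1 ≤ l) (hlc : (l : ℝ) ≤ c) :
    (N (ε ^ 4 / (16 * (σ : ℝ) ^ 4 * (l : ℝ)) / 4) (δ / (2 * (l : ℝ)) / 2) 2
      (gridSize (Real.sqrt (ε ^ 4 / (16 * (σ : ℝ) ^ 4 * (l : ℝ)) / 4))) : ℝ) ≤
        N₀ * (c ^ 8) ^ cN := by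
  have harg := h.inner_arg_le hc hl hlc
  refine (hP _ (h.inner_quarter_mem hl) _ (h.inner_half_mem hl) 2 _ (by norm_num)
    (one_le_gridSize _)).1.trans ?_
  have h0 := (h.inner_eps_mem hl).1
  have h0' := (h.inner_del_mem hl).1
  have hs := h.s_nonneg
  gcongr

/-- The number of test samples is polynomial. -/
theorem inner_test_le (h : ParamBound b s ε δ K₀ σ) (hc : b ^ 12 ≤ c)
    (hcK : 0 ≤ cK) (hca : 1 + cK ≤ c) (hl : 1 ≤ l) (hlc : (l : ℝ) ≤ c) {k : ℕ}
    (hk : (k : ℝ) ≤ (c ^ 8) ^ (1 + cK)) :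
    (⌈16 / (ε ^ 4 / (16 * (σ : ℝ) ^ 4 * (l : ℝ))) ^ 2 *
      Real.log (4 * (k : ℝ) / (δ / (2 * (l : ℝ))))⌉₊ : ℝ) ≤ c ^ 9 := by
  have hb := h.eight_le
  have hbc := h.b_le hc
  have h8 : 8 ≤ c := hb.trans hbc
  have hc0 : 0 < c := by linarith
  have he := h.inner_inv_eps_le hc hl hlc
  have hd := h.inner_inv_del_le hc hl hlc
  have h0 := (h.inner_eps_mem hl).1
  have h0' := (h.inner_del_mem hl).1
  set e := ε ^ 4 / (16 * (σ : ℝ) ^ 4 * (l : ℝ))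
  set d := δ / (2 * (l : ℝ))
  have hlog0 : 0 ≤ Real.log c := Real.log_nonneg (by linarith)
  have hlogc : Real.log c ≤ c := (Real.log_le_sub_one_of_pos hc0).trans (by linarith)
  have hlog : Real.log (4 * (k : ℝ) / d) ≤ c ^ 4 := by
    -- For `k = 0` the logarithm is `Real.log 0 = 0`.
    rcases Nat.eq_zero_or_pos k with rfl | hk0
    · simp only [Nat.cast_zero, mul_zero, zero_div, Real.log_zero]
      positivity
    have hk0' : (0 : ℝ) < k := by exact_mod_cast hk0
    have h1 : 4 * (k : ℝ) / d ≤ c ^ 3 * (c ^ 8) ^ (1 + cK) := by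
      calc 4 * (k : ℝ) / d = 2 * (d / 2)⁻¹ * k := by field_simp; norm_num
        _ ≤ c * c ^ 2 * (c ^ 8) ^ (1 + cK) := by
            gcongr
            linarith
        _ = _ := by ring
    calc Real.log (4 * (k : ℝ) / d) ≤ Real.log (c ^ 3 * (c ^ 8) ^ (1 + cK)) :=
          Real.log_le_log (by positivity) h1
      _ = (3 + 8 * (1 + cK)) * Real.log c := by
          rw [Real.log_mul (by positivity) (by positivity), Real.log_rpow (by positivity),
            Real.log_pow, Real.log_pow]
          push_cast
          ring
      _ ≤ (3 + 8 * c) * c := by gcongr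
      _ ≤ c ^ 4 := by nlinarith [mul_le_mul h8 h8 (by norm_num) hc0.le, sq_nonneg c]
  have hprod : 16 / e ^ 2 * Real.log (4 * (k : ℝ) / d) ≤ c ^ 8 := by
    calc 16 / e ^ 2 * Real.log (4 * (k : ℝ) / d) ≤ 16 / e ^ 2 * c ^ 4 := by gcongr
      _ = (e / 4)⁻¹ ^ 2 * c ^ 4 := by field_simp; norm_num
      _ ≤ (c ^ 2) ^ 2 * c ^ 4 := by gcongr
      _ = c ^ 8 := by ring
  calc _ ≤ ((⌈c ^ 8⌉₊ : ℕ) : ℝ) := by exact_mod_cast Nat.ceil_mono hprod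
    _ ≤ c ^ 8 + 1 := (Nat.ceil_lt_add_one (by positivity)).le
    _ ≤ c ^ 9 := by nlinarith [one_le_pow₀ (n := 8) (show 1 ≤ c by linarith)]

theorem le_base (h : ParamBound b s ε δ K₀ σ) (hcK : 0 ≤ cK) :
    b ^ 12 ≤ (b ^ 12) ^ (1 + cK) :=
  Real.self_le_rpow_of_one_le (one_le_pow₀ (by linarith [h.eight_le])) (by linarith)

/-- Bernoulli's inequality. It is needed because the logarithm of a cover size brings down the
factor `1 + cK`. -/
theorem exponent_le (h : ParamBound b s ε δ K₀ σ) (hcK : 0 ≤ cK) :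
    1 + cK ≤ (b ^ 12) ^ (1 + cK) := by
  have h2 : (2 : ℝ) ≤ b ^ 12 := by
    have := le_self_pow₀ (show 1 ≤ b by linarith [h.eight_le]) (show 12 ≠ 0 by norm_num)
    linarith [h.eight_le]
  have := one_add_mul_self_le_rpow_one_add (s := b ^ 12 - 1) (by linarith)
    (p := 1 + cK) (by linarith)
  rw [add_sub_cancel] at this
  nlinarith

theorem twoRedBounds (h : ParamBound b s ε δ K₀ σ) (hP : PolyBounded N K N₀ K₀ cN cK s)
    (hcK : 0 ≤ cK) (hc : c = (b ^ 12) ^ (1 + cK)) :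
    TwoRedBounds K σ ε δ ⌊c⌋₊ ⌊b ^ 3⌋₊ ⌊(c ^ 8) ^ (1 + cK)⌋₊ ⌊c ^ 3⌋₊ := by
  have hbc : b ^ 12 ≤ c := hc ▸ h.le_base hcK
  have hc0 : 0 ≤ c := by linarith [h.b_le hbc, h.eight_le]
  refine ⟨Nat.le_floor (hc ▸ h.coverSize_le hP hcK), Nat.le_floor h.outer_grid_le,
    fun l hl hlk => Nat.le_floor ?_, fun l hl hlk => Nat.le_floor ?_⟩
  · exact h.inner_K_le hP hcK hbc hl ((Nat.le_floor_iff hc0).1 hlk)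
  · exact h.inner_grid_le hbc hl ((Nat.le_floor_iff hc0).1 hlk)

/-- With `m = c ^ cN`, the inner oracle call costs `N₀ m⁸` and the test samples `c⁹ ≤ m⁹`. Each
merging of terms spends one more power of `m ≥ 8`. -/
theorem twoRedSamples_le (h : ParamBound b s ε δ K₀ σ) (hP : PolyBounded N K N₀ K₀ cN cK s)
    (hN₀ : 1 ≤ N₀) (hcN : 1 ≤ cN) (hcK : 0 ≤ cK) (hc : c = (b ^ 12) ^ (1 + cK)) :
    (twoRedSamples N K σ ε δ : ℝ) ≤ N₀ * (c ^ cN) ^ 11 := by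
  have hbc : b ^ 12 ≤ c := hc ▸ h.le_base hcK
  have h8 : 8 ≤ c := h.eight_le.trans (h.b_le hbc)
  have hb0 : 0 ≤ b := by linarith [h.eight_le]
  have hc0 : 0 ≤ c := by linarith
  have hN0 : 0 ≤ N₀ := by linarith
  have hcm : c ≤ c ^ cN := Real.self_le_rpow_of_one_le (by linarith) hcN
  set m := c ^ cN with hm
  have hm8 : 8 ≤ m := h8.trans hcm
  have houter := h.outer_N_le hP hN0 (by linarith)
  have houter' : N₀ * (b ^ 12) ^ cN ≤ N₀ * m := by
    rw [hm]
    gcongr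
  have hone : ∀ l : ℕ, 1 ≤ l → l ≤ coverSize K σ ε δ →
      (oneRedSamples N K (ε ^ 4 / (16 * (σ : ℝ) ^ 4 * (l : ℝ))) (δ / (2 * (l : ℝ))) : ℝ) ≤
        N₀ * m ^ 10 := by
    intro l hl hlk
    have hlc : (l : ℝ) ≤ c := by
      rw [hc]
      exact le_trans (by exact_mod_cast hlk) (h.coverSize_le hP hcK)
    have h1 := h.inner_N_le hP hN0 (by linarith) hbc hl hlc
    have h2 := h.inner_test_le hbc hcK (hc ▸ h.exponent_le hcK) hl hlc
      (h.inner_K_le hP hcK hbc hl hlc)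
    have h3 : (c ^ 8) ^ cN = m ^ 8 := by
      rw [hm, ← Real.rpow_natCast_mul hc0, ← Real.rpow_mul_natCast hc0, mul_comm]
    rw [h3] at h1
    unfold oneRedSamples
    push_cast
    have hm0 : 0 ≤ m := by linarith
    calc _ ≤ N₀ * m ^ 8 + c ^ 9 := add_le_add h1 h2
      _ ≤ N₀ * m ^ 9 + N₀ * m ^ 9 := by
          refine add_le_add ?_ ?_
          · gcongr
            · linarith
            · norm_num
          · calc c ^ 9 = 1 * c ^ 9 := (one_mul _).symm
              _ ≤ N₀ * m ^ 9 := by gcongr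
      _ = N₀ * (2 * m ^ 9) := by ring
      _ ≤ N₀ * (m * m ^ 9) := by gcongr; linarith
      _ = N₀ * m ^ 10 := by ring
  have hsup : (((Finset.Icc 1 (coverSize K σ ε δ)).sup fun k =>
      oneRedSamples N K (ε ^ 4 / (16 * (σ : ℝ) ^ 4 * (k : ℝ))) (δ / (2 * (k : ℝ))) : ℕ) : ℝ) ≤
        N₀ * m ^ 10 := by
    have hnn : 0 ≤ N₀ * m ^ 10 := by positivity
    refine le_trans (Nat.cast_le.2 ?_) (Nat.floor_le hnn)
    refine Finset.sup_le fun l hl => Nat.le_floor ?_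
    obtain ⟨hl1, hl2⟩ := Finset.mem_Icc.1 hl
    exact hone l hl1 hl2
  unfold twoRedSamples
  push_cast
  have hm0 : 0 ≤ m := by linarith
  calc _ ≤ 2 * (N₀ * m + N₀ * m ^ 10) := by
        gcongr
        exact houter.trans houter'
    _ ≤ 2 * (N₀ * m ^ 10 + N₀ * m ^ 10) := by
        gcongr
        exact le_self_pow₀ (by linarith) (by norm_num)
    _ = N₀ * (4 * m ^ 10) := by ring
    _ ≤ N₀ * (m * m ^ 10) := by gcongr; linarith
    _ = N₀ * m ^ 11 := by ring

end ParamBound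

end Bounds

/-! ### The final exponents. -/

section Polynomial

variable {X S : Type} {ιX : Bool → X} {ιS : Bool → S} {Φ : Set (X → S)} {O : RLOracle X}
  {N K : ℝ → ℝ → ℕ → ℕ → ℕ} {xbar : X} {N₀ K₀ cN cK s ε δ b : ℝ} {σ : ℕ}

theorem two_le_card [Fintype S] (hιS : Function.Injective ιS) : 2 ≤ Fintype.card S := by
  simpa using Fintype.card_le_of_injective ιS hιS

/-- The base of the polynomial bounds dominates all parameters. -/
theorem paramBound (hs : 2 ≤ s) (hσ : 1 ≤ σ) (hσs : (σ : ℝ) ≤ s) (hK₀ : 1 ≤ K₀)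
    (hε : ε ∈ Set.Ioo (0 : ℝ) (1 / 2)) (hδ : δ ∈ Set.Ioo (0 : ℝ) (1 / 2)) :
    8 ≤ K₀ * (s / (ε * δ)) ∧
      ParamBound ((K₀ * (s / (ε * δ))) ^ 3) s (ε / 2) (δ / 18) K₀ σ := by
  have hε0 := hε.1
  have hδ0 := hδ.1
  have he : 2 ≤ ε⁻¹ := by
    rw [le_inv_comm₀ (by norm_num) hε0]
    linarith [hε.2]
  have hd : 2 ≤ δ⁻¹ := by
    rw [le_inv_comm₀ (by norm_num) hδ0]
    linarith [hδ.2]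
  have hB : K₀ * (s / (ε * δ)) = K₀ * s * ε⁻¹ * δ⁻¹ := by field_simp
  set B := K₀ * (s / (ε * δ)) with hBdef
  have h8 : 8 ≤ B := by
    rw [hB]
    calc (8 : ℝ) = 1 * 2 * 2 * 2 := by norm_num
      _ ≤ _ := by gcongr
  have hBK : K₀ ≤ B := by
    rw [hB]
    calc K₀ = K₀ * 1 * 1 * 1 := by ring
      _ ≤ _ := by gcongr <;> linarith
  have hBs : s ≤ B := by
    rw [hB]
    calc s = 1 * s * 1 * 1 := by ring
      _ ≤ _ := by gcongr <;> linarith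
  have hBe : ε⁻¹ ≤ B := by
    rw [hB]
    calc ε⁻¹ = 1 * 1 * ε⁻¹ * 1 := by ring
      _ ≤ _ := by gcongr <;> linarith
  have hBd : δ⁻¹ ≤ B := by
    rw [hB]
    calc δ⁻¹ = 1 * 1 * 1 * δ⁻¹ := by ring
      _ ≤ _ := by gcongr <;> linarith
  have hB3 : B ≤ B ^ 3 := le_self_pow₀ (by linarith) (by norm_num)
  -- The cube in the base pays for the rescaling of `δ` to `δ / 18` and of `ε` to `ε / 2`.
  have h18 : 18 * B ≤ B ^ 3 := by nlinarith [mul_le_mul h8 h8 (by norm_num) (by linarith)]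
  refine ⟨h8, ⟨h8.trans hB3, ⟨by linarith, by linarith [hε.2]⟩, ⟨by linarith, by linarith [hδ.2]⟩,
    ?_, ?_, by linarith, hBs.trans hB3, hσ, (hσs.trans hBs).trans hB3, hBK.trans hB3⟩⟩
  · rw [inv_div, div_eq_mul_inv]
    linarith
  · rw [inv_div, div_eq_mul_inv]
    linarith

theorem exists_samples_regToRL [Fintype S] (hreg : IsRegular ιX ιS Φ) (hO : IsEfficientRL Φ O N K)
    (hxbar : (∃ x, x ∉ Set.range ιX) → xbar ∉ Set.range ιX) (hN₀ : 1 ≤ N₀) (hK₀ : 1 ≤ K₀)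
    (hcN : 1 ≤ cN) (hcK : 0 ≤ cK) (hP : PolyBounded N K N₀ K₀ cN cK (Fintype.card S))
    {C : ℝ} (hC : 504 ≤ C) :
    ∃ Nreg : ℝ → ℝ → ℕ, IsEfficientTwoContext Φ (regToRL O ιX xbar (Fintype.card S)) Nreg ∧
      ∀ ε ∈ Set.Ioo (0 : ℝ) (1 / 2), ∀ δ ∈ Set.Ioo (0 : ℝ) (1 / 2), (Nreg ε δ : ℝ) ≤
        N₀ * (K₀ * ((Fintype.card S : ℝ) / (ε * δ))) ^ (C * cN * (1 + cK)) := by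
  have hcard := two_le_card hreg.2.1
  have hs : (2 : ℝ) ≤ Fintype.card S := by exact_mod_cast hcard
  refine ⟨fun ε δ => ⌊N₀ * (K₀ * ((Fintype.card S : ℝ) / (ε * δ))) ^ (C * cN * (1 + cK))⌋₊,
    isEfficientTwoContext_regToRL hreg hO hxbar fun ε hε δ hδ => ?_, fun ε hε δ hδ => ?_⟩
  swap
  · refine Nat.floor_le ?_
    have := hε.1
    have := hδ.1
    positivity
  -- With only two states there is no base class to fit. The maximum with `1` keeps the parameter
  -- bounds meaningful in that case too.
  have hσs : ((max (Fintype.card S - 2) 1 : ℕ) : ℝ) ≤ Fintype.card S := by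
    exact_mod_cast (by omega : max (Fintype.card S - 2) 1 ≤ Fintype.card S)
  obtain ⟨h8, hb⟩ := paramBound hs (le_max_right (Fintype.card S - 2) 1) hσs hK₀ hε hδ
  set B := K₀ * ((Fintype.card S : ℝ) / (ε * δ)) with hB
  set b := B ^ 3 with hbdef
  set c := (b ^ 12) ^ (1 + cK) with hc
  have hbc : b ^ 12 ≤ c := hb.le_base hcK
  have hb8 := hb.eight_le
  have hb6 : b ^ 6 ≤ c := hb.le_of_pow_le hbc (by norm_num)
  have hc8 : 8 ≤ c := hb8.trans (hb.b_le hbc)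
  have hcm : c ≤ c ^ cN := Real.self_le_rpow_of_one_le (by linarith) hcN
  have hsamples := hb.twoRedSamples_le hP hN₀ hcN hcK hc
  have hB0 : 0 ≤ B := by linarith
  -- `504 = 3 · 12 · 14`, from `b = B ^ 3`, `c = (b ^ 12) ^ (1 + cK)` and the fourteen powers of `c
  -- ^ cN`.
  have hm14 : (c ^ cN) ^ 14 ≤ B ^ (C * cN * (1 + cK)) := by
    have : (c ^ cN) ^ 14 = B ^ (504 * cN * (1 + cK)) := by
      rw [hc, hbdef, ← Real.rpow_mul_natCast (by positivity), ← Real.rpow_mul (by positivity),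
        ← pow_mul, ← Real.rpow_natCast_mul hB0]
      congr 1
      push_cast
      ring
    rw [this]
    refine Real.rpow_le_rpow_of_exponent_le (by linarith) ?_
    gcongr
  set m := c ^ cN with hm
  have hm8 : 8 ≤ m := hc8.trans hcm
  have hm0 : 0 ≤ m := by linarith
  have hε0 := hε.1
  have hδ0 := hδ.1
  have hie := hb.inv_eps
  have hid := hb.inv_del
  have hpe : 0 < (ε / 2)⁻¹ := by positivity
  have hpd : 0 < (δ / 18)⁻¹ := by positivity
  have h72 : 72 / (ε * δ) ≤ b ^ 3 := by
    calc 72 / (ε * δ) = 2 * ((ε / 2)⁻¹ * (δ / 18)⁻¹) := by field_simp; norm_num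
      _ ≤ b * (b * b) := by gcongr; linarith
      _ = b ^ 3 := by ring
  have hb3m : b ^ 3 + 1 ≤ m := by
    have h3 : (8 : ℝ) ^ 3 ≤ b ^ 3 := pow_le_pow_left₀ (by norm_num) hb8 3
    nlinarith
  set t := if 1 ≤ Fintype.card S - 2 then
    twoRedSamples N K (Fintype.card S - 2) (ε / 2) (δ / 18) else 0 with ht
  have htm : (t : ℝ) ≤ N₀ * m ^ 11 := by
    rw [ht]
    split_ifs with h1
    · rwa [max_eq_left h1] at hsamples
    · simp only [Nat.cast_zero]
      positivity
  -- The fourteenth power of `m` pays for the rounding in the definition of `Nreg`.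
  have hfloor : ∀ x : ℝ, x ≤ N₀ * m ^ 13 →
      x ≤ ((⌊N₀ * B ^ (C * cN * (1 + cK))⌋₊ : ℕ) : ℝ) := by
    intro x hx
    have h1 := Nat.lt_floor_add_one (N₀ * B ^ (C * cN * (1 + cK)))
    have h2 : N₀ * m ^ 13 + 1 ≤ N₀ * B ^ (C * cN * (1 + cK)) := by
      calc N₀ * m ^ 13 + 1 ≤ N₀ * m ^ 13 + N₀ * m ^ 13 := by
            gcongr
            exact one_le_mul_of_one_le_of_one_le hN₀ (one_le_pow₀ (by linarith))
        _ = N₀ * (2 * m ^ 13) := by ring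
        _ ≤ N₀ * (m * m ^ 13) := by gcongr; linarith
        _ = N₀ * m ^ 14 := by ring
        _ ≤ _ := by gcongr
    linarith
  refine ⟨t + ⌈72 / (ε * δ)⌉₊, fun h1 => ?_, ?_, hfloor _ ?_, hfloor _ ?_⟩
  · rw [ht, if_pos h1]
    exact Nat.le_add_right _ _
  · push_cast
    exact (Nat.le_ceil _).trans (le_add_of_nonneg_left (Nat.cast_nonneg _))
  · have hceil : ((⌈72 / (ε * δ)⌉₊ : ℕ) : ℝ) ≤ m :=
      (Nat.ceil_lt_add_one (by positivity)).le.trans (by linarith)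
    have hM : ((t + ⌈72 / (ε * δ)⌉₊ : ℕ) : ℝ) ≤ N₀ * (2 * m ^ 11) := by
      push_cast
      calc _ ≤ N₀ * m ^ 11 + 1 * m := by rw [one_mul]; exact add_le_add htm hceil
        _ ≤ N₀ * m ^ 11 + N₀ * m ^ 11 := by
            gcongr
            exact le_self_pow₀ (by linarith) (by norm_num)
        _ = _ := by ring
    have h36 : 36 / ε ≤ b ^ 3 := by
      calc 36 / ε = 18 * (ε / 2)⁻¹ := by field_simp; norm_num
        _ ≤ b ^ 2 * b := by gcongr; nlinarith
        _ = b ^ 3 := by ring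
    calc _ = 36 / ε * ((t + ⌈72 / (ε * δ)⌉₊ : ℕ) : ℝ) := by ring
      _ ≤ m * (N₀ * (2 * m ^ 11)) := by
          gcongr
          linarith
      _ = N₀ * (2 * m ^ 12) := by ring
      _ ≤ N₀ * (m * m ^ 12) := by gcongr; linarith
      _ = N₀ * m ^ 13 := by ring
  · calc 23328 / (ε ^ 2 * δ) = 324 * ((ε / 2)⁻¹ ^ 2 * (δ / 18)⁻¹) := by field_simp; norm_num
      _ ≤ b ^ 3 * (b ^ 2 * b) := by
          gcongr
          nlinarith [pow_le_pow_left₀ (by norm_num) hb8 3]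
      _ = b ^ 6 := by ring
      _ ≤ 1 * m := by linarith
      _ ≤ N₀ * m ^ 13 := by
          gcongr
          exact le_self_pow₀ (by linarith) (by norm_num)

theorem runsInTime_of_polyBounded [Fintype S] (hreg : IsRegular ιX ιS Φ)
    (hO : IsEfficientRL Φ O N K) (hxbar : (∃ x, x ∉ Set.range ιX) → xbar ∉ Set.range ιX)
    (hK₀ : 1 ≤ K₀) (hcK : 0 ≤ cK) (hP : PolyBounded N K N₀ K₀ cN cK (Fintype.card S)) {C : ℝ}
    (hC : 1440 ≤ C) :
    RunsInTime Φ (regToRL O ιX xbar (Fintype.card S))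
      (fun n ε δ => ((n : ℝ) + 1) *
        (K₀ * ((Fintype.card S : ℝ) / (ε * δ))) ^ (C * (1 + cK) ^ 2))
      (fun ε δ => (K₀ * ((Fintype.card S : ℝ) / (ε * δ))) ^ (C * (1 + cK) ^ 2)) := by
  have hcard := two_le_card hreg.2.1
  have hs : (2 : ℝ) ≤ Fintype.card S := by exact_mod_cast hcard
  refine runsInTime_regToRL hreg hO hxbar fun ε hε δ hδ => ?_
  have hσs : ((max (Fintype.card S - 2) 1 : ℕ) : ℝ) ≤ Fintype.card S := by
    exact_mod_cast (by omega : max (Fintype.card S - 2) 1 ≤ Fintype.card S)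
  obtain ⟨h8, hb⟩ := paramBound hs (le_max_right (Fintype.card S - 2) 1) hσs hK₀ hε hδ
  set B := K₀ * ((Fintype.card S : ℝ) / (ε * δ)) with hB
  set b := B ^ 3 with hbdef
  set c := (b ^ 12) ^ (1 + cK) with hc
  have hbc : b ^ 12 ≤ c := hb.le_base hcK
  have hb8 := hb.eight_le
  have hc8 : 8 ≤ c := hb8.trans (hb.b_le hbc)
  have hB0 : 0 ≤ B := by linarith
  have hc0 : 0 ≤ c := by linarith
  have hD8 : c ^ 8 ≤ (c ^ 8) ^ (1 + cK) :=
    Real.self_le_rpow_of_one_le (one_le_pow₀ (by linarith)) (by linarith)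
  -- `1440 = 3 · 12 · 8 · 5`. The square of `1 + cK` arises because the inner cover size is a power
  -- of a base that already bounds the outer one.
  have hD5 : ((c ^ 8) ^ (1 + cK)) ^ 5 ≤ B ^ (C * (1 + cK) ^ 2) := by
    have : ((c ^ 8) ^ (1 + cK)) ^ 5 = B ^ (1440 * (1 + cK) ^ 2) := by
      rw [hc, hbdef, ← Real.rpow_mul_natCast (by positivity), ← Real.rpow_mul_natCast (by positivity),
        ← Real.rpow_mul (by positivity), ← pow_mul, ← Real.rpow_natCast_mul hB0]
      congr 1
      push_cast
      ring
    rw [this]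
    refine Real.rpow_le_rpow_of_exponent_le (by linarith) ?_
    gcongr
  set D := (c ^ 8) ^ (1 + cK) with hD
  have hcD : ∀ j : ℕ, j ≤ 8 → c ^ j ≤ D := fun j hj =>
    (pow_le_pow_right₀ (by linarith) hj).trans hD8
  have hcD1 : c ≤ D := by simpa using hcD 1 (by norm_num)
  have h8D : 8 ≤ D := hc8.trans hcD1
  have hk : ((⌊c⌋₊ : ℕ) : ℝ) ≤ D := (Nat.floor_le hc0).trans hcD1
  have hg : ((⌊b ^ 3⌋₊ : ℕ) : ℝ) ≤ D :=
    (Nat.floor_le (by positivity)).trans ((hb.le_of_pow_le hbc (by norm_num)).trans hcD1)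
  have hk' : ((⌊D⌋₊ : ℕ) : ℝ) ≤ D := Nat.floor_le (by linarith)
  have hg' : ((⌊c ^ 3⌋₊ : ℕ) : ℝ) ≤ D :=
    (Nat.floor_le (by positivity)).trans (hcD 3 (by norm_num))
  have hDD : 8 * D ≤ D * D := by gcongr
  refine ⟨⌊c⌋₊, ⌊b ^ 3⌋₊, ⌊D⌋₊, ⌊c ^ 3⌋₊, fun h1 => ?_, fun n => ?_, ?_⟩
  · have := hb.twoRedBounds hP hcK hc
    rwa [max_eq_left h1] at this
  · push_cast
    calc _ ≤ 9 * (((n : ℝ) + 1) * (13 + D * (D + 11 + D * (D + 4)))) := by gcongr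
      _ = ((n : ℝ) + 1) * (9 * (13 + D * (D + 11 + D * (D + 4)))) := by ring
      _ ≤ ((n : ℝ) + 1) * (D * D * D ^ 3) := by
          refine mul_le_mul_of_nonneg_left ?_ (by positivity)
          have h1 : D + 11 + D * (D + 4) ≤ 3 * (D * D) := by nlinarith
          have h2 : D * (D + 11 + D * (D + 4)) ≤ D * (3 * (D * D)) := by gcongr
          have h3 : 13 ≤ D * (D * D) := by nlinarith
          have h4 : 0 ≤ D ^ 3 := by positivity
          have h5 : 36 * D ^ 3 ≤ D * D * D ^ 3 := by
            gcongr
            nlinarith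
          linarith [show D * (D * D) = D ^ 3 by ring, show D * (3 * (D * D)) = 3 * D ^ 3 by ring]
      _ = ((n : ℝ) + 1) * D ^ 5 := by ring
      _ ≤ _ := by gcongr
  · push_cast
    calc _ ≤ 14 + D * (D + 1) + D := by gcongr
      _ ≤ D ^ 3 := by nlinarith
      _ ≤ D ^ 5 := pow_le_pow_right₀ (by linarith) (by norm_num)
      _ ≤ _ := hD5

end Polynomial

end BlockRL

end

theorem mainTheorem2 :
    ∃ C : ℝ, 0 < C ∧
    ∀ (X S : Type) [Fintype S] (ιX : Bool → X) (ιS : Bool → S) (Φ : Set (X → S)),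
      BlockRL.IsRegular ιX ιS Φ →
    ∀ (O : BlockRL.RLOracle X) (N K : ℝ → ℝ → ℕ → ℕ → ℕ),
      BlockRL.IsEfficientRL Φ O N K →
      -- over the base class
      BlockRL.IsEfficientTwoContext (BlockRL.baseClass ιX ιS Φ)
        (BlockRL.twoRedBase O ιX (Fintype.card S - 2))
        (BlockRL.twoRedSamples N K (Fintype.card S - 2)) ∧
      -- over the regular class itself, with polynomially bounded oracle
      ∀ xbar : X, ((∃ x, x ∉ Set.range ιX) → xbar ∉ Set.range ιX) →
      ∀ N₀ K₀ cN cK : ℝ, 1 ≤ N₀ → 1 ≤ K₀ → 1 ≤ cN → 0 ≤ cK →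
      (∀ ε ∈ Set.Ioo (0 : ℝ) (1 / 2), ∀ δ ∈ Set.Ioo (0 : ℝ) (1 / 2),
        ∀ H A : ℕ, 1 ≤ H → 1 ≤ A →
          (N ε δ H A : ℝ) ≤ N₀ * ((H * A * Fintype.card S : ℝ) / (ε * δ)) ^ cN ∧
          (K ε δ H A : ℝ) ≤ K₀ * ((H * A * Fintype.card S : ℝ) / (ε * δ)) ^ cK) →
      (∃ Nreg : ℝ → ℝ → ℕ,
        BlockRL.IsEfficientTwoContext Φ (BlockRL.regToRL O ιX xbar (Fintype.card S)) Nreg ∧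
        ∀ ε ∈ Set.Ioo (0 : ℝ) (1 / 2), ∀ δ ∈ Set.Ioo (0 : ℝ) (1 / 2),
          (Nreg ε δ : ℝ) ≤
            N₀ * (K₀ * ((Fintype.card S : ℝ) / (ε * δ))) ^ (C * cN * (1 + cK))) ∧
      BlockRL.RunsInTime Φ (BlockRL.regToRL O ιX xbar (Fintype.card S))
        (fun n ε δ =>
          ((n : ℝ) + 1) * (K₀ * ((Fintype.card S : ℝ) / (ε * δ))) ^ (C * (1 + cK) ^ 2))
        (fun ε δ =>
          (K₀ * ((Fintype.card S : ℝ) / (ε * δ))) ^ (C * (1 + cK) ^ 2)) := by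
  -- The larger of the two requirements, `504` for the samples and `1440` for the steps.
  refine ⟨1440, by norm_num, fun X S _ ιX ιS Φ hreg O N K hO =>
    ⟨BlockRL.isEfficientTwoContext_twoRedBase hreg hO,
      fun xbar hxbar N₀ K₀ cN cK hN₀ hK₀ hcN hcK hP => ⟨?_, ?_⟩⟩⟩
  · exact BlockRL.exists_samples_regToRL hreg hO hxbar hN₀ hK₀ hcN hcK hP (by norm_num)
  · exact BlockRL.runsInTime_of_polyBounded hreg hO hxbar hK₀ hcK hP le_rfl
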